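/- Write $(x,h)$ for the coordinates of $\mathbb{R}^{n+d}=\mathbb{R}^n\times\mathbb{R}^d$ and $I=\{h=0\}$. For an open set $W\subset\mathbb{R}^{n+d}$ and $s\in\mathbb{R}$, let $E_{s,I}(W)$ be the space of distributions $t\in\mathcal{D}'(W)$ such that for every $p\in I\cap\mathrm{int}(\overline{W})$ there is a smooth chart $\psi:V\to\mathbb{R}^{n+d}$ defined on an open neighbourhood $V\subset\mathrm{int}(\overline{W})$ of $p$ and adapted to $I$ (a point $q\in V$ lies in $I$ if and only if $\psi(q)$ does), such that $\psi(V\cap W)$ is stable under $(x,h)\mapsto(x,\lambda h)$, $0<\lambda\le 1$, and the family $\big(\lambda^{-s}(\psi_*t)(x,\lambda h)\big)_{0<\lambda\le1}$ is bounded in $\mathcal{D}'(\psi(V\cap W))$. Here $u(x,\lambda h)$ is defined by $\langle u(x,\lambda h),\varphi\rangle=\lambda^{-d}\langle u,\varphi(x,\lambda^{-1}h)\rangle$, and bounded means that the pairing with each test function is bounded. Let $U=U_1\times U_2$ with $U_1\subset\mathbb{R}^n$, $U_2\subset\mathbb{R}^d$ open and $U$ stable under $(x,h)\mapsto(x,\lambda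 h)$, $0<\lambda\le1$. Let $\chi\in C^\infty(\mathbb{R}^{n+d})$ be equal to $1$ in a neighbourhood of $I$, such that $(x,h)\mapsto x$ is proper on $\mathrm{supp}\,\chi$ and, if $0\in U_2$, $\mathrm{supp}\,\chi\cap(U_1\times\mathbb{R}^d)\subset U$. Let $s\in\mathbb{R}$, $m=\lfloor -s-d\rfloor$, and for a test function $\varphi$ on $U$ let $$I_m\varphi(x,h)=\varphi(x,h)-\sum_{|\alpha|\le m}\frac{h^\alpha}{\alpha!}\,\partial_h^\alpha\varphi(x,0)$$ (so $I_m\varphi=\varphi$ if $m<0$). Let $E'(U)=E_{s,I}(U)$ if $-s-d\notin\mathbb{N}=\{0,1,2,\dots\}$, and $E'(U)=\bigcap_{s'<s}E_{s',I}(U)$ otherwise. **Theorem.** Let $t\in E_{s,I}(U\setminus I)$. There is a distribution $\overline{t}\in\mathcal{D}'(U)$, the canonical extension of $t$ (associated with $\chi$), given by $$\langle\overline{t},\varphi\rangle=\lim_{\varepsilon\to0^+}\big\langle t,\ (\chi(x,h)-\chi(x,h/\varepsilon))\,I_m\varphi\big\rangle+\langle t,(1-\chi)\varphi\rangle ,\qquad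 \varphi\in\mathcal{D}(U)$$ (that is, $\overline{t}=\lim_{\varepsilon\to0^+}t\,(1-\chi(x,h/\varepsilon))$ if $s+d>0$); it extends $t$ and belongs to $E'(U)$. A distribution $\tilde{t}\in\mathcal{D}'(U)$ is an extension of $t$ belonging to $E'(U)$ if and only if there are distributions $t_\alpha\in\mathcal{D}'(U_1)$, $|\alpha|\le m$, such that $$\tilde{t}(x,h)=\overline{t}(x,h)+\sum_{|\alpha|\le m}t_\alpha(x)\,\partial_h^\alpha\delta_I(h),$$ where $\langle t_\alpha(x)\,\partial_h^\alpha\delta_I(h),\varphi\rangle=(-1)^{|\alpha|}\langle t_\alpha,(\partial_h^\alpha\varphi)(\cdot,0)\rangle$. In particular, if $s+d>0$, the sum is empty and $\overline{t}$ is the only extension of $t$ in $E_{s,I}(U)$. -/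

import Mathlib

open Set Filter TopologicalSpace
open scoped Distributions ContDiff Topology LineDeriv

noncomputable section

namespace TransverseScaling

/-- The space `ℝ^{n+d} = ℝ^n × ℝ^d` with coordinates `(x, h)`. The submanifold `I` is `{h = 0}`. -/
abbrev Space (n d : ℕ) : Type := EuclideanSpace ℝ (Fin n) × EuclideanSpace ℝ (Fin d)

variable {n d : ℕ}

/-- The submanifold `I = {h = 0}`. -/
def planeI (n d : ℕ) : Set (Space n d) := {z | z.2 = 0}

/-- The open set `U ∖ I`. -/
def offI (U : Opens (Space n d)) : Opens (Space n d) :=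
  ⟨(U : Set (Space n d)) \ planeI n d,
    U.isOpen.sdiff (isClosed_eq continuous_snd continuous_const)⟩

lemma mem_offI {U : Opens (Space n d)} {z : Space n d} : z ∈ offI U ↔ z ∈ U ∧ z.2 ≠ 0 := Iff.rfl

/-- The open set `U₁ × U₂`. -/
def box (U₁ : Opens (EuclideanSpace ℝ (Fin n))) (U₂ : Opens (EuclideanSpace ℝ (Fin d))) :
    Opens (Space n d) :=
  ⟨(U₁ : Set (EuclideanSpace ℝ (Fin n))) ×ˢ (U₂ : Set (EuclideanSpace ℝ (Fin d))),
    U₁.isOpen.prod U₂.isOpen⟩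

lemma mem_box {U₁ : Opens (EuclideanSpace ℝ (Fin n))} {U₂ : Opens (EuclideanSpace ℝ (Fin d))}
    {z : Space n d} : z ∈ box U₁ U₂ ↔ z.1 ∈ U₁ ∧ z.2 ∈ U₂ := Iff.rfl

/-! ### Scaling -/

/-- `W` is stable under the scalings `(x, h) ↦ (x, r h)`, `0 < r ≤ 1`. -/
def ScaleStable (W : Opens (Space n d)) : Prop :=
  ∀ z ∈ W, ∀ r ∈ Ioc (0 : ℝ) 1, ((z.1, r • z.2) : Space n d) ∈ W

/-- A smooth function with support in a compact subset of `Ω`, as a test function. -/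
def mkTest {Ω : Opens (Space n d)} (f : Space n d → ℝ) (hf : ContDiff ℝ ∞ f)
    (K : Set (Space n d)) (hK : IsCompact K) (hKΩ : K ⊆ Ω) (hfK : ∀ z, f z ≠ 0 → z ∈ K) :
    𝓓(Ω, ℝ) where
  toFun := f
  contDiff' := hf
  hasCompactSupport' := HasCompactSupport.of_support_subset_isCompact hK hfK
  tsupport_subset' := (closure_minimal hfK hK.isClosed).trans hKΩ

/-- The scaled test function `φ_{1/r} (x, h) = φ (x, h / r)`. -/
def scaleTest {W : Opens (Space n d)} (hW : ScaleStable W) (r : ℝ) (hr : r ∈ Ioc (0 : ℝ) 1)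
    (φ : 𝓓(W, ℝ)) : 𝓓(W, ℝ) :=
  mkTest (fun z => φ (z.1, r⁻¹ • z.2))
    (φ.contDiff.comp (contDiff_fst.prodMk (contDiff_snd.const_smul r⁻¹)))
    ((fun z : Space n d => ((z.1, r • z.2) : Space n d)) '' tsupport φ)
    (φ.hasCompactSupport.isCompact.image
      (continuous_fst.prodMk (continuous_snd.const_smul r)))
    (by
      rintro _ ⟨z, hz, rfl⟩
      exact hW z (φ.tsupport_subset hz) r hr)
    (by
      intro z hz
      refine ⟨(z.1, r⁻¹ • z.2), subset_tsupport _ hz, ?_⟩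
      simp [smul_smul, mul_inv_cancel₀ hr.1.ne'])

/-! ### Charts adapted to `I` and push-forward of distributions -/

/-- A smooth chart `ψ` of `ℝ^{n+d}`, defined on the open set `ψ.source`, in which `I` is given by
`{h = 0}`. -/
structure AdaptedChart (n d : ℕ) extends OpenPartialHomeomorph (Space n d) (Space n d) where
  smooth : ContDiffOn ℝ ∞ toFun source
  smooth_symm : ContDiffOn ℝ ∞ invFun target
  map_I : ∀ z ∈ source, z ∈ planeI n d ↔ toFun z ∈ planeI n d

/-- The open set `ψ(V ∩ U)` where `V` is the domain of the chart `ψ`. -/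
def AdaptedChart.image (ψ : AdaptedChart n d) (U : Opens (Space n d)) : Opens (Space n d) :=
  ⟨ψ.toOpenPartialHomeomorph '' (ψ.source ∩ U),
    ψ.toOpenPartialHomeomorph.isOpen_image_source_inter U.isOpen⟩

lemma contDiff_det : ContDiff ℝ ∞ (fun A : Space n d →L[ℝ] Space n d => A.det) := by
  classical
  let b := Module.finBasis ℝ (Space n d)
  have h : (fun A : Space n d →L[ℝ] Space n d => A.det) =
      fun A => ∑ σ : Equiv.Perm (Fin (Module.finrank ℝ (Space n d))),
        ((Equiv.Perm.sign σ : ℤ) : ℝ) * ∏ i, (b.coord (σ i)).toContinuousLinearMap (A (b i)) := by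
    funext A
    change LinearMap.det (A : Space n d →ₗ[ℝ] Space n d) = _
    rw [← LinearMap.det_toMatrix b, Matrix.det_apply']
    simp [LinearMap.toMatrix_apply]
  rw [h]
  fun_prop

lemma AdaptedChart.det_ne_zero (ψ : AdaptedChart n d) {y : Space n d} (hy : y ∈ ψ.source) :
    (fderiv ℝ ψ.toOpenPartialHomeomorph y).det ≠ 0 := by
  have h1 : DifferentiableAt ℝ ψ.toOpenPartialHomeomorph y :=
    ((ψ.smooth y hy).contDiffAt (ψ.open_source.mem_nhds hy)).differentiableAt (by simp)
  have hy' : ψ.toOpenPartialHomeomorph y ∈ ψ.target := ψ.map_source' hy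
  have h2 : DifferentiableAt ℝ ψ.toOpenPartialHomeomorph.symm (ψ.toOpenPartialHomeomorph y) :=
    ((ψ.smooth_symm _ hy').contDiffAt (ψ.open_target.mem_nhds hy')).differentiableAt (by simp)
  have h3 : (fderiv ℝ ψ.toOpenPartialHomeomorph.symm (ψ.toOpenPartialHomeomorph y)).comp
      (fderiv ℝ ψ.toOpenPartialHomeomorph y) = ContinuousLinearMap.id ℝ (Space n d) := by
    rw [← fderiv_comp y h2 h1]
    have : (ψ.toOpenPartialHomeomorph.symm ∘ ψ.toOpenPartialHomeomorph) =ᶠ[𝓝 y] id := by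
      filter_upwards [ψ.open_source.mem_nhds hy] with z hz
      exact ψ.toOpenPartialHomeomorph.left_inv hz
    rw [this.fderiv_eq, fderiv_id]
  intro h0
  have h4 := congrArg (fun A : Space n d →L[ℝ] Space n d => A.det) h3
  have h5 : (fderiv ℝ ψ.toOpenPartialHomeomorph.symm (ψ.toOpenPartialHomeomorph y)).det *
      (fderiv ℝ ψ.toOpenPartialHomeomorph y).det = 1 := by
    simpa [ContinuousLinearMap.det] using h4
  rw [h0] at h5
  simp at h5

/-- The pull-back `φ ↦ (φ ∘ ψ) |det Dψ|` of test functions, extended by zero outside the domain of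
the chart. It is the transpose of the push-forward of distributions by `ψ`. -/
def AdaptedChart.pullTest (ψ : AdaptedChart n d) (U : Opens (Space n d))
    (φ : 𝓓(ψ.image U, ℝ)) : 𝓓(U, ℝ) :=
  have hsub : ∀ z ∈ tsupport φ, ψ.toOpenPartialHomeomorph.symm z ∈ ψ.source ∩ U ∧
      z ∈ ψ.target := by
    intro z hz
    obtain ⟨y, hy, rfl⟩ := φ.tsupport_subset hz
    rw [ψ.toOpenPartialHomeomorph.left_inv hy.1]
    exact ⟨hy, ψ.map_source' hy.1⟩
  have hK : IsCompact (ψ.toOpenPartialHomeomorph.symm '' tsupport φ) :=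
    φ.hasCompactSupport.isCompact.image_of_continuousOn
      (ψ.toOpenPartialHomeomorph.continuousOn_symm.mono fun z hz => (hsub z hz).2)
  have hne : ∀ y, ψ.source.indicator (fun y => φ (ψ.toOpenPartialHomeomorph y) *
      |(fderiv ℝ ψ.toOpenPartialHomeomorph y).det|) y ≠ 0 →
      y ∈ ψ.toOpenPartialHomeomorph.symm '' tsupport φ := by
    intro y hy
    have hys : y ∈ ψ.source := by
      by_contra h
      exact hy (indicator_of_notMem h _)
    rw [indicator_of_mem hys] at hy
    exact ⟨_, subset_tsupport _ (left_ne_zero_of_mul hy),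
      ψ.toOpenPartialHomeomorph.left_inv hys⟩
  mkTest
    (ψ.source.indicator fun y => φ (ψ.toOpenPartialHomeomorph y) *
      |(fderiv ℝ ψ.toOpenPartialHomeomorph y).det|)
    (by
      rw [contDiff_iff_contDiffAt]
      intro y
      by_cases hy : y ∈ ψ.source
      · have h1 : ContDiffAt ℝ ∞ ψ.toOpenPartialHomeomorph y :=
          (ψ.smooth y hy).contDiffAt (ψ.open_source.mem_nhds hy)
        have h2 : ContDiffAt ℝ ∞
            (fun y => |(fderiv ℝ ψ.toOpenPartialHomeomorph y).det|) y :=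
          (contDiff_det.contDiffAt.comp y (h1.fderiv_right (m := ∞) (by simp))).abs
            (ψ.det_ne_zero hy)
        refine ((φ.contDiff.contDiffAt.comp y h1).mul h2).congr_of_eventuallyEq ?_
        filter_upwards [ψ.open_source.mem_nhds hy] with z hz
        exact indicator_of_mem hz _
      · have hmem : y ∉ ψ.toOpenPartialHomeomorph.symm '' tsupport φ := by
          rintro ⟨z, hz, rfl⟩
          exact hy (hsub z hz).1.1
        refine (contDiffAt_const (c := (0 : ℝ))).congr_of_eventuallyEq ?_
        filter_upwards [hK.isClosed.isOpen_compl.mem_nhds hmem] with z hz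
        by_contra h
        exact hz (hne z h))
    (ψ.toOpenPartialHomeomorph.symm '' tsupport φ) hK
    (by
      rintro _ ⟨z, hz, rfl⟩
      exact (hsub z hz).1.2)
    hne

/-- `⟨r^{-s} (ψ_* t)_r, φ⟩` for a distribution `t` on `U`, where `u_r (x, h) = u (x, r h)`, that is
`⟨u_r, φ⟩ = r^{-d} ⟨u, φ_{1/r}⟩`. -/
def scaledPairing (s : ℝ) {U : Opens (Space n d)} (t : 𝓓'(U, ℂ)) (ψ : AdaptedChart n d)
    (hψ : ScaleStable (ψ.image U)) (r : ℝ) (hr : r ∈ Ioc (0 : ℝ) 1) (φ : 𝓓(ψ.image U, ℝ)) : ℂ :=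
  ((r ^ (-s) * r ^ (-(d : ℝ)) : ℝ) : ℂ) * t (ψ.pullTest U (scaleTest hψ r hr φ))

/-- The space `E_{s,I}(U)` of distributions on `U` that are weakly homogeneous of degree `s`
along `I`: for every `p ∈ I ∩ int (closure U)` there is a chart `ψ : V → ℝ^{n+d}` around `p`,
`V ⊆ int (closure U)`, adapted to `I`, such that `(r^{-s} (ψ_* t)(x, r h))_{0 < r ≤ 1}` is
a bounded family of distributions on `ψ(V ∩ U)`. -/
def weaklyHomogeneous (s : ℝ) (U : Opens (Space n d)) : Set 𝓓'(U, ℂ) :=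
  {t | ∀ p ∈ planeI n d ∩ interior (closure (U : Set (Space n d))),
    ∃ ψ : AdaptedChart n d, p ∈ ψ.source ∧
      ψ.source ⊆ interior (closure (U : Set (Space n d))) ∧
      ∃ hψ : ScaleStable (ψ.image U), ∀ φ : 𝓓(ψ.image U, ℝ), ∃ C : ℝ,
        ∀ (r : ℝ) (hr : r ∈ Ioc (0 : ℝ) 1), ‖scaledPairing s t ψ hψ r hr φ‖ ≤ C}

/-- The space in which the extensions of elements of `E_{s,I}(U ∖ I)` live: it is `E_{s,I}(U)` if
`-s-d ∉ {0, 1, 2, …}`, and the intersection of the `E_{s',I}(U)`, `s' < s`, otherwise. -/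
def extensionSpace (s : ℝ) (U : Opens (Space n d)) : Set 𝓓'(U, ℂ) :=
  {T | ((¬ ∃ k : ℕ, -s - d = k) → T ∈ weaklyHomogeneous s U) ∧
    ((∃ k : ℕ, -s - d = k) → ∀ s' < s, T ∈ weaklyHomogeneous s' U)}

/-- `T ∈ 𝓓'(U)` extends `t ∈ 𝓓'(U ∖ I)`. -/
def IsExtension {U : Opens (Space n d)} (t : 𝓓'(offI U, ℂ)) (T : 𝓓'(U, ℂ)) : Prop :=
  ∀ φ : 𝓓(offI U, ℝ), T (TestFunction.monoCLM ℝ φ) = t φ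

/-! ### Transverse derivatives and layers on `I` -/

/-- The multi-indices `α ∈ ℕ^d` with `|α| ≤ m` (there are none if `m < 0`). -/
def multiIndices (d : ℕ) (m : ℤ) : Finset (Fin d → ℕ) :=
  {α ∈ Fintype.piFinset fun _ : Fin d => Finset.range (m.toNat + 1) | ((∑ j, α j : ℕ) : ℤ) ≤ m}

lemma mem_multiIndices {m : ℤ} {α : Fin d → ℕ} :
    α ∈ multiIndices d m ↔ ((∑ j, α j : ℕ) : ℤ) ≤ m := by
  simp only [multiIndices, Finset.mem_filter, Fintype.mem_piFinset, Finset.mem_range,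
    and_iff_right_iff_imp]
  intro h j
  have := Finset.single_le_sum (f := α) (fun _ _ => Nat.zero_le _) (Finset.mem_univ j)
  omega

/-- The derivative `∂_h^α φ` in the directions transverse to `I`. -/
def transverseDeriv {U : Opens (Space n d)} (α : Fin d → ℕ) (φ : 𝓓(U, ℝ)) : 𝓓(U, ℝ) :=
  (List.finRange d).foldr (fun j g =>
    (fun f : 𝓓(U, ℝ) => ∂_{((0, EuclideanSpace.single j 1) : Space n d)} f)^[α j] g) φ

/-- The restriction `x ↦ φ (x, 0)` to `I` of a test function on `U₁ × U₂`. -/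
def traceTest {U₁ : Opens (EuclideanSpace ℝ (Fin n))} {U₂ : Opens (EuclideanSpace ℝ (Fin d))}
    (φ : 𝓓(box U₁ U₂, ℝ)) : 𝓓(U₁, ℝ) :=
  have h : tsupport (fun x => φ (x, 0)) ⊆ (fun x => ((x, 0) : Space n d)) ⁻¹' tsupport φ :=
    closure_minimal (fun _ hx => subset_tsupport _ hx)
      ((isClosed_tsupport _).preimage (by fun_prop))
  { toFun := fun x => φ (x, 0)
    contDiff' := φ.contDiff.comp (contDiff_id.prodMk contDiff_const)
    hasCompactSupport' := (φ.hasCompactSupport.isCompact.image continuous_fst).of_isClosed_subset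
      (isClosed_tsupport _) fun x hx => ⟨(x, 0), h hx, rfl⟩
    tsupport_subset' := fun _ hx => (φ.tsupport_subset (h hx)).1 }

/-- The pairing of the distribution `c(x) ∂_h^α δ_I(h)` on `U₁ × U₂`, for `c ∈ 𝓓'(U₁)`, with `φ`:
it is `(-1)^{|α|} ⟨c, (∂_h^α φ)(·, 0)⟩`. -/
def layerPairing {U₁ : Opens (EuclideanSpace ℝ (Fin n))}
    {U₂ : Opens (EuclideanSpace ℝ (Fin d))} (c : 𝓓'(U₁, ℂ)) (α : Fin d → ℕ)
    (φ : 𝓓(box U₁ U₂, ℝ)) : ℂ :=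
  (-1) ^ (∑ j, α j) * c (traceTest (transverseDeriv α φ))

/-! ### The canonical extension -/

/-- Cut-off functions: `χ` is smooth, equal to `1` in a neighbourhood of `I`, the projection
`(x, h) ↦ x` is proper on the support of `χ`, and, over `U₁`, the support of `χ` is contained in
`U₁ × U₂` (as soon as `U₁ × U₂` can meet `I`). -/
structure IsCutoff (U₁ : Opens (EuclideanSpace ℝ (Fin n)))
    (U₂ : Opens (EuclideanSpace ℝ (Fin d))) (χ : Space n d → ℝ) : Prop where
  smooth : ContDiff ℝ ∞ χ
  eq_one : ∀ p ∈ planeI n d, ∀ᶠ z in 𝓝 p, χ z = 1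
  proper : ∀ K : Set (EuclideanSpace ℝ (Fin n)), IsCompact K →
    IsCompact (tsupport χ ∩ Prod.fst ⁻¹' K)
  support_subset : (0 : EuclideanSpace ℝ (Fin d)) ∈ U₂ →
    ∀ z ∈ tsupport χ, z.1 ∈ U₁ → z.2 ∈ U₂

/-- The Taylor remainder `I_m φ (x, h) = φ (x, h) - ∑_{|α| ≤ m} (h^α / α!) ∂_h^α φ (x, 0)`.
It is `φ` itself if `m < 0`. -/
def taylorRemainder {U : Opens (Space n d)} (m : ℤ) (φ : 𝓓(U, ℝ)) (z : Space n d) : ℝ :=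
  φ z - ∑ α ∈ multiIndices d m,
    (∏ j, z.2 j ^ α j / (α j).factorial) * transverseDeriv α φ (z.1, 0)

lemma contDiff_taylorRemainder {U : Opens (Space n d)} (m : ℤ) (φ : 𝓓(U, ℝ)) :
    ContDiff ℝ ∞ (taylorRemainder m φ) := by
  refine φ.contDiff.sub (ContDiff.sum fun α _ => ContDiff.mul ?_ ?_)
  · refine contDiff_prod fun j _ => ContDiff.div_const (ContDiff.pow ?_ _) _
    fun_prop
  · exact (transverseDeriv α φ).contDiff.comp (contDiff_fst.prodMk contDiff_const)

lemma tsupport_transverseDeriv {U : Opens (Space n d)} (α : Fin d → ℕ) (φ : 𝓓(U, ℝ)) :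
    tsupport (transverseDeriv α φ) ⊆ tsupport φ := by
  have h1 : ∀ (v : Space n d) (f : 𝓓(U, ℝ)), tsupport (∂_{v} f : 𝓓(U, ℝ)) ⊆ tsupport f := by
    intro v f
    refine closure_minimal (fun z hz => ?_) (isClosed_tsupport _)
    by_contra h
    have h0 : f =ᶠ[𝓝 z] fun _ => (0 : ℝ) := notMem_tsupport_iff_eventuallyEq.1 h
    apply hz
    change (TestFunction.lineDerivCLM ℝ v f : 𝓓(U, ℝ)) z = 0
    rw [TestFunction.lineDerivCLM_apply_of_le (by simp), h0.lineDeriv_eq]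
    simp [lineDeriv]
  have h2 : ∀ (v : Space n d) (k : ℕ) (f : 𝓓(U, ℝ)),
      tsupport ((fun f : 𝓓(U, ℝ) => ∂_{v} f)^[k] f) ⊆ tsupport f := by
    intro v k
    induction k with
    | zero => intro f; exact subset_rfl
    | succ k ih => intro f; exact (ih _).trans (h1 v f)
  unfold transverseDeriv
  induction List.finRange d with
  | nil => exact subset_rfl
  | cons j l ih => exact (h2 _ _ _).trans ih

variable {U₁ : Opens (EuclideanSpace ℝ (Fin n))} {U₂ : Opens (EuclideanSpace ℝ (Fin d))}
  {χ : Space n d → ℝ}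

/-- The test function `(1 - χ) φ` on `U ∖ I`, where `U = U₁ × U₂`. -/
def outerTest (hχ : IsCutoff U₁ U₂ χ) (φ : 𝓓(box U₁ U₂, ℝ)) : 𝓓(offI (box U₁ U₂), ℝ) where
  toFun z := (1 - χ z) * φ z
  contDiff' := (contDiff_const.sub hχ.smooth).mul φ.contDiff
  hasCompactSupport' := φ.hasCompactSupport.mul_left
  tsupport_subset' := by
    intro z hz
    refine ⟨φ.tsupport_subset (tsupport_mul_subset_right hz), fun hI => ?_⟩
    refine notMem_tsupport_iff_eventuallyEq.2 ?_ hz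
    filter_upwards [hχ.eq_one z hI] with w hw
    simp [hw]

/-- The test function `(χ(x, h) - χ(x, h / ε)) I_m φ (x, h)` on `U ∖ I`, where `U = U₁ × U₂`. -/
def innerTest (hU : ScaleStable (box U₁ U₂)) (hχ : IsCutoff U₁ U₂ χ) (m : ℤ) (ε : ℝ)
    (hε : ε ∈ Ioc (0 : ℝ) 1) (φ : 𝓓(box U₁ U₂, ℝ)) : 𝓓(offI (box U₁ U₂), ℝ) :=
  have hS : Continuous fun z : Space n d => ((z.1, ε • z.2) : Space n d) := by fun_prop
  have hS' : Continuous fun z : Space n d => ((z.1, ε⁻¹ • z.2) : Space n d) := by fun_prop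
  have hK₀ : IsCompact (Prod.fst '' (tsupport φ ∩ planeI n d)) :=
    (φ.hasCompactSupport.isCompact.inter_right
      (isClosed_eq continuous_snd continuous_const)).image continuous_fst
  have hK : IsCompact (tsupport φ ∪
      ((tsupport χ ∩ Prod.fst ⁻¹' (Prod.fst '' (tsupport φ ∩ planeI n d))) ∪
        (fun z : Space n d => ((z.1, ε • z.2) : Space n d)) ''
          (tsupport χ ∩ Prod.fst ⁻¹' (Prod.fst '' (tsupport φ ∩ planeI n d))))) :=
    φ.hasCompactSupport.isCompact.union
      ((hχ.proper _ hK₀).union ((hχ.proper _ hK₀).image hS))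
  have hsupp : ∀ z, (χ z - χ (z.1, ε⁻¹ • z.2)) * taylorRemainder m φ z ≠ 0 →
      z ∈ tsupport φ ∪
      ((tsupport χ ∩ Prod.fst ⁻¹' (Prod.fst '' (tsupport φ ∩ planeI n d))) ∪
        (fun z : Space n d => ((z.1, ε • z.2) : Space n d)) ''
          (tsupport χ ∩ Prod.fst ⁻¹' (Prod.fst '' (tsupport φ ∩ planeI n d)))) := by
    intro z hz
    by_cases h0 : z ∈ tsupport φ
    · exact Or.inl h0
    right
    have hx : ((z.1, 0) : Space n d) ∈ tsupport φ := by
      by_contra hx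
      apply right_ne_zero_of_mul hz
      have : ∀ α : Fin d → ℕ, transverseDeriv α φ (z.1, 0) = 0 := fun α =>
        image_eq_zero_of_notMem_tsupport fun h => hx (tsupport_transverseDeriv α φ h)
      simp [taylorRemainder, this, image_eq_zero_of_notMem_tsupport h0]
    have hx' : z.1 ∈ Prod.fst '' (tsupport φ ∩ planeI n d) := ⟨(z.1, 0), ⟨hx, rfl⟩, rfl⟩
    by_cases h1 : z ∈ tsupport χ
    · exact Or.inl ⟨h1, hx'⟩
    · refine Or.inr ⟨(z.1, ε⁻¹ • z.2), ⟨?_, hx'⟩, ?_⟩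
      · by_contra h2
        apply left_ne_zero_of_mul hz
        rw [image_eq_zero_of_notMem_tsupport h1, image_eq_zero_of_notMem_tsupport h2, sub_zero]
      · simp [smul_smul, mul_inv_cancel₀ hε.1.ne']
  have hsub : tsupport φ ∪
      ((tsupport χ ∩ Prod.fst ⁻¹' (Prod.fst '' (tsupport φ ∩ planeI n d))) ∪
        (fun z : Space n d => ((z.1, ε • z.2) : Space n d)) ''
          (tsupport χ ∩ Prod.fst ⁻¹' (Prod.fst '' (tsupport φ ∩ planeI n d)))) ⊆
      (box U₁ U₂ : Set (Space n d)) := by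
    have hin : ∀ z ∈ tsupport χ ∩ Prod.fst ⁻¹' (Prod.fst '' (tsupport φ ∩ planeI n d)),
        z ∈ box U₁ U₂ := by
      rintro z ⟨hz, w, ⟨hw, hw0⟩, hwz⟩
      have hw' := φ.tsupport_subset hw
      have h1 : z.1 ∈ U₁ := hwz ▸ hw'.1
      have h2 : (0 : EuclideanSpace ℝ (Fin d)) ∈ U₂ := by
        have : w.2 = 0 := hw0
        exact this ▸ hw'.2
      exact ⟨h1, hχ.support_subset h2 z hz h1⟩
    rintro z (hz | hz | ⟨w, hw, rfl⟩)
    · exact φ.tsupport_subset hz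
    · exact hin z hz
    · exact hU w (hin w hw) ε hε
  { toFun := fun z => (χ z - χ (z.1, ε⁻¹ • z.2)) * taylorRemainder m φ z
    contDiff' := (hχ.smooth.sub (hχ.smooth.comp
      (contDiff_fst.prodMk (contDiff_snd.const_smul ε⁻¹)))).mul (contDiff_taylorRemainder m φ)
    hasCompactSupport' := HasCompactSupport.of_support_subset_isCompact hK hsupp
    tsupport_subset' := by
      intro z hz
      refine ⟨hsub (closure_minimal hsupp hK.isClosed hz), fun hI => ?_⟩
      refine notMem_tsupport_iff_eventuallyEq.2 ?_ hz
      have hz0 : z.2 = 0 := hI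
      have hI' : ((z.1, ε⁻¹ • z.2) : Space n d) ∈ planeI n d := by simp [planeI, hz0]
      filter_upwards [hχ.eq_one z hI, hS'.continuousAt.eventually (hχ.eq_one _ hI')] with w h1 h2
      simp [h1, h2] }

/-- `T` is the canonical extension of `t ∈ 𝓓'(U ∖ I)`, `U = U₁ × U₂`, built from the cut-off `χ`:
`⟨T, φ⟩ = lim_{ε → 0} ⟨t (χ - χ_{1/ε}), I_m φ⟩ + ⟨t (1 - χ), φ⟩`, where `χ_{1/ε}(x, h) = χ(x, h/ε)`
and `m` is the integer part of `-s-d`. If `s + d > 0` then `I_m φ = φ` and this says that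
`T = lim_{ε → 0} t (1 - χ_{1/ε})`. -/
def IsCanonicalExtension (hU : ScaleStable (box U₁ U₂)) (hχ : IsCutoff U₁ U₂ χ) (s : ℝ)
    (t : 𝓓'(offI (box U₁ U₂), ℂ)) (T : 𝓓'(box U₁ U₂, ℂ)) : Prop :=
  ∀ φ : 𝓓(box U₁ U₂, ℝ),
    Tendsto (fun ε : Ioc (0 : ℝ) 1 =>
      t (innerTest hU hχ ⌊-s - d⌋ ε ε.2 φ) + t (outerTest hχ φ))
      (comap Subtype.val (𝓝 0)) (𝓝 (T φ))

end TransverseScaling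

end

open TransverseScaling

noncomputable section

namespace TransverseScaling

/-! Write `dil r f` for `f (x, h / r)`. The proof replaces weak homogeneity by the estimate `|t (dil
r f)| ≤ C r^(s+d)` in the given coordinates (`StdBounded`). If `ψ` is an adapted chart, the
transverse component of `ψ (x, r h)` vanishes at `r = 0`, so by Hadamard's lemma `ψ ∘ scal r = scal
r ∘ Ψ_r` with `Ψ_r` smooth up to `r = 0` (`exists_blowup`). Hence `dil r f` is the scaled pull-back
through `ψ` of a test function that depends on `r` but stays in a bounded set. Banach–Steinhaus
(`uniform_bound`) makes the bounds for single test functions uniform on bounded sets, and the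
estimate follows near each point of `I` (`exists_local_bound`). A partition of unity in `x` makes it
global (`stdBounded_of_local`).

The engine is a shell estimate (`exists_dyadic_bound`). Suppose `Φ (x, r h) = r^k M (r, x, h)` with
`M` smooth. The part of `Φ` between the cut-offs at scales `q` and `q / ν`, `1 ≤ ν ≤ 2`, is `q^k`
times a dilation by `q` of a function from a bounded set of test functions off `I`, so `t` is
`O(q^(k+s+d))` on it. For a positive exponent the dyadic sum converges; for a negative one it is
dominated by its last term. The Taylor remainder `I_m φ` has `k = (m+1).toNat`
(`exists_taylorRemainder`), and the choice of `m` makes `k + s + d > 0`. This gives the limit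
defining the canonical extension; it is a distribution, again by Banach–Steinhaus.

For the degree of the extension, apply the approximations to `dil r φ` (`approximation_scaleTest`).
Two terms are `O(r^(s+d))`. The others are `r^(-|α|)` times `t` on `h^α / α! ∂_h^α φ(x, 0)` cut off
between scales `1` and `r`, where the shell exponent is `|α| + s + d ≤ 0`. If it is negative they
are `O(r^(s+d))` too. If it is zero, summing equal bounds over the shells may cost a logarithm,
which is why `s` is lowered to `s' < s` when `-s-d` is a natural number.

For the classification, a difference `S` of two extensions vanishes on test functions off `I` and
still satisfies a scaling bound, so it kills `χ I_m φ` (`StdBounded.pair_cutoff_mul_eq_zero`). Only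
the Taylor polynomial contributes, and its coefficients give the layers (`exists_layers`).
Conversely, scaling multiplies a layer of order `α` by `r^(-|α|)`, which the bound allows for `|α| ≤
m`. If `0 ∉ U₂`, the open sets `U ∖ I` and `U` coincide. -/

section

/-! ### Bounded sets of test functions and uniform boundedness. -/

section TestFunctions

variable {E : Type*} [NormedAddCommGroup E] [NormedSpace ℝ E] {W : Opens E}
  {F : Type*} [NormedAddCommGroup F] [NormedSpace ℝ F]

/-- `f` is a smooth function with compact support in `W`. -/
structure IsTest (W : Opens E) (f : E → ℝ) : Prop where
  contDiff : ContDiff ℝ ∞ f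
  hasCompactSupport : HasCompactSupport f
  tsupport_subset : tsupport f ⊆ W

/-- The bundled test function. -/
def IsTest.toTest {f : E → ℝ} (h : IsTest W f) : 𝓓(W, ℝ) :=
  ⟨f, h.contDiff, h.hasCompactSupport, h.tsupport_subset⟩

@[simp] lemma IsTest.coe_toTest {f : E → ℝ} (h : IsTest W f) : (h.toTest : E → ℝ) = f := rfl

lemma isTest_coe (φ : 𝓓(W, ℝ)) : IsTest W φ :=
  ⟨φ.contDiff, φ.hasCompactSupport, φ.tsupport_subset⟩

lemma IsTest.of_support {f : E → ℝ} (hf : ContDiff ℝ ∞ f) {K : Set E} (hK : IsCompact K)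
    (hKW : K ⊆ W) (h : ∀ z, f z ≠ 0 → z ∈ K) : IsTest W f :=
  ⟨hf, HasCompactSupport.of_support_subset_isCompact hK h,
    (closure_minimal h hK.isClosed).trans hKW⟩

lemma IsTest.mono {W' : Opens E} (h : (W : Set E) ⊆ W') {f : E → ℝ} (hf : IsTest W f) :
    IsTest W' f :=
  ⟨hf.contDiff, hf.hasCompactSupport, hf.tsupport_subset.trans h⟩

lemma isTest_zero : IsTest W (fun _ => (0 : ℝ)) :=
  .of_support contDiff_const isCompact_empty (empty_subset _) fun _ h => (h rfl).elim

lemma IsTest.add {f g : E → ℝ} (hf : IsTest W f) (hg : IsTest W g) :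
    IsTest W (fun z => f z + g z) := isTest_coe (hf.toTest + hg.toTest)

lemma IsTest.sub {f g : E → ℝ} (hf : IsTest W f) (hg : IsTest W g) :
    IsTest W (fun z => f z - g z) := isTest_coe (hf.toTest - hg.toTest)

lemma IsTest.smul {f : E → ℝ} (hf : IsTest W f) (c : ℝ) :
    IsTest W (fun z => c * f z) := isTest_coe (c • hf.toTest)

lemma IsTest.mul_left {f : E → ℝ} (hf : IsTest W f) {g : E → ℝ} (hg : ContDiff ℝ ∞ g) :
    IsTest W (fun z => g z * f z) :=
  .of_support (hg.mul hf.contDiff) hf.hasCompactSupport hf.tsupport_subset fun _ h =>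
    subset_tsupport _ (right_ne_zero_of_mul h)

lemma IsTest.sum {ι : Type*} {s : Finset ι} {f : ι → E → ℝ} (hf : ∀ i ∈ s, IsTest W (f i)) :
    IsTest W (fun z => ∑ i ∈ s, f i z) := by
  classical
  induction s using Finset.induction_on with
  | empty => simpa using isTest_zero
  | insert a s ha ih =>
    simp only [Finset.sum_insert ha]
    exact (hf a (by simp)).add (ih fun i hi => hf i (by simp [hi]))

/-- The pairing of a linear form on test functions with a function: it is zero if the function is
not a test function. -/
def pair (T : 𝓓(W, ℝ) →ₗ[ℝ] F) (f : E → ℝ) : F :=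
  open Classical in if h : IsTest W f then T h.toTest else 0

variable (T : 𝓓(W, ℝ) →ₗ[ℝ] F)

lemma pair_of_isTest {f : E → ℝ} (h : IsTest W f) : pair T f = T h.toTest := dif_pos h

@[simp] lemma pair_coe (φ : 𝓓(W, ℝ)) : pair T φ = T φ := pair_of_isTest T (isTest_coe φ)

lemma pair_zero : pair T (fun _ => (0 : ℝ)) = 0 := by
  rw [pair_of_isTest T isTest_zero, ← map_zero T]; rfl

lemma pair_add {f g : E → ℝ} (hf : IsTest W f) (hg : IsTest W g) :
    pair T (fun z => f z + g z) = pair T f + pair T g := by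
  rw [pair_of_isTest T (hf.add hg), pair_of_isTest T hf, pair_of_isTest T hg, ← map_add]; rfl

lemma pair_sub {f g : E → ℝ} (hf : IsTest W f) (hg : IsTest W g) :
    pair T (fun z => f z - g z) = pair T f - pair T g := by
  rw [pair_of_isTest T (hf.sub hg), pair_of_isTest T hf, pair_of_isTest T hg, ← map_sub]; rfl

lemma pair_smul {f : E → ℝ} (hf : IsTest W f) (c : ℝ) :
    pair T (fun z => c * f z) = c • pair T f := by
  rw [pair_of_isTest T (hf.smul c), pair_of_isTest T hf, ← map_smul]; rfl

lemma pair_sum {ι : Type*} {s : Finset ι} {f : ι → E → ℝ} (hf : ∀ i ∈ s, IsTest W (f i)) :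
    pair T (fun z => ∑ i ∈ s, f i z) = ∑ i ∈ s, pair T (f i) := by
  classical
  induction s using Finset.induction_on with
  | empty => simpa using pair_zero T
  | insert a s ha ih =>
    simp only [Finset.sum_insert ha]
    have hs : ∀ i ∈ s, IsTest W (f i) := fun i hi => hf i (by simp [hi])
    rw [pair_add T (hf a (by simp)) (.sum hs), ih hs]

/-- The smooth functions with support in `K` whose derivatives of order `i` are bounded by `B i`. -/
def testSet (K : Set E) (B : ℕ → ℝ) : Set (E → ℝ) :=
  {f | ContDiff ℝ ∞ f ∧ (∀ z, f z ≠ 0 → z ∈ K) ∧ ∀ i z, ‖iteratedFDeriv ℝ i f z‖ ≤ B i}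

lemma isTest_of_mem_testSet {K : Set E} {B : ℕ → ℝ} (hK : IsCompact K) (hKW : K ⊆ W) {f : E → ℝ}
    (hf : f ∈ testSet K B) : IsTest W f := .of_support hf.1 hK hKW hf.2.1

lemma mem_testSet_of_bound {K : Set E} (hK : IsClosed K) {B : ℕ → ℝ} {f : E → ℝ}
    (hf : ContDiff ℝ ∞ f) (h : ∀ z, f z ≠ 0 → z ∈ K)
    (hB : ∀ i, ∀ z ∈ K, ‖iteratedFDeriv ℝ i f z‖ ≤ B i) :
    f ∈ testSet K (fun i => max (B i) 0) := by
  refine ⟨hf, h, fun i z => ?_⟩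
  by_cases hz : z ∈ K
  · exact (hB i z hz).trans (le_max_left _ _)
  · have : f =ᶠ[𝓝 z] fun _ => (0 : ℝ) := by
      filter_upwards [hK.isOpen_compl.mem_nhds hz] with w hw
      by_contra h0
      exact hw (h w h0)
    rw [(this.iteratedFDeriv ℝ i).eq_of_nhds]
    have h0 : iteratedFDeriv ℝ i (fun _ : E => (0 : ℝ)) z = 0 := by
      have := iteratedFDeriv_fun_zero (𝕜 := ℝ) (E := E) (F := ℝ) (n := i)
      exact congrFun this z
    rw [h0, norm_zero]
    exact le_max_right _ _

/-- `T` is bounded on each bounded set of test functions. -/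
def BoundedOnTestSets (T : 𝓓(W, ℝ) →ₗ[ℝ] F) : Prop :=
  ∀ K : Set E, IsCompact K → K ⊆ W → ∀ B : ℕ → ℝ, ∃ C, ∀ f ∈ testSet K B, ‖pair T f‖ ≤ C

variable {T}

/-- Continuity on `𝓓(W)` is tested on each `𝓓_K`. That space is first countable, so there a linear
map which is bounded on bounded sets is continuous. -/
lemma BoundedOnTestSets.continuous (hT : BoundedOnTestSets T) : Continuous T := by
  rw [TestFunction.continuous_iff_continuous_comp]
  intro K hK
  let L : 𝓓_{K}(E, ℝ) →ₗ[ℝ] F :=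
    T ∘ₗ ((TestFunction.ofSupportedInCLM ℝ hK : 𝓓_{K}(E, ℝ) →L[ℝ] 𝓓(W, ℝ)) :
      𝓓_{K}(E, ℝ) →ₗ[ℝ] 𝓓(W, ℝ))
  have hs := ContDiffMapSupportedIn.withSeminorms ℝ E ℝ ⊤ K
  have := hs.firstCountableTopology
  refine LinearMap.continuous_of_locally_bounded L fun s hsb => ?_
  rw [hs.isVonNBounded_iff_seminorm_bounded] at hsb
  choose B hB0 hB using hsb
  obtain ⟨C, hC⟩ := hT K K.isCompact hK B
  rw [NormedSpace.isVonNBounded_iff]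
  refine isBounded_iff_forall_norm_le.2 ⟨C, ?_⟩
  rintro _ ⟨f, hf, rfl⟩
  have hmem : (f : E → ℝ) ∈ testSet (K : Set E) B := by
    refine ⟨f.contDiff, fun z hz => ?_, fun i z => ?_⟩
    · by_contra h
      exact hz (f.zero_on_compl h)
    · exact (ContDiffMapSupportedIn.norm_iteratedFDeriv_apply_le_seminorm_top ℝ).trans
        (hB i f hf).le
  have := hC _ hmem
  rwa [pair_of_isTest T (isTest_of_mem_testSet K.isCompact hK hmem)] at this

lemma boundedOnTestSets_of_continuous (hT : Continuous T) : BoundedOnTestSets T := by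
  intro K hK hKW B
  let K' : Compacts E := ⟨K, hK⟩
  have hs := ContDiffMapSupportedIn.withSeminorms ℝ E ℝ ⊤ K'
  let L : 𝓓_{K'}(E, ℝ) →L[ℝ] F :=
    (⟨T, hT⟩ : 𝓓(W, ℝ) →L[ℝ] F).comp (TestFunction.ofSupportedInCLM ℝ hKW)
  let s : Set 𝓓_{K'}(E, ℝ) := {f | (f : E → ℝ) ∈ testSet K B}
  have hsb : Bornology.IsVonNBounded ℝ s := by
    rw [hs.isVonNBounded_iff_seminorm_bounded]
    intro i
    refine ⟨|B i| + 1, by positivity, fun f hf => ?_⟩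
    refine lt_of_le_of_lt ?_ (lt_add_one _)
    rw [ContDiffMapSupportedIn.seminorm_top_le_iff ℝ (abs_nonneg _)]
    exact fun z _ => (hf.2.2 i z).trans (le_abs_self _)
  have := hsb.image L
  rw [NormedSpace.isVonNBounded_iff] at this
  obtain ⟨C, hC⟩ := isBounded_iff_forall_norm_le.1 this
  refine ⟨C, fun f hf => ?_⟩
  rw [pair_of_isTest T (isTest_of_mem_testSet hK hKW hf)]
  exact hC _ ⟨⟨f, hf.1, fun z hz => by_contra fun h => hz (hf.2.1 z h)⟩, hf, rfl⟩

/-- The series of derivatives of every order converges normally, because the elements of `testSet K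
B` share the bounds `B`. It is used to map `ℓ¹` linearly into test functions. -/
lemma tsum_mem_testSet {K : Set E} {B : ℕ → ℝ} {c : testSet K B → ℝ}
    (hc : Summable fun f => ‖c f‖) :
    (fun z => ∑' f : testSet K B, c f * (f : E → ℝ) z) ∈
      testSet K (fun i => (∑' f, ‖c f‖) * B i) := by
  have hsmooth : ∀ f : testSet K B, ContDiff ℝ ((⊤ : ℕ∞) : ℕ∞ω)
      (fun z => c f * (f : E → ℝ) z) := fun f => contDiff_const.mul f.2.1
  have hbd : ∀ (k : ℕ) (f : testSet K B) (z : E),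
      ‖iteratedFDeriv ℝ k (fun z => c f * (f : E → ℝ) z) z‖ ≤ ‖c f‖ * B k := by
    intro k f z
    have : iteratedFDeriv ℝ k (fun z => c f * (f : E → ℝ) z) z =
        c f • iteratedFDeriv ℝ k (f : E → ℝ) z :=
      iteratedFDeriv_const_smul_apply (a := c f)
        ((f.2.1.of_le (by exact_mod_cast le_top)).contDiffAt)
    rw [this, norm_smul]
    exact mul_le_mul_of_nonneg_left (f.2.2.2 k z) (norm_nonneg _)
  refine ⟨contDiff_tsum (N := ⊤) (v := fun k f => ‖c f‖ * B k) hsmooth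
    (fun k _ => hc.mul_right _) (fun k f z _ => hbd k f z), fun z hz => ?_, fun i z => ?_⟩
  · by_contra h
    apply hz
    have : ∀ f : testSet K B, c f * (f : E → ℝ) z = 0 := fun f => by
      rw [by_contra fun h' => h (f.2.2.1 z h'), mul_zero]
    simp [this]
  · rw [iteratedFDeriv_tsum (N := ⊤) (v := fun k f => ‖c f‖ * B k) hsmooth
      (fun k _ => hc.mul_right _) (fun k f z _ => hbd k f z) (by exact_mod_cast le_top)]
    refine tsum_of_norm_bounded (g := fun f => ‖c f‖ * B i) ?_ fun f => hbd i f z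
    exact hc.hasSum.mul_right _

/-- The uniform boundedness principle for families of linear forms on test functions. -/
theorem uniform_bound {ι : Type*} {T : ι → 𝓓(W, ℝ) →ₗ[ℝ] F} (hT : ∀ k, BoundedOnTestSets (T k))
    (hp : ∀ f, IsTest W f → ∃ C, ∀ k, ‖pair (T k) f‖ ≤ C) {K : Set E} (hK : IsCompact K)
    (hKW : K ⊆ W) (B : ℕ → ℝ) : ∃ C, ∀ k, ∀ f ∈ testSet K B, ‖pair (T k) f‖ ≤ C := by
  classical
  -- Banach–Steinhaus is applied on the Banach space `ℓ¹(testSet K B)` rather than on test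
  -- functions. The map `Φ a = ∑ a_f f` sends its unit ball into `testSet K B`, and unit coordinate
  -- vectors go to the elements of `testSet K B` themselves.
  let X := lp (fun _ : testSet K B => ℝ) 1
  let c : X → testSet K B → ℝ := fun a f => a.1 f
  let Φ : X → E → ℝ := fun a z => ∑' f : testSet K B, c a f * (f : E → ℝ) z
  have hsum : ∀ a : X, Summable fun f => ‖c a f‖ := fun a => by
    simpa using (lp.memℓp a).summable (by simp)
  have hnorm : ∀ a : X, ‖a‖ = ∑' f, ‖c a f‖ := fun a => by
    simpa using lp.norm_eq_tsum_rpow (p := 1) (by simp) a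
  have hmem : ∀ a : X, Φ a ∈ testSet K (fun i => ‖a‖ * B i) := fun a => by
    rw [hnorm]; exact tsum_mem_testSet (hsum a)
  have htest : ∀ a : X, IsTest W (Φ a) := fun a => isTest_of_mem_testSet hK hKW (hmem a)
  have hptsum : ∀ (a : X) (z : E), Summable fun f : testSet K B => c a f * (f : E → ℝ) z := by
    intro a z
    refine ((hsum a).mul_right (B 0)).of_norm_bounded fun f => ?_
    rw [norm_mul]
    refine mul_le_mul_of_nonneg_left ?_ (norm_nonneg _)
    simpa using f.2.2.2 0 z
  have hadd : ∀ a b : X, Φ (a + b) = fun z => Φ a z + Φ b z := by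
    intro a b
    funext z
    rw [← (hptsum a z).tsum_add (hptsum b z)]
    exact tsum_congr fun f => add_mul _ _ _
  have hsmul : ∀ (r : ℝ) (a : X), Φ (r • a) = fun z => r * Φ a z := by
    intro r a
    funext z
    rw [← tsum_mul_left]
    exact tsum_congr fun f => mul_assoc _ _ _
  let L : ι → X →ₗ[ℝ] F := fun k =>
    { toFun := fun a => pair (T k) (Φ a)
      map_add' := fun a b => by rw [hadd, pair_add _ (htest a) (htest b)]
      map_smul' := fun r a => by rw [hsmul, pair_smul _ (htest a)]; rfl }
  have hL : ∀ k, ∃ C, ∀ a, ‖L k a‖ ≤ C * ‖a‖ := by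
    intro k
    obtain ⟨C, hC⟩ := hT k K hK hKW B
    refine ⟨C, fun a => ?_⟩
    rcases eq_or_ne a 0 with rfl | ha
    · simp
    have ha' : ‖a‖ ≠ 0 := norm_ne_zero_iff.2 ha
    have h1 : Φ (‖a‖⁻¹ • a) ∈ testSet K B := by
      have := hmem (‖a‖⁻¹ • a)
      rw [norm_smul, norm_inv, norm_norm, inv_mul_cancel₀ ha'] at this
      simpa using this
    have h2 : L k a = ‖a‖ • L k (‖a‖⁻¹ • a) := by
      rw [← map_smul, smul_smul, mul_inv_cancel₀ ha', one_smul]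
    rw [h2, norm_smul, norm_norm, mul_comm]
    exact mul_le_mul_of_nonneg_right (hC _ h1) (norm_nonneg _)
  obtain ⟨C, hC⟩ := banach_steinhaus
    (g := fun k => LinearMap.mkContinuousOfExistsBound (L k) (hL k)) fun a => hp _ (htest a)
  refine ⟨C, fun k f hf => ?_⟩
  let e : X := lp.single 1 (⟨f, hf⟩ : testSet K B) (1 : ℝ)
  have he : Φ e = f := by
    funext z
    have : ∀ g : testSet K B, g ≠ ⟨f, hf⟩ → c e g * (g : E → ℝ) z = 0 := by
      intro g hg
      have : c e g = 0 := lp.single_apply_ne 1 _ _ hg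
      rw [this, zero_mul]
    change ∑' g : testSet K B, c e g * (g : E → ℝ) z = f z
    rw [tsum_eq_single _ this]
    have : c e ⟨f, hf⟩ = 1 := lp.single_apply_self 1 _ _
    rw [this, one_mul]
  have hen : ‖e‖ = 1 := by
    have := lp.norm_single (E := fun _ : testSet K B => ℝ) (p := 1) (by simp) ⟨f, hf⟩ (1 : ℝ)
    simpa only [norm_one] using this
  calc ‖pair (T k) f‖ = ‖LinearMap.mkContinuousOfExistsBound (L k) (hL k) e‖ := by rw [← he]; rfl
    _ ≤ C := by
      refine (ContinuousLinearMap.le_opNorm _ _).trans ?_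
      rw [hen, mul_one]
      exact hC k

/-- A pointwise limit of a sequence of distributions is continuous. -/
theorem continuous_of_tendsto {T : 𝓓(W, ℝ) →ₗ[ℝ] F} {S : ℕ → 𝓓(W, ℝ) →ₗ[ℝ] F}
    (hS : ∀ k, BoundedOnTestSets (S k))
    (h : ∀ φ, Tendsto (fun k => S k φ) atTop (𝓝 (T φ))) : Continuous T := by
  refine BoundedOnTestSets.continuous fun K hK hKW B => ?_
  have h' : ∀ f, IsTest W f → Tendsto (fun k => pair (S k) f) atTop (𝓝 (pair T f)) := by
    intro f hf
    simp only [pair_of_isTest _ hf]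
    exact h _
  obtain ⟨C, hC⟩ := uniform_bound hS (fun f hf => by
    obtain ⟨C, hC⟩ := isBounded_iff_forall_norm_le.1 (Metric.isBounded_range_of_tendsto _ (h' f hf))
    exact ⟨C, fun k => hC _ ⟨k, rfl⟩⟩) hK hKW B
  exact ⟨C, fun f hf => le_of_tendsto (h' f (isTest_of_mem_testSet hK hKW hf)).norm
    (Eventually.of_forall fun k => hC k f hf)⟩

end TestFunctions

end

section

/-! ### Derivative bounds for compositions and for smooth families. -/

section Bounds

variable {E : Type*} [NormedAddCommGroup E] [NormedSpace ℝ E]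
  {E' : Type*} [NormedAddCommGroup E'] [NormedSpace ℝ E']

/-- Derivative bounds for weighted compositions `m · (g ∘ θ)`, uniform in `g`. -/
lemma exists_bound_mul_comp {V : Set E} (hV : IsOpen V) {θ : E → E'} {m : E → ℝ}
    (hθ : ContDiffOn ℝ ∞ θ V) (hm : ContDiffOn ℝ ∞ m V) {K : Set E} (hK : IsCompact K)
    (hKV : K ⊆ V) (B : ℕ → ℝ) : ∃ B' : ℕ → ℝ, ∀ g : E' → ℝ, ContDiff ℝ ∞ g →
      (∀ i w, ‖iteratedFDeriv ℝ i g w‖ ≤ B i) → ∀ i, ∀ z ∈ K,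
        ‖iteratedFDeriv ℝ i (fun z => m z * g (θ z)) z‖ ≤ B' i := by
  have hu := hV.uniqueDiffOn (𝕜 := ℝ)
  have h1 : ∀ i : ℕ, ∃ C, ∀ z ∈ K, ‖iteratedFDerivWithin ℝ i θ V z‖ ≤ C := fun i =>
    hK.exists_bound_of_continuousOn
      ((hθ.continuousOn_iteratedFDerivWithin (by exact_mod_cast le_top) hu).mono hKV)
  have h2 : ∀ i : ℕ, ∃ C, ∀ z ∈ K, ‖iteratedFDerivWithin ℝ i m V z‖ ≤ C := fun i =>
    hK.exists_bound_of_continuousOn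
      ((hm.continuousOn_iteratedFDerivWithin (by exact_mod_cast le_top) hu).mono hKV)
  choose C1 hC1 using h1
  choose C2 hC2 using h2
  -- The composition estimate wants the `i`-th derivative of `θ` bounded by `D ^ i`; the summand `1`
  -- gives `D ≥ 1`, hence `D ≤ D ^ i` for `i ≥ 1`.
  let D : ℕ → ℝ := fun n => 1 + ∑ i ∈ Finset.range (n + 1), |C1 i|
  let A : ℕ → ℝ := fun n => ∑ i ∈ Finset.range (n + 1), |B i|
  refine ⟨fun n => ∑ i ∈ Finset.range (n + 1), (n.choose i : ℝ) * |C2 i| *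
    (((n - i).factorial : ℝ) * A (n - i) * D (n - i) ^ (n - i)), fun g hg hgB n z hz => ?_⟩
  have hD1 : ∀ n, 1 ≤ D n := fun n => by
    have : 0 ≤ ∑ i ∈ Finset.range (n + 1), |C1 i| := Finset.sum_nonneg fun _ _ => abs_nonneg _
    simp only [D]; linarith
  have hcomp : ∀ k, ‖iteratedFDerivWithin ℝ k (g ∘ θ) V z‖ ≤
      (k.factorial : ℝ) * A k * D k ^ k := by
    intro k
    refine norm_iteratedFDerivWithin_comp_le (N := ∞) (t := univ) hg.contDiffOn hθ
      (by exact_mod_cast le_top) uniqueDiffOn_univ hu (mapsTo_univ _ _) (hKV hz) ?_ ?_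
    · intro i hi
      rw [iteratedFDerivWithin_univ]
      refine (hgB i _).trans ((le_abs_self _).trans ?_)
      exact Finset.single_le_sum (f := fun i => |B i|) (fun _ _ => abs_nonneg _)
        (Finset.mem_range.2 (Nat.lt_succ_of_le hi))
    · intro i hi1 hi
      have h3 : |C1 i| ≤ ∑ i ∈ Finset.range (k + 1), |C1 i| :=
        Finset.single_le_sum (f := fun i => |C1 i|) (fun _ _ => abs_nonneg _)
          (Finset.mem_range.2 (Nat.lt_succ_of_le hi))
      calc _ ≤ |C1 i| := (hC1 i z hz).trans (le_abs_self _)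
        _ ≤ D k := by simp only [D]; linarith
        _ ≤ D k ^ i := le_self_pow₀ (hD1 k) (by omega)
  rw [← iteratedFDerivWithin_of_isOpen n hV (hKV hz)]
  refine (norm_iteratedFDerivWithin_mul_le (N := ∞) hm
    (hg.comp_contDiffOn hθ) hu (hKV hz) (by exact_mod_cast le_top)).trans ?_
  refine Finset.sum_le_sum fun i hi => ?_
  have h4 : ‖iteratedFDerivWithin ℝ i m V z‖ ≤ |C2 i| := (hC2 i z hz).trans (le_abs_self _)
  exact mul_le_mul (mul_le_mul_of_nonneg_left h4 (by positivity)) (hcomp _) (norm_nonneg _)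
    (by positivity)

/-- The weighted composition with a smooth map sends bounded sets of test functions to bounded
sets of test functions. -/
lemma exists_testSet_mul_comp {V : Set E} (hV : IsOpen V) {θ : E → E'} {m : E → ℝ}
    (hθ : ContDiffOn ℝ ∞ θ V) (hm : ContDiffOn ℝ ∞ m V) {K : Set E} (hK : IsCompact K)
    (hKV : K ⊆ V) (K₀ : Set E') (B : ℕ → ℝ) : ∃ B' : ℕ → ℝ, ∀ g ∈ testSet K₀ B,
      ∀ f : E → ℝ, ContDiff ℝ ∞ f → (∀ z, f z ≠ 0 → z ∈ K) →
      (∀ z ∈ V, f z = m z * g (θ z)) → f ∈ testSet K B' := by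
  obtain ⟨B', hB'⟩ := exists_bound_mul_comp hV hθ hm hK hKV B
  refine ⟨_, fun g hg f hf hfK hfV => mem_testSet_of_bound hK.isClosed hf hfK
    (B := B') fun i z hz => ?_⟩
  have : f =ᶠ[𝓝 z] fun z => m z * g (θ z) := by
    filter_upwards [hV.mem_nhds (hKV hz)] with w hw using hfV w hw
  rw [(this.iteratedFDeriv ℝ i).eq_of_nhds]
  exact hB' g hg.1 hg.2.2 i z hz

/-- A jointly smooth family of functions with supports in a fixed compact set is bounded, when the
parameter stays in a compact set. -/
lemma exists_testSet_family {P : Type*} [NormedAddCommGroup P] [NormedSpace ℝ P]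
    {M : P × E → ℝ} (hM : ContDiff ℝ ∞ M) {Λ : Set P} (hΛ : IsCompact Λ) {K : Set E}
    (hK : IsCompact K) : ∃ B : ℕ → ℝ, ∀ p ∈ Λ, (∀ z, M (p, z) ≠ 0 → z ∈ K) →
      (fun z => M (p, z)) ∈ testSet K B := by
  have h : ∀ i : ℕ, ∃ C, ∀ q ∈ Λ ×ˢ K, ‖iteratedFDeriv ℝ i M q‖ ≤ C := fun i =>
    (hΛ.prod hK).exists_bound_of_continuousOn
      (hM.continuous_iteratedFDeriv (by exact_mod_cast le_top)).continuousOn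
  choose C hC using h
  refine ⟨_, fun p hp hs => mem_testSet_of_bound hK.isClosed
    (hM.comp (contDiff_const.prodMk contDiff_id)) hs (B := C) fun i z hz => ?_⟩
  let L : E →L[ℝ] P × E := ContinuousLinearMap.inr ℝ P E
  have h1 : (fun z => M (p, z)) = (fun q => M ((p, 0) + q)) ∘ L := by
    funext z
    simp [L]
  have h2 : ContDiff ℝ ∞ (fun q => M ((p, 0) + q)) :=
    hM.comp (contDiff_const.add contDiff_id)
  rw [h1, L.iteratedFDeriv_comp_right h2 z (by exact_mod_cast le_top),
    iteratedFDeriv_comp_add_left]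
  refine (ContinuousMultilinearMap.norm_compContinuousLinearMap_le _ _).trans ?_
  have h3 : ∏ _j : Fin i, ‖L‖ ≤ 1 :=
    Finset.prod_le_one (fun _ _ => norm_nonneg _) fun _ _ => ContinuousLinearMap.norm_inr_le_one _ _ _
  have h4 : ‖iteratedFDeriv ℝ i M ((p, 0) + L z)‖ ≤ C i := by
    refine hC i _ ?_
    simp [L, hp, hz]
  calc _ ≤ ‖iteratedFDeriv ℝ i M ((p, 0) + L z)‖ * 1 := by gcongr
    _ ≤ C i := by rw [mul_one]; exact h4

end Bounds

/-! ### Integrals with parameters and Hadamard's lemma. -/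

section ParametricIntegral

variable {P : Type*} [NormedAddCommGroup P] [NormedSpace ℝ P]
  {F : Type*} [NormedAddCommGroup F] [NormedSpace ℝ F]

open MeasureTheory in
/-- Smoothness of integrals over `[0, 1]` depending on a parameter. -/
lemma contDiff_integral_unitInterval {g : P × ℝ → F} (hg : ContDiff ℝ ∞ g) :
    ContDiff ℝ ∞ (fun p => ∫ τ in (0 : ℝ)..1, g (p, τ)) := by
  -- The integral is the value at `0` of the convolution of the indicator of `(0, 1]` with `y ↦ b y
  -- • g (p, -y)`. The bump `b` equals `1` on `[-1, 1]` and only serves to make the second factor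
  -- compactly supported.
  let b : ContDiffBump (0 : ℝ) := ⟨1, 2, by norm_num, by norm_num⟩
  have h := contDiffOn_convolution_right_with_param_comp (𝕜 := ℝ) (n := ⊤) (μ := volume)
    (ContinuousLinearMap.lsmul ℝ ℝ : ℝ →L[ℝ] F →L[ℝ] F) (s := (univ : Set P))
    (v := fun _ => (0 : ℝ)) contDiffOn_const (f := indicator (Ioc (0 : ℝ) 1) 1)
    (g := fun p y => b y • g (p, -y)) (k := Metric.closedBall 0 2) isOpen_univ
    (isCompact_closedBall _ _) (fun p y _ hy => by
      have : b y = 0 := by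
        by_contra h
        have h2 : y ∈ tsupport b := subset_tsupport _ h
        rw [b.tsupport_eq] at h2
        exact hy h2
      simp [this])
    ((integrable_indicator_iff measurableSet_Ioc).2
      (integrableOn_const (by simp) (C := (1 : ℝ)))).locallyIntegrable
    (by
      refine ContDiff.contDiffOn ?_
      exact (b.contDiff.comp contDiff_snd).smul (hg.comp (contDiff_fst.prodMk contDiff_snd.neg)))
  rw [contDiffOn_univ] at h
  convert h using 2 with p
  rw [convolution_def, intervalIntegral.integral_of_le zero_le_one,
    ← integral_indicator measurableSet_Ioc]
  congr 1
  funext y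
  by_cases hy : y ∈ Ioc (0 : ℝ) 1
  · have : b (0 - y) = 1 := b.one_of_mem_closedBall (by
      simpa [abs_of_pos hy.1] using hy.2)
    rw [indicator_of_mem hy, indicator_of_mem hy, this]
    simp
  · simp [hy]

/-- A function of `(σ, z)` vanishing for `σ = 0` with derivative `σ^m S(σ, z)` in `σ`, where `S` is
smooth, is of the form `σ^{m+1} R(σ, z)` with `R` smooth. -/
lemma exists_smooth_factor [CompleteSpace F] {r S : ℝ × P → F} (m : ℕ) (hS : ContDiff ℝ ∞ S)
    (h0 : ∀ z, r (0, z) = 0)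
    (hr : ∀ z σ, HasDerivAt (fun σ => r (σ, z)) (σ ^ m • S (σ, z)) σ) :
    ∃ R : ℝ × P → F, ContDiff ℝ ∞ R ∧ ∀ σ z, r (σ, z) = σ ^ (m + 1) • R (σ, z) := by
  -- This is the integral of the derivative of `τ ↦ r (τ σ, z)` over `[0, 1]`, divided by the factor
  -- `σ ^ (m + 1)` that the chain rule produces.
  refine ⟨fun q => ∫ τ in (0 : ℝ)..1, τ ^ m • S (τ * q.1, q.2),
    contDiff_integral_unitInterval (g := fun x : (ℝ × P) × ℝ => x.2 ^ m • S (x.2 * x.1.1, x.1.2))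
      (by fun_prop), fun σ z => ?_⟩
  have hd : ∀ τ ∈ uIcc (0 : ℝ) 1, HasDerivAt (fun τ => r (τ * σ, z))
      (σ ^ (m + 1) • (τ ^ m • S (τ * σ, z))) τ := by
    intro τ _
    have h1 : HasDerivAt (fun τ : ℝ => τ * σ) σ τ := by
      simpa using (hasDerivAt_id τ).mul_const σ
    have h2 := (hr z (τ * σ)).scomp τ h1
    have h4 : σ • (τ * σ) ^ m • S (τ * σ, z) = σ ^ (m + 1) • (τ ^ m • S (τ * σ, z)) := by
      rw [smul_smul, smul_smul]
      congr 1
      ring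
    rw [← h4]
    exact h2
  have h3 := intervalIntegral.integral_eq_sub_of_hasDerivAt hd
    (Continuous.intervalIntegrable (by fun_prop) _ _)
  rw [← intervalIntegral.integral_smul, h3]
  simp [h0]

/-- Hadamard's lemma. -/
lemma exists_smooth_div [CompleteSpace F] {f : ℝ × P → F} (hf : ContDiff ℝ ∞ f)
    (h0 : ∀ z, f (0, z) = 0) :
    ∃ G : ℝ × P → F, ContDiff ℝ ∞ G ∧ ∀ σ z, f (σ, z) = σ • G (σ, z) := by
  obtain ⟨R, hR, h⟩ := exists_smooth_factor (r := f) 0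
    (S := fun q => fderiv ℝ f q (1, 0))
    ((hf.fderiv_right (m := ∞) (by simp)).clm_apply contDiff_const) h0 (by
      intro z σ
      have h1 : HasFDerivAt f (fderiv ℝ f (σ, z)) (σ, z) :=
        (hf.differentiable (by simp) _).hasFDerivAt
      have h2 : HasDerivAt (fun σ : ℝ => (σ, z)) ((1 : ℝ), (0 : P)) σ :=
        (hasDerivAt_id σ).prodMk (hasDerivAt_const σ z)
      rw [pow_zero, one_smul]
      exact h1.comp_hasDerivAt σ h2)
  exact ⟨R, hR, fun σ z => by simpa using h σ z⟩

end ParametricIntegral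

end

section

/-! ### Transposed operators and weighted uniform bounds. -/

section Families

variable {E : Type*} [NormedAddCommGroup E] [NormedSpace ℝ E] {W : Opens E}
  {E' : Type*} [NormedAddCommGroup E'] [NormedSpace ℝ E'] {W' : Opens E'}
  {F : Type*} [NormedAddCommGroup F] [NormedSpace ℝ F]

lemma boundedOnTestSets_distribution (t : 𝓓'(W, ℂ)) :
    BoundedOnTestSets (t : 𝓓(W, ℝ) →ₗ[ℝ] ℂ) := boundedOnTestSets_of_continuous t.cont

lemma BoundedOnTestSets.smul {T : 𝓓(W, ℝ) →ₗ[ℝ] F} (hT : BoundedOnTestSets T) (c : ℝ) :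
    BoundedOnTestSets (c • T) := by
  intro K hK hKW B
  obtain ⟨C, hC⟩ := hT K hK hKW B
  refine ⟨‖c‖ * C, fun f hf => ?_⟩
  have h := isTest_of_mem_testSet hK hKW hf
  rw [pair_of_isTest _ h, LinearMap.smul_apply, norm_smul, ← pair_of_isTest _ h]
  exact mul_le_mul_of_nonneg_left (hC f hf) (norm_nonneg _)

lemma BoundedOnTestSets.add {T S : 𝓓(W, ℝ) →ₗ[ℝ] F} (hT : BoundedOnTestSets T)
    (hS : BoundedOnTestSets S) : BoundedOnTestSets (T + S) := by
  intro K hK hKW B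
  obtain ⟨C, hC⟩ := hT K hK hKW B
  obtain ⟨C', hC'⟩ := hS K hK hKW B
  refine ⟨C + C', fun f hf => ?_⟩
  have h := isTest_of_mem_testSet hK hKW hf
  have h1 := hC f hf
  have h2 := hC' f hf
  rw [pair_of_isTest _ h] at h1 h2 ⊢
  exact (norm_add_le _ _).trans (add_le_add h1 h2)

/-- Transposes of weighted compositions preserve boundedness on bounded sets of test functions. -/
lemma BoundedOnTestSets.comp {T : 𝓓(W, ℝ) →ₗ[ℝ] F} (hT : BoundedOnTestSets T)
    {A : 𝓓(W', ℝ) →ₗ[ℝ] 𝓓(W, ℝ)} {V : Set E} (hV : IsOpen V) {θ : E → E'} {m : E → ℝ}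
    (hθ : ContDiffOn ℝ ∞ θ V) (hm : ContDiffOn ℝ ∞ m V)
    (hA : ∀ φ, ∀ z ∈ V, A φ z = m z * φ (θ z))
    (hs : ∀ K, IsCompact K → K ⊆ W' → ∃ K', IsCompact K' ∧ K' ⊆ V ∧ K' ⊆ W ∧
      ∀ φ : 𝓓(W', ℝ), (∀ w, φ w ≠ 0 → w ∈ K) → ∀ z, A φ z ≠ 0 → z ∈ K') :
    BoundedOnTestSets (T ∘ₗ A) := by
  intro K hK hKW B
  obtain ⟨K', hK', hK'V, hK'W, hAK⟩ := hs K hK hKW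
  obtain ⟨B', hB'⟩ := exists_testSet_mul_comp hV hθ hm hK' hK'V K B
  obtain ⟨C, hC⟩ := hT K' hK' hK'W B'
  refine ⟨C, fun f hf => ?_⟩
  have h := isTest_of_mem_testSet hK hKW hf
  rw [pair_of_isTest _ h]
  have := hC (A h.toTest) (hB' f hf _ (A h.toTest).contDiff (hAK h.toTest hf.2.1)
    (hA h.toTest))
  rwa [pair_coe] at this

/-- Apply `uniform_bound` to the family `(w k)⁻¹ • T k`. In the applications the index is the scale
`r` and the weight is `r ^ (s + d)`. -/
lemma uniform_bound_weight {ι : Type*} {T : ι → 𝓓(W, ℝ) →ₗ[ℝ] F} {w : ι → ℝ}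
    (hw : ∀ k, 0 < w k) (hT : ∀ k, BoundedOnTestSets (T k))
    (hp : ∀ f, IsTest W f → ∃ C, ∀ k, ‖pair (T k) f‖ ≤ C * w k) {K : Set E} (hK : IsCompact K)
    (hKW : K ⊆ W) (B : ℕ → ℝ) :
    ∃ C, 0 ≤ C ∧ ∀ k, ∀ f ∈ testSet K B, ‖pair (T k) f‖ ≤ C * w k := by
  have key : ∀ k f, IsTest W f → ‖pair ((w k)⁻¹ • T k) f‖ = ‖pair (T k) f‖ / w k := by
    intro k f hf
    rw [pair_of_isTest _ hf, pair_of_isTest _ hf, LinearMap.smul_apply, norm_smul, norm_inv,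
      Real.norm_of_nonneg (hw k).le, inv_mul_eq_div]
  obtain ⟨C, hC⟩ := uniform_bound (T := fun k => (w k)⁻¹ • T k) (fun k => (hT k).smul _)
    (fun f hf => by
      obtain ⟨C, hC⟩ := hp f hf
      exact ⟨C, fun k => by rw [key k f hf, div_le_iff₀ (hw k)]; exact hC k⟩) hK hKW B
  refine ⟨max C 0, le_max_right _ _, fun k f hf => ?_⟩
  have := hC k f hf
  rw [key k f (isTest_of_mem_testSet hK hKW hf), div_le_iff₀ (hw k)] at this
  exact this.trans (mul_le_mul_of_nonneg_right (le_max_left _ _) (hw k).le)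

end Families

/-! ### Scaling bounds in the standard coordinates. -/

section Scaling

variable {n d : ℕ} {W : Opens (Space n d)}

/-- The scaled function `f_{1/r} (x, h) = f (x, h / r)`. -/
def dil (r : ℝ) (f : Space n d → ℝ) : Space n d → ℝ := fun z => f (z.1, r⁻¹ • z.2)

lemma dil_dil (r r' : ℝ) (f : Space n d → ℝ) : dil r (dil r' f) = dil (r' * r) f := by
  funext z
  simp [dil, smul_smul, mul_comm]

lemma coe_scaleTest (hW : ScaleStable W) (r : ℝ) (hr : r ∈ Ioc (0 : ℝ) 1) (φ : 𝓓(W, ℝ)) :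
    (scaleTest hW r hr φ : Space n d → ℝ) = dil r φ := rfl

lemma IsTest.dil (hW : ScaleStable W) {r : ℝ} (hr : r ∈ Ioc (0 : ℝ) 1) {f : Space n d → ℝ}
    (hf : IsTest W f) : IsTest W (dil r f) := isTest_coe (scaleTest hW r hr hf.toTest)

/-- Scaling of test functions as a linear map. -/
def scaleLin (hW : ScaleStable W) (r : ℝ) (hr : r ∈ Ioc (0 : ℝ) 1) : 𝓓(W, ℝ) →ₗ[ℝ] 𝓓(W, ℝ) where
  toFun := scaleTest hW r hr
  map_add' _ _ := rfl
  map_smul' _ _ := rfl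

/-- The family `r^{-s} T(x, r h)`, `0 < r ≤ 1`, is bounded. -/
def StdBounded (s : ℝ) (T : 𝓓(W, ℝ) →ₗ[ℝ] ℂ) : Prop :=
  ∀ f, IsTest W f → ∃ C, ∀ r ∈ Ioc (0 : ℝ) 1, ‖pair T (dil r f)‖ ≤ C * r ^ (s + d)

lemma BoundedOnTestSets.scale {T : 𝓓(W, ℝ) →ₗ[ℝ] ℂ} (hT : BoundedOnTestSets T)
    (hW : ScaleStable W) (r : ℝ) (hr : r ∈ Ioc (0 : ℝ) 1) :
    BoundedOnTestSets (T ∘ₗ scaleLin hW r hr) := by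
  refine hT.comp isOpen_univ (θ := fun z => ((z.1, r⁻¹ • z.2) : Space n d)) (m := fun _ => 1)
    (by fun_prop) contDiffOn_const (fun φ z _ => (one_mul _).symm) fun K hK hKW => ?_
  refine ⟨(fun z : Space n d => ((z.1, r • z.2) : Space n d)) '' K, hK.image (by fun_prop),
    subset_univ _, ?_, fun φ hφ z hz => ⟨_, hφ _ hz, ?_⟩⟩
  · rintro _ ⟨z, hz, rfl⟩
    exact hW z (hKW hz) r hr
  · simp [smul_smul, mul_inv_cancel₀ hr.1.ne']

/-- The constant in `StdBounded` depends on the test function. Banach–Steinhaus for the family `T ∘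
scaleLin r` makes it uniform on bounded sets, which is needed because the functions to be scaled
will themselves vary with a scale. -/
lemma StdBounded.uniform {s : ℝ} {T : 𝓓(W, ℝ) →ₗ[ℝ] ℂ} (h : StdBounded s T)
    (hT : BoundedOnTestSets T) (hW : ScaleStable W) {K : Set (Space n d)} (hK : IsCompact K)
    (hKW : K ⊆ W) (B : ℕ → ℝ) : ∃ C, 0 ≤ C ∧ ∀ f ∈ testSet K B, ∀ r ∈ Ioc (0 : ℝ) 1,
      ‖pair T (dil r f)‖ ≤ C * r ^ (s + d) := by
  have key : ∀ (r : Ioc (0 : ℝ) 1) f, IsTest W f →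
      pair (T ∘ₗ scaleLin hW r r.2) f = pair T (dil r f) := fun r f hf => by
    rw [pair_of_isTest _ hf, pair_of_isTest _ (hf.dil hW r.2)]
    rfl
  obtain ⟨C, hC0, hC⟩ := uniform_bound_weight (T := fun r : Ioc (0 : ℝ) 1 => T ∘ₗ scaleLin hW r r.2)
    (w := fun r => (r : ℝ) ^ (s + d)) (fun r => Real.rpow_pos_of_pos r.2.1 _)
    (fun r => hT.scale hW r r.2) (fun f hf => by
      obtain ⟨C, hC⟩ := h f hf
      exact ⟨C, fun r => by rw [key r f hf]; exact hC r r.2⟩) hK hKW B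
  refine ⟨C, hC0, fun f hf r hr => ?_⟩
  rw [← key ⟨r, hr⟩ f (isTest_of_mem_testSet hK hKW hf)]
  exact hC ⟨r, hr⟩ f hf

lemma StdBounded.mono {s s' : ℝ} {T : 𝓓(W, ℝ) →ₗ[ℝ] ℂ} (h : StdBounded s T) (hs : s' ≤ s) :
    StdBounded s' T := by
  intro f hf
  obtain ⟨C, hC⟩ := h f hf
  refine ⟨max C 0, fun r hr => (hC r hr).trans ?_⟩
  exact mul_le_mul (le_max_left _ _)
    (Real.rpow_le_rpow_of_exponent_ge hr.1 hr.2 (by linarith))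
    (Real.rpow_nonneg hr.1.le _) (le_max_right _ _)

lemma StdBounded.add {s : ℝ} {T S : 𝓓(W, ℝ) →ₗ[ℝ] ℂ} (hW : ScaleStable W) (hT : StdBounded s T)
    (hS : StdBounded s S) : StdBounded s (T + S) := by
  intro f hf
  obtain ⟨C, hC⟩ := hT f hf
  obtain ⟨C', hC'⟩ := hS f hf
  refine ⟨C + C', fun r hr => ?_⟩
  have h1 := hC r hr
  have h2 := hC' r hr
  rw [pair_of_isTest _ (hf.dil hW hr)] at h1 h2 ⊢
  rw [add_mul]
  exact (norm_add_le _ _).trans (add_le_add h1 h2)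

lemma StdBounded.smul {s : ℝ} {T : 𝓓(W, ℝ) →ₗ[ℝ] ℂ} (hW : ScaleStable W) (hT : StdBounded s T)
    (c : ℝ) : StdBounded s (c • T) := by
  intro f hf
  obtain ⟨C, hC⟩ := hT f hf
  refine ⟨|c| * C, fun r hr => ?_⟩
  have h1 := hC r hr
  rw [pair_of_isTest _ (hf.dil hW hr)] at h1 ⊢
  rw [LinearMap.smul_apply, norm_smul, mul_assoc]
  exact mul_le_mul_of_nonneg_left h1 (norm_nonneg _)

lemma weaklyHomogeneous_mono {s s' : ℝ} (hs : s' ≤ s) :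
    weaklyHomogeneous s W ⊆ weaklyHomogeneous s' W := by
  intro t ht p hp
  obtain ⟨ψ, h1, h2, hψ, h⟩ := ht p hp
  refine ⟨ψ, h1, h2, hψ, fun φ => ?_⟩
  obtain ⟨C, hC⟩ := h φ
  refine ⟨C, fun r hr => le_trans ?_ (hC r hr)⟩
  unfold scaledPairing
  rw [norm_mul, norm_mul]
  refine mul_le_mul_of_nonneg_right ?_ (norm_nonneg _)
  have h3 : 0 ≤ r ^ (-(d : ℝ)) := Real.rpow_nonneg hr.1.le _
  have h4 : 0 ≤ r ^ (-s') := Real.rpow_nonneg hr.1.le _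
  have h5 : r ^ (-s') ≤ r ^ (-s) :=
    Real.rpow_le_rpow_of_exponent_ge hr.1 hr.2 (by linarith)
  rw [Complex.norm_real, Complex.norm_real, Real.norm_of_nonneg (by positivity),
    Real.norm_of_nonneg (mul_nonneg (h4.trans h5) h3)]
  exact mul_le_mul_of_nonneg_right h5 h3

/-- The identity of an open set as a chart adapted to `I`. -/
def idChart (V : Opens (Space n d)) : AdaptedChart n d where
  toOpenPartialHomeomorph := OpenPartialHomeomorph.ofSet V V.isOpen
  smooth := contDiffOn_id
  smooth_symm := contDiffOn_id
  map_I _ _ := Iff.rfl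

/-- Boundedness of the scaled family in the standard coordinates implies weak homogeneity. -/
lemma StdBounded.weaklyHomogeneous {s : ℝ} {t : 𝓓'(W, ℂ)} (hW : ScaleStable W)
    (h : StdBounded s (t : 𝓓(W, ℝ) →ₗ[ℝ] ℂ)) : t ∈ weaklyHomogeneous s W := by
  intro p hp
  -- The largest domain allowed for a chart. It contains `W`, so the image of `W` in the identity
  -- chart is `W`, and its stability under scaling is the hypothesis `hW`.
  let V : Opens (Space n d) := ⟨interior (closure (W : Set (Space n d))), isOpen_interior⟩
  have hWV : (W : Set (Space n d)) ⊆ V := W.isOpen.subset_interior_closure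
  have him : (idChart V).image W = W := by
    ext z
    constructor
    · rintro ⟨w, ⟨_, hw⟩, rfl⟩
      exact hw
    · exact fun hz => ⟨z, ⟨hWV hz, hz⟩, rfl⟩
  have hψ : ScaleStable ((idChart V).image W) := by rw [him]; exact hW
  refine ⟨idChart V, hp.2, subset_rfl, hψ, fun φ => ?_⟩
  have hφ : IsTest W φ :=
    ⟨φ.contDiff, φ.hasCompactSupport, φ.tsupport_subset.trans (by rw [him])⟩
  obtain ⟨C, hC⟩ := h φ hφ
  refine ⟨C, fun r hr => ?_⟩
  have hpull : (idChart V).pullTest W (scaleTest hψ r hr φ) =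
      (hφ.dil hW hr).toTest := by
    ext z
    change (V : Set (Space n d)).indicator (fun y => dil r φ y *
      |(fderiv ℝ (id : Space n d → Space n d) y).det|) z = dil r φ z
    by_cases hz : z ∈ (V : Set (Space n d))
    · rw [indicator_of_mem hz, fderiv_id]
      simp [ContinuousLinearMap.det]
    · rw [indicator_of_notMem hz]
      by_contra h0
      exact hz (hWV ((hφ.dil hW hr).tsupport_subset (subset_tsupport _ (Ne.symm h0))))
  have h1 := hC r hr
  rw [pair_of_isTest _ (hφ.dil hW hr)] at h1
  unfold scaledPairing
  rw [hpull, norm_mul, Complex.norm_real, ← Real.rpow_add hr.1,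
    Real.norm_of_nonneg (Real.rpow_nonneg hr.1.le _)]
  calc _ ≤ r ^ (-s + -(d : ℝ)) * (C * r ^ (s + d)) :=
        mul_le_mul_of_nonneg_left h1 (Real.rpow_nonneg hr.1.le _)
    _ = C := by
      rw [mul_left_comm, ← Real.rpow_add hr.1, show -s + -(d : ℝ) + (s + d) = 0 by ring,
        Real.rpow_zero, mul_one]

end Scaling

end

/-! ### From an adapted chart to the standard coordinates. -/

section

variable {n d : ℕ} {W : Opens (Space n d)}

/-- The scaling `(x, h) ↦ (x, r h)`. -/
def scal (r : ℝ) (z : Space n d) : Space n d := (z.1, r • z.2)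

lemma scal_injective {r : ℝ} (hr : r ≠ 0) : Function.Injective (scal r : Space n d → Space n d) := by
  intro z w h
  have h1 := congrArg Prod.fst h
  have h2 := congrArg Prod.snd h
  exact Prod.ext h1 (smul_right_injective _ hr h2)

lemma scal_mem_ball {r : ℝ} (hr : r ∈ Icc (0 : ℝ) 1) {p z : Space n d} (hp : p.2 = 0) {δ : ℝ}
    (hz : z ∈ Metric.ball p δ) : scal r z ∈ Metric.ball p δ := by
  rw [Metric.mem_ball, dist_eq_norm, Prod.norm_def, max_lt_iff] at hz ⊢
  refine ⟨hz.1, ?_⟩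
  have h2 := hz.2
  simp only [Prod.snd_sub, hp, sub_zero, scal] at h2 ⊢
  refine lt_of_le_of_lt ?_ h2
  rw [norm_smul, Real.norm_of_nonneg hr.1]
  exact mul_le_of_le_one_left (norm_nonneg _) hr.2

/-- The blow-up `(scal r)⁻¹ ∘ f ∘ scal r` of a smooth map preserving `I` extends smoothly to
`r = 0`. -/
lemma exists_blowup {f : Space n d → Space n d} (hf : ContDiff ℝ ∞ f)
    (h0 : ∀ z, z.2 = 0 → (f z).2 = 0) :
    ∃ Ψ : ℝ × Space n d → Space n d, ContDiff ℝ ∞ Ψ ∧ (∀ r z, scal r (Ψ (r, z)) = f (scal r z)) ∧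
      ∀ r z, z.2 = 0 → (Ψ (r, z)).2 = 0 := by
  have hs : ContDiff ℝ ∞ (fun q : ℝ × Space n d => scal q.1 q.2) := by
    unfold scal; fun_prop
  obtain ⟨G, hG, h⟩ := exists_smooth_div (f := fun q : ℝ × Space n d => (f (scal q.1 q.2)).2)
    (hf.comp hs).snd (fun z => h0 _ (by simp [scal]))
  refine ⟨fun q => ((f (scal q.1 q.2)).1, G q), (hf.comp hs).fst.prodMk hG, fun r z => ?_,
    fun r z hz => ?_⟩
  · exact Prod.ext rfl (h r z).symm
  · have hc : Continuous fun r : ℝ => G (r, z) := by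
      have := hG.continuous
      fun_prop
    -- For `r ≠ 0` divide by `r`; the value at `r = 0` follows by continuity.
    have : (fun r : ℝ => G (r, z)) = fun _ => 0 := by
      refine Continuous.ext_on (dense_compl_singleton (0 : ℝ)) hc continuous_const fun r hr => ?_
      have h1 := h r z
      rw [h0 _ (by simp [scal, hz])] at h1
      exact (smul_eq_zero.1 h1.symm).resolve_left hr
    exact congrFun this r

/-- Local extension of smooth functions by cutting off. -/
lemma exists_smooth_cutoff {E F : Type*} [NormedAddCommGroup E] [NormedSpace ℝ E]
    [FiniteDimensional ℝ E] [NormedAddCommGroup F] [NormedSpace ℝ F] {g : E → F} {O : Set E}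
    (hO : IsOpen O) (hg : ContDiffOn ℝ ∞ g O) {p : E} (hp : p ∈ O) :
    ∃ b : E → ℝ, ContDiff ℝ ∞ (fun z => b z • g z) ∧ (∀ z, b z ≠ 0 → z ∈ O) ∧
      ∀ᶠ z in 𝓝 p, b z = 1 := by
  obtain ⟨ε, hε, hεO⟩ := Metric.isOpen_iff.1 hO p hp
  let b : ContDiffBump p := ⟨ε / 4, ε / 2, by positivity, by linarith⟩
  have hb : tsupport b ⊆ O := by
    rw [b.tsupport_eq]
    exact (Metric.closedBall_subset_ball (by simp only [b]; linarith)).trans hεO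
  refine ⟨b, ?_, fun z hz => hb (subset_tsupport _ hz), b.eventuallyEq_one⟩
  rw [contDiff_iff_contDiffAt]
  intro z
  by_cases hz : z ∈ O
  · exact b.contDiff.contDiffAt.smul ((hg z hz).contDiffAt (hO.mem_nhds hz))
  · refine (contDiffAt_const (c := (0 : F))).congr_of_eventuallyEq ?_
    filter_upwards [(isClosed_tsupport b).isOpen_compl.mem_nhds fun h => hz (hb h)] with w hw
    rw [image_eq_zero_of_notMem_tsupport hw, zero_smul]

namespace AdaptedChart

variable (ψ : AdaptedChart n d)

lemma contDiffOn_abs_det :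
    ContDiffOn ℝ ∞ (fun y => |(fderiv ℝ ψ.toOpenPartialHomeomorph y).det|) ψ.source := by
  intro y hy
  have h1 : ContDiffAt ℝ ∞ ψ.toOpenPartialHomeomorph y :=
    (ψ.smooth y hy).contDiffAt (ψ.open_source.mem_nhds hy)
  exact ((contDiff_det.contDiffAt.comp y (h1.fderiv_right (m := ∞) (by simp))).abs
    (ψ.det_ne_zero hy)).contDiffWithinAt

lemma pullTest_apply (φ : 𝓓(ψ.image W, ℝ)) (z : Space n d) :
    ψ.pullTest W φ z = ψ.source.indicator (fun y => φ (ψ.toOpenPartialHomeomorph y) *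
      |(fderiv ℝ ψ.toOpenPartialHomeomorph y).det|) z := rfl

lemma pullTest_of_mem (φ : 𝓓(ψ.image W, ℝ)) {z : Space n d} (hz : z ∈ ψ.source) :
    ψ.pullTest W φ z = φ (ψ.toOpenPartialHomeomorph z) *
      |(fderiv ℝ ψ.toOpenPartialHomeomorph z).det| := by
  rw [pullTest_apply, indicator_of_mem hz]

lemma pullTest_of_notMem (φ : 𝓓(ψ.image W, ℝ)) {z : Space n d} (hz : z ∉ ψ.source) :
    ψ.pullTest W φ z = 0 := by
  rw [pullTest_apply, indicator_of_notMem hz]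

/-- The transpose of push-forward followed by scaling, as a linear map on test functions. -/
def scaledPull (hψ : ScaleStable (ψ.image W)) (r : ℝ) (hr : r ∈ Ioc (0 : ℝ) 1) :
    𝓓(ψ.image W, ℝ) →ₗ[ℝ] 𝓓(W, ℝ) where
  toFun φ := ψ.pullTest W (scaleTest hψ r hr φ)
  map_add' φ φ' := by
    ext z
    change _ = ψ.pullTest W _ z + ψ.pullTest W _ z
    by_cases hz : z ∈ ψ.source
    · rw [pullTest_of_mem _ _ hz, pullTest_of_mem _ _ hz, pullTest_of_mem _ _ hz, ← add_mul]
      rfl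
    · rw [pullTest_of_notMem _ _ hz, pullTest_of_notMem _ _ hz, pullTest_of_notMem _ _ hz, add_zero]
  map_smul' c φ := by
    ext z
    change _ = c * ψ.pullTest W _ z
    by_cases hz : z ∈ ψ.source
    · rw [pullTest_of_mem _ _ hz, pullTest_of_mem _ _ hz, ← mul_assoc]
      rfl
    · rw [pullTest_of_notMem _ _ hz, pullTest_of_notMem _ _ hz, mul_zero]

lemma scaledPull_apply (hψ : ScaleStable (ψ.image W)) (r : ℝ) (hr : r ∈ Ioc (0 : ℝ) 1)
    (φ : 𝓓(ψ.image W, ℝ)) (z : Space n d) : ψ.scaledPull hψ r hr φ z =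
      ψ.source.indicator (fun y => φ (scal r⁻¹ (ψ.toOpenPartialHomeomorph y)) *
        |(fderiv ℝ ψ.toOpenPartialHomeomorph y).det|) z := rfl

lemma mem_image_iff {w : Space n d} : w ∈ ψ.image W ↔
    w ∈ ψ.target ∧ ψ.toOpenPartialHomeomorph.symm w ∈ W := by
  constructor
  · rintro ⟨y, hy, rfl⟩
    rw [ψ.toOpenPartialHomeomorph.left_inv hy.1]
    exact ⟨ψ.map_source' hy.1, hy.2⟩
  · rintro ⟨h1, h2⟩
    exact ⟨_, ⟨ψ.map_target' h1, h2⟩, ψ.toOpenPartialHomeomorph.right_inv h1⟩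

lemma boundedOnTestSets_scaledPull {T : 𝓓(W, ℝ) →ₗ[ℝ] ℂ} (hT : BoundedOnTestSets T)
    (hψ : ScaleStable (ψ.image W)) (r : ℝ) (hr : r ∈ Ioc (0 : ℝ) 1) :
    BoundedOnTestSets (T ∘ₗ ψ.scaledPull hψ r hr) := by
  have hscal : ContDiff ℝ ∞ (scal r⁻¹ : Space n d → Space n d) := by unfold scal; fun_prop
  refine hT.comp ψ.open_source (θ := fun z => scal r⁻¹ (ψ.toOpenPartialHomeomorph z))
    (hscal.comp_contDiffOn ψ.smooth) ψ.contDiffOn_abs_det (fun φ z hz => ?_) fun K hK hKW => ?_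
  · rw [scaledPull_apply, indicator_of_mem hz, mul_comm]
  · have hr' : ∀ z ∈ scal r '' K, z ∈ ψ.image W := by
      rintro _ ⟨z, hz, rfl⟩
      exact hψ z (hKW hz) r hr
    refine ⟨ψ.toOpenPartialHomeomorph.symm '' (scal r '' K), ?_, ?_, ?_, fun φ hφ z hz => ?_⟩
    · refine (hK.image ?_).image_of_continuousOn
        (ψ.toOpenPartialHomeomorph.continuousOn_symm.mono fun z hz =>
          (ψ.mem_image_iff.1 (hr' z hz)).1)
      unfold scal; fun_prop
    · rintro _ ⟨z, hz, rfl⟩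
      exact ψ.map_target' (ψ.mem_image_iff.1 (hr' z hz)).1
    · rintro _ ⟨z, hz, rfl⟩
      exact (ψ.mem_image_iff.1 (hr' z hz)).2
    · rw [scaledPull_apply] at hz
      have hzs : z ∈ ψ.source := by
        by_contra h
        exact hz (indicator_of_notMem h _)
      rw [indicator_of_mem hzs] at hz
      refine ⟨_, ⟨_, hφ _ (left_ne_zero_of_mul hz), rfl⟩, ?_⟩
      have : scal r (scal r⁻¹ (ψ.toOpenPartialHomeomorph z)) = ψ.toOpenPartialHomeomorph z := by
        simp [scal, smul_smul, mul_inv_cancel₀ hr.1.ne']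
      rw [this]
      exact ψ.toOpenPartialHomeomorph.left_inv hzs

end AdaptedChart

/-- Weak homogeneity in an adapted chart around `p ∈ I` implies boundedness of the scaled family in
the standard coordinates, for test functions supported near `p`. -/
lemma exists_local_bound {s : ℝ} {t : 𝓓'(W, ℂ)} {ψ : AdaptedChart n d}
    (hψ : ScaleStable (ψ.image W))
    (ht : ∀ φ : 𝓓(ψ.image W, ℝ), ∃ C : ℝ, ∀ (r : ℝ) (hr : r ∈ Ioc (0 : ℝ) 1),
      ‖scaledPairing s t ψ hψ r hr φ‖ ≤ C)
    {p : Space n d} (hp : p ∈ ψ.source) (hp0 : p.2 = 0) {A : Prop}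
    (hA : ∀ᶠ z in 𝓝 p, z ∈ W ↔ (A ∨ z.2 ≠ 0)) :
    ∃ δ > 0, ∀ f, IsTest W f → tsupport f ⊆ Metric.ball p δ → ∃ C, ∀ r ∈ Ioc (0 : ℝ) 1,
      ‖pair (t : 𝓓(W, ℝ) →ₗ[ℝ] ℂ) (dil r f)‖ ≤ C * r ^ (s + d) := by
  set e := ψ.toOpenPartialHomeomorph with he
  set q := e p with hq
  have hqt : q ∈ ψ.target := ψ.map_source' hp
  have hqp : e.symm q = p := e.left_inv hp
  have hq0 : q.2 = 0 := (ψ.map_I p hp).1 hp0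
  have hsymmI : ∀ w ∈ ψ.target, w.2 = 0 ↔ (e.symm w).2 = 0 := by
    intro w hw
    have := ψ.map_I (e.symm w) (ψ.map_target' hw)
    have h2 : ψ.toFun (e.symm w) = w := e.right_inv hw
    rw [h2] at this
    exact this.symm
  -- The chart, its inverse and the inverse Jacobian are replaced by globally defined smooth
  -- functions that agree with them near `p` or `q`, so that the blow-ups are defined on the whole
  -- space.
  obtain ⟨b₁, hb₁, hb₁s, hb₁p⟩ := exists_smooth_cutoff ψ.open_source ψ.smooth hp
  obtain ⟨b₂, hb₂, hb₂s, hb₂q⟩ := exists_smooth_cutoff ψ.open_target ψ.smooth_symm hqt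
  have hJ : ContDiffOn ℝ ∞ (fun w => |(fderiv ℝ e (e.symm w)).det|⁻¹) ψ.target := by
    refine ContDiffOn.inv (ψ.contDiffOn_abs_det.comp ψ.smooth_symm fun w hw => ψ.map_target' hw) ?_
    exact fun w hw => abs_ne_zero.2 (ψ.det_ne_zero (ψ.map_target' hw))
  obtain ⟨b₃, hb₃, -, hb₃q⟩ := exists_smooth_cutoff ψ.open_target hJ hqt
  obtain ⟨Ψ, hΨ, hΨs, hΨI⟩ := exists_blowup hb₁ (fun z hz => by
    by_cases h : b₁ z = 0
    · simp [h]
    · have : (ψ.toFun z).2 = 0 := (ψ.map_I z (hb₁s z h)).1 hz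
      exact (congrArg (b₁ z • ·) this).trans (smul_zero _))
  obtain ⟨Θ, hΘ, hΘs, hΘI⟩ := exists_blowup hb₂ (fun z hz => by
    by_cases h : b₂ z = 0
    · simp [h]
    · have : (ψ.invFun z).2 = 0 := (hsymmI z (hb₂s z h)).1 hz
      exact (congrArg (b₂ z • ·) this).trans (smul_zero _))
  -- a ball around `q`
  have hev : ∀ᶠ w in 𝓝 q, w ∈ ψ.target ∧ b₂ w = 1 ∧ b₃ w = 1 ∧
      (e.symm w ∈ W ↔ (A ∨ (e.symm w).2 ≠ 0)) := by
    have hc : Tendsto e.symm (𝓝 q) (𝓝 p) := by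
      have := e.continuousAt_symm hqt
      rwa [ContinuousAt, hqp] at this
    exact (ψ.open_target.eventually_mem hqt).and (hb₂q.and (hb₃q.and (hc.eventually hA)))
  obtain ⟨ε, hε, hball⟩ := Metric.eventually_nhds_iff_ball.1 hev
  let κ : ContDiffBump q := ⟨ε / 4, ε / 2, by positivity, by linarith⟩
  have hκin : ∀ w, κ w ≠ 0 → w ∈ Metric.ball q ε := by
    intro w hw
    have : w ∈ Function.support κ := hw
    rw [κ.support_eq] at this
    exact Metric.ball_subset_ball (by simp only [κ]; linarith) this
  -- a ball around `p`
  have hΨp : ∀ r ∈ Icc (0 : ℝ) 1, Ψ (r, p) = q := by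
    intro r _
    have h1 := hΨs r p
    have h2 : scal r p = p := Prod.ext rfl (by simp [scal, hp0])
    rw [h2, hb₁p.self_of_nhds, one_smul] at h1
    have h3 := congrArg Prod.fst h1
    exact Prod.ext h3 ((hΨI r p hp0).trans hq0.symm)
  have hev' : ∀ᶠ z in 𝓝 p, (z ∈ ψ.source ∧ b₁ z = 1 ∧ (z ∈ W ↔ (A ∨ z.2 ≠ 0))) ∧
      ∀ r ∈ Icc (0 : ℝ) 1, Ψ (r, z) ∈ Metric.ball q (ε / 4) := by
    refine ((ψ.open_source.eventually_mem hp).and (hb₁p.and hA)).and ?_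
    refine isCompact_Icc.eventually_forall_of_forall_eventually fun r hr => ?_
    have h1 : Tendsto (fun x : Space n d × ℝ => Ψ (x.2, x.1)) (𝓝 (p, r)) (𝓝 q) := by
      have : Continuous fun x : Space n d × ℝ => Ψ (x.2, x.1) := by
        have := hΨ.continuous
        fun_prop
      have h2 := this.tendsto (p, r)
      rwa [hΨp r hr] at h2
    exact h1.eventually (Metric.ball_mem_nhds q (by positivity))
  obtain ⟨δ, hδ, hball'⟩ := Metric.eventually_nhds_iff_ball.1 hev'
  have hsub : Metric.ball q (ε / 4) ⊆ Metric.ball q ε := Metric.ball_subset_ball (by linarith)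
  have hΨe : ∀ r ∈ Icc (0 : ℝ) 1, ∀ z ∈ Metric.ball p δ, scal r (Ψ (r, z)) = e (scal r z) := by
    intro r hr z hz
    rw [hΨs, (hball' _ (scal_mem_ball hr hp0 hz)).1.2.1, one_smul]
    rfl
  have hΘe : ∀ r ∈ Icc (0 : ℝ) 1, ∀ w ∈ Metric.ball q ε,
      scal r (Θ (r, w)) = e.symm (scal r w) := by
    intro r hr w hw
    rw [hΘs, (hball _ (scal_mem_ball hr hq0 hw)).2.1, one_smul]
    rfl
  have ha : ∀ r ∈ Ioc (0 : ℝ) 1, ∀ z ∈ Metric.ball p δ, Θ (r, Ψ (r, z)) = z := by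
    intro r hr z hz
    have hr' : r ∈ Icc (0 : ℝ) 1 := ⟨hr.1.le, hr.2⟩
    apply scal_injective hr.1.ne'
    rw [hΘe r hr' _ (hsub ((hball' z hz).2 r hr')), hΨe r hr' z hz]
    exact e.left_inv (hball' _ (scal_mem_ball hr' hp0 hz)).1.1
  -- The value `r = 0` is included by continuity. It is needed for the compact set `K` below, whose
  -- parameter interval is closed.
  have ha' : ∀ r ∈ Icc (0 : ℝ) 1, ∀ z ∈ Metric.ball p δ, Θ (r, Ψ (r, z)) = z := by
    intro r hr z hz
    have hc : IsClosed {r : ℝ | Θ (r, Ψ (r, z)) = z} := by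
      refine isClosed_eq ?_ continuous_const
      have := hΨ.continuous
      have := hΘ.continuous
      fun_prop
    have h1 : Ioc (0 : ℝ) 1 ⊆ {r : ℝ | Θ (r, Ψ (r, z)) = z} := fun r hr => ha r hr z hz
    have h2 := closure_minimal h1 hc
    rw [closure_Ioc zero_ne_one] at h2
    exact h2 hr
  have hb : ∀ r ∈ Ioc (0 : ℝ) 1, ∀ w ∈ Metric.ball q ε, Θ (r, w) ∈ Metric.ball p δ →
      Ψ (r, Θ (r, w)) = w := by
    intro r hr w hw hz
    have hr' : r ∈ Icc (0 : ℝ) 1 := ⟨hr.1.le, hr.2⟩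
    apply scal_injective hr.1.ne'
    rw [hΨe r hr' _ hz, hΘe r hr' w hw]
    exact e.right_inv (hball _ (scal_mem_ball hr' hq0 hw)).1
  refine ⟨δ, hδ, fun f hf hfs => ?_⟩
  -- `M (r, ·)` is designed so that scaling it in the chart and pulling it back, Jacobian included,
  -- gives exactly `dil r f`. It is smooth in `(r, w)` up to `r = 0`, so for `r` in `(0, 1]` it
  -- stays in one bounded set.
  let M : ℝ × Space n d → ℝ := fun x => κ x.2 * f (Θ x) *
    (b₃ (scal x.1 x.2) • |(fderiv ℝ e (e.symm (scal x.1 x.2))).det|⁻¹)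
  have hM : ContDiff ℝ ∞ M := by
    refine ((κ.contDiff.comp contDiff_snd).mul (hf.contDiff.comp hΘ)).mul (hb₃.comp ?_)
    unfold scal; fun_prop
  let K : Set (Space n d) := Ψ '' (Icc (0 : ℝ) 1 ×ˢ tsupport f)
  have hK : IsCompact K := (isCompact_Icc.prod hf.hasCompactSupport).image hΨ.continuous
  have hKW : K ⊆ ψ.image W := by
    rintro _ ⟨⟨r, z⟩, ⟨hr, hz⟩, rfl⟩
    have hzp := hfs hz
    have hw := hball _ (hsub ((hball' z hzp).2 r hr))
    refine ψ.mem_image_iff.2 ⟨hw.1, hw.2.2.2.2 ?_⟩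
    rcases (hball' z hzp).1.2.2.1 (hf.tsupport_subset hz) with h | h
    · exact Or.inl h
    -- `Θ` preserves `I` and inverts `Ψ`, so `Ψ (r, z)` is off `I` when `z` is, also at `r = 0`.
    -- This keeps `K` inside the chart image of `U ∖ I`.
    · refine Or.inr fun h0 => h ?_
      rw [← ha' r hr z hzp]
      exact hΘI _ _ ((hsymmI _ hw.1).2 h0)
  have hMK : ∀ r ∈ Ioc (0 : ℝ) 1, ∀ w, M (r, w) ≠ 0 → w ∈ K := by
    intro r hr w hw
    have h1 := left_ne_zero_of_mul hw
    have h2 := hκin w (left_ne_zero_of_mul h1)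
    have h3 : Θ (r, w) ∈ tsupport f := subset_tsupport _ (right_ne_zero_of_mul h1)
    exact ⟨(r, Θ (r, w)), ⟨⟨hr.1.le, hr.2⟩, h3⟩, hb r hr w h2 (hfs h3)⟩
  obtain ⟨B, hB⟩ := exists_testSet_family hM (isCompact_Icc (a := (0 : ℝ)) (b := 1)) hK
  have hTb := boundedOnTestSets_distribution t
  obtain ⟨C, -, hC⟩ := uniform_bound_weight
    (T := fun r : Ioc (0 : ℝ) 1 => (t : 𝓓(W, ℝ) →ₗ[ℝ] ℂ) ∘ₗ ψ.scaledPull hψ r r.2)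
    (w := fun r => (r : ℝ) ^ (s + d)) (fun r => Real.rpow_pos_of_pos r.2.1 _)
    (fun r => ψ.boundedOnTestSets_scaledPull hTb hψ r r.2) (fun g hg => by
      obtain ⟨C, hC⟩ := ht hg.toTest
      refine ⟨C, fun r => ?_⟩
      have h1 := hC r r.2
      unfold scaledPairing at h1
      rw [norm_mul, Complex.norm_real, ← Real.rpow_add r.2.1,
        Real.norm_of_nonneg (Real.rpow_nonneg r.2.1.le _),
        show -s + -(d : ℝ) = -(s + d) by ring, Real.rpow_neg r.2.1.le, inv_mul_eq_div,
        div_le_iff₀ (Real.rpow_pos_of_pos r.2.1 _)] at h1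
      rw [pair_of_isTest _ hg]
      exact h1) hK hKW B
  refine ⟨C, fun r hr => ?_⟩
  have hr' : r ∈ Icc (0 : ℝ) 1 := ⟨hr.1.le, hr.2⟩
  have hmem := hB r hr' (hMK r hr)
  have htest := isTest_of_mem_testSet hK hKW hmem
  have hmain := hC ⟨r, hr⟩ _ hmem
  rw [pair_of_isTest _ htest] at hmain
  have hinv : ∀ w : Space n d, scal r (scal r⁻¹ w) = w := fun w => by
    simp [scal, smul_smul, mul_inv_cancel₀ hr.1.ne']
  have hid : (ψ.scaledPull hψ r hr htest.toTest : Space n d → ℝ) = dil r f := by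
    funext y
    rw [AdaptedChart.scaledPull_apply]
    change _ = f (scal r⁻¹ y)
    by_cases hy : scal r⁻¹ y ∈ tsupport f
    · set z := scal r⁻¹ y with hz
      have hzp := hfs hy
      have hyz : y = scal r z := (hinv y).symm
      have hys : y ∈ ψ.source := by
        rw [hyz]; exact (hball' _ (scal_mem_ball hr' hp0 hzp)).1.1
      rw [indicator_of_mem hys]
      have h1 : scal r⁻¹ (e y) = Ψ (r, z) := by
        apply scal_injective hr.1.ne'
        rw [hinv, hΨe r hr' z hzp, ← hyz]
      have h2 := (hball' z hzp).2 r hr'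
      have h3 : κ (Ψ (r, z)) = 1 := κ.one_of_mem_closedBall (Metric.ball_subset_closedBall h2)
      have h4 := (hball _ (scal_mem_ball hr' hq0 (hsub h2))).2.2.1
      rw [h1]
      change κ (Ψ (r, z)) * f (Θ (r, Ψ (r, z))) * (b₃ (scal r (Ψ (r, z))) •
        |(fderiv ℝ e (e.symm (scal r (Ψ (r, z))))).det|⁻¹) * |(fderiv ℝ e y).det| = f z
      rw [h3, h4, ha r hr z hzp, hΨe r hr' z hzp, ← hyz, e.left_inv hys, one_mul, one_smul,
        mul_assoc, inv_mul_cancel₀ (abs_ne_zero.2 (ψ.det_ne_zero hys)), mul_one]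
    · rw [image_eq_zero_of_notMem_tsupport hy]
      by_contra h0
      have hys : y ∈ ψ.source := by
        by_contra h
        exact h0 (indicator_of_notMem h _)
      rw [indicator_of_mem hys] at h0
      have h1 : M (r, scal r⁻¹ (e y)) ≠ 0 := left_ne_zero_of_mul h0
      have h2 := left_ne_zero_of_mul h1
      have h3 := hκin _ (left_ne_zero_of_mul h2)
      have h4 : Θ (r, scal r⁻¹ (e y)) ∈ tsupport f := subset_tsupport _ (right_ne_zero_of_mul h2)
      apply hy
      have h5 : scal r (Θ (r, scal r⁻¹ (e y))) = y := by
        rw [hΘe r hr' _ h3, hinv, e.left_inv hys]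
      have h6 : scal r⁻¹ y = Θ (r, scal r⁻¹ (e y)) := by
        apply scal_injective hr.1.ne'
        rw [hinv, h5]
      rwa [h6]
  have h7 := pair_coe (t : 𝓓(W, ℝ) →ₗ[ℝ] ℂ) (ψ.scaledPull hψ r hr htest.toTest)
  rw [hid] at h7
  rw [h7]
  exact hmain

end

/-! ### Globalising the scaling bounds along the submanifold. -/

section

variable {n d : ℕ} {W : Opens (Space n d)}

lemma contDiff_scal (r : ℝ) : ContDiff ℝ ∞ (scal r : Space n d → Space n d) := by
  unfold scal; fun_prop

lemma exists_rpow_lower_bound {r₀ : ℝ} (h0 : 0 < r₀) (a : ℝ) :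
    ∃ c > 0, ∀ r ∈ Icc r₀ 1, c ≤ r ^ a := by
  refine ⟨min 1 (r₀ ^ a), lt_min one_pos (Real.rpow_pos_of_pos h0 _), fun r hr => ?_⟩
  rcases le_total 0 a with ha | ha
  · exact (min_le_right _ _).trans (Real.rpow_le_rpow h0.le hr.1 ha)
  · exact (min_le_left _ _).trans
      (Real.one_le_rpow_of_pos_of_le_one_of_nonpos (h0.trans_le hr.1) hr.2 ha)

/-- The scaled family is bounded as long as the scale stays away from zero. -/
lemma exists_bound_dil_of_le {T : 𝓓(W, ℝ) →ₗ[ℝ] ℂ} (hT : BoundedOnTestSets T)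
    (hW : ScaleStable W) {f : Space n d → ℝ} (hf : IsTest W f) {r₀ : ℝ} (h0 : 0 < r₀) (a : ℝ) :
    ∃ C, 0 ≤ C ∧ ∀ r ∈ Icc r₀ 1, ‖pair T (dil r f)‖ ≤ C * r ^ a := by
  let K : Set (Space n d) := (fun x : ℝ × Space n d => scal x.1 x.2) '' (Icc r₀ 1 ×ˢ tsupport f)
  have hK : IsCompact K := by
    refine (isCompact_Icc.prod hf.hasCompactSupport).image ?_
    unfold scal; fun_prop
  have hKW : K ⊆ W := by
    rintro _ ⟨⟨r, z⟩, ⟨hr, hz⟩, rfl⟩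
    exact hW z (hf.tsupport_subset hz) r ⟨h0.trans_le hr.1, hr.2⟩
  have hM : ContDiff ℝ ∞ (fun x : ℝ × Space n d => f (scal x.1 x.2)) := by
    refine hf.contDiff.comp ?_
    unfold scal; fun_prop
  -- The parameter is `r⁻¹`, which runs through the compact interval `[1, r₀⁻¹]`.
  obtain ⟨B, hB⟩ := exists_testSet_family hM (isCompact_Icc (a := (1 : ℝ)) (b := r₀⁻¹)) hK
  obtain ⟨C, hC⟩ := hT K hK hKW B
  obtain ⟨c, hc, hcr⟩ := exists_rpow_lower_bound h0 a
  refine ⟨max C 0 / c, by positivity, fun r hr => ?_⟩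
  have hr0 : 0 < r := h0.trans_le hr.1
  have hmem := hB r⁻¹ ⟨(one_le_inv₀ hr0).2 hr.2, inv_anti₀ h0 hr.1⟩ fun z hz =>
    ⟨(r, scal r⁻¹ z), ⟨hr, subset_tsupport _ hz⟩, by
      simp [scal, smul_smul, mul_inv_cancel₀ hr0.ne']⟩
  calc ‖pair T (dil r f)‖ ≤ C := hC _ hmem
    _ ≤ max C 0 / c * c := by rw [div_mul_cancel₀ _ hc.ne']; exact le_max_left _ _
    _ ≤ max C 0 / c * r ^ a := by gcongr; exact hcr r hr

open scoped Manifold in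
/-- Boundedness of the scaled family can be checked locally along `I`. -/
lemma stdBounded_of_local {T : 𝓓(W, ℝ) →ₗ[ℝ] ℂ} (hT : BoundedOnTestSets T)
    (hW : ScaleStable W) {s : ℝ}
    (h : ∀ z ∈ W, ∃ δ > 0, ∀ f, IsTest W f → tsupport f ⊆ Metric.ball (z.1, 0) δ → ∃ C,
      ∀ r ∈ Ioc (0 : ℝ) 1, ‖pair T (dil r f)‖ ≤ C * r ^ (s + d)) : StdBounded s T := by
  intro f hf
  have hK := hf.hasCompactSupport.isCompact
  have hK1 : IsCompact (Prod.fst '' tsupport f) := hK.image continuous_fst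
  have h' : ∀ x : EuclideanSpace ℝ (Fin n), ∃ δ > 0, x ∈ Prod.fst '' tsupport f →
      ∀ f, IsTest W f → tsupport f ⊆ Metric.ball (x, 0) δ → ∃ C,
      ∀ r ∈ Ioc (0 : ℝ) 1, ‖pair T (dil r f)‖ ≤ C * r ^ (s + d) := by
    intro x
    by_cases hx : x ∈ Prod.fst '' tsupport f
    · obtain ⟨z, hz, rfl⟩ := hx
      obtain ⟨δ, hδ, H⟩ := h z (hf.tsupport_subset hz)
      exact ⟨δ, hδ, fun _ => H⟩
    · exact ⟨1, one_pos, fun hx' => (hx hx').elim⟩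
  choose δ hδ H using h'
  obtain ⟨F, hFK, hF⟩ := hK1.elim_nhds_subcover (fun x => Metric.ball x (δ x))
    fun x _ => Metric.ball_mem_nhds x (hδ x)
  -- The partition of unity depends on `x` only, so it commutes with the scalings.
  obtain ⟨ρ, hρ⟩ := SmoothPartitionOfUnity.exists_isSubordinate 𝓘(ℝ, EuclideanSpace ℝ (Fin n))
    hK1.isClosed (fun x : F => Metric.ball (x : EuclideanSpace ℝ (Fin n)) (δ x))
    (fun _ => Metric.isOpen_ball) (by simpa only [iUnion_subtype] using hF)
  obtain ⟨R, hR⟩ := hK.exists_bound_of_continuousOn (continuous_snd.continuousOn (s := tsupport f))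
  obtain ⟨c, hc, hcF⟩ : ∃ c > 0, ∀ x ∈ F, c ≤ δ x := by
    rcases F.eq_empty_or_nonempty with rfl | hne
    · exact ⟨1, one_pos, by simp⟩
    · obtain ⟨x, hx, hmin⟩ := F.exists_min_image δ hne
      exact ⟨δ x, hδ x, hmin⟩
  -- After scaling by `r₀` the support is so thin in `h` that each piece fits in its ball around a
  -- point of `I`. Scales `r ≤ r₀` factor through `r₀`; the scales `r ≥ r₀` are harmless.
  obtain ⟨r₀, hr₀, hr₀c⟩ : ∃ r₀ ∈ Ioc (0 : ℝ) 1, r₀ * max R 0 < c := by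
    have hpos : 0 < max R 0 + 1 := by positivity
    refine ⟨min 1 (c / 2 / (max R 0 + 1)), ⟨by positivity, min_le_left _ _⟩, ?_⟩
    calc _ ≤ c / 2 / (max R 0 + 1) * (max R 0 + 1) := by
          gcongr
          · exact min_le_right _ _
          · linarith
      _ = c / 2 := div_mul_cancel₀ _ hpos.ne'
      _ < c := by linarith
  let g : F → Space n d → ℝ := fun i z => ρ i z.1 * f z
  have hρs : ∀ i : F, ContDiff ℝ ∞ (fun z : Space n d => ρ i z.1) := fun i =>
    (ρ i).contMDiff.contDiff.comp contDiff_fst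
  have hg : ∀ i, IsTest W (g i) := fun i => hf.mul_left (hρs i)
  have hgd : ∀ i, IsTest W (dil r₀ (g i)) := fun i => (hg i).dil hW hr₀
  have hsum : ∀ z, f z = ∑ i : F, g i z := by
    intro z
    by_cases hz : z ∈ tsupport f
    · have h1 : ∑ᶠ i, ρ i z.1 = 1 := ρ.sum_eq_one ⟨z, hz, rfl⟩
      rw [finsum_eq_sum_of_fintype] at h1
      simp only [g, ← Finset.sum_mul, h1, one_mul]
    · simp [g, image_eq_zero_of_notMem_tsupport hz]
  have hsupp : ∀ i, tsupport (dil r₀ (g i)) ⊆ Metric.ball ((i : EuclideanSpace ℝ (Fin n)), 0) (δ i) := by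
    intro i
    have hcl : IsClosed {z : Space n d | z.1 ∈ tsupport (ρ i) ∧ ‖z.2‖ ≤ r₀ * max R 0} :=
      ((isClosed_tsupport _).preimage continuous_fst).inter
        (isClosed_le continuous_snd.norm continuous_const)
    refine (closure_minimal (fun z hz => ?_) hcl).trans fun z hz => ?_
    · have h1 : ρ i z.1 * f (z.1, r₀⁻¹ • z.2) ≠ 0 := hz
      refine ⟨subset_tsupport _ (left_ne_zero_of_mul h1), ?_⟩
      have h2 := hR _ (subset_tsupport _ (right_ne_zero_of_mul h1))
      rw [norm_smul, norm_inv, Real.norm_of_nonneg hr₀.1.le, inv_mul_le_iff₀ hr₀.1] at h2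
      exact h2.trans (mul_le_mul_of_nonneg_left (le_max_left _ _) hr₀.1.le)
    · rw [Metric.mem_ball, Prod.dist_eq, max_lt_iff]
      refine ⟨hρ i hz.1, ?_⟩
      rw [dist_zero_right]
      exact hz.2.trans_lt (hr₀c.trans_le (hcF i i.2))
  have hloc : ∀ i : F, ∃ C, ∀ r ∈ Ioc (0 : ℝ) 1, ‖pair T (dil r (dil r₀ (g i)))‖ ≤ C * r ^ (s + d) :=
    fun i => H i (hFK i i.2) _ (hgd i) (hsupp i)
  choose C hC using hloc
  obtain ⟨C', hC'0, hC'⟩ := exists_bound_dil_of_le hT hW hf hr₀.1 (s + d)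
  refine ⟨max (∑ i, C i * (r₀ ^ (s + d))⁻¹) C', fun r hr => ?_⟩
  rcases le_total r₀ r with h1 | h1
  · exact (hC' r ⟨h1, hr.2⟩).trans (mul_le_mul_of_nonneg_right (le_max_right _ _)
      (Real.rpow_nonneg hr.1.le _))
  · refine le_trans ?_ (mul_le_mul_of_nonneg_right (le_max_left _ _) (Real.rpow_nonneg hr.1.le _))
    have h2 : r / r₀ ∈ Ioc (0 : ℝ) 1 := ⟨div_pos hr.1 hr₀.1, (div_le_one hr₀.1).2 h1⟩
    have h3 : dil r f = fun z => ∑ i : F, dil (r / r₀) (dil r₀ (g i)) z := by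
      funext z
      simp only [dil_dil, mul_div_cancel₀ r hr₀.1.ne']
      exact hsum _
    rw [h3, pair_sum T fun i _ => (hgd i).dil hW h2, Finset.sum_mul]
    refine (norm_sum_le _ _).trans (Finset.sum_le_sum fun i _ => (hC i _ h2).trans_eq ?_)
    rw [Real.div_rpow hr.1.le hr₀.1.le]
    ring

lemma scaleStable_offI {U : Opens (Space n d)} (hU : ScaleStable U) : ScaleStable (offI U) :=
  fun z hz r hr => ⟨hU z hz.1 r hr, fun h => hz.2 ((smul_eq_zero.1 h).resolve_left hr.1.ne')⟩

/-- Weakly homogeneous distributions have bounded scaled families in the standard coordinates. -/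
lemma stdBounded_of_weaklyHomogeneous (hW : ScaleStable W) {s : ℝ} {t : 𝓓'(W, ℂ)}
    (ht : t ∈ weaklyHomogeneous s W) {A : Prop}
    (h : ∀ z ∈ W, ((z.1, 0) : Space n d) ∈ interior (closure (W : Set (Space n d))) ∧
      ∀ᶠ w in 𝓝 ((z.1, 0) : Space n d), w ∈ W ↔ (A ∨ w.2 ≠ 0)) :
    StdBounded s (t : 𝓓(W, ℝ) →ₗ[ℝ] ℂ) := by
  refine stdBounded_of_local (boundedOnTestSets_distribution t) hW fun z hz => ?_
  obtain ⟨ψ, h1, -, hψ, h2⟩ := ht (z.1, 0) ⟨rfl, (h z hz).1⟩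
  exact exists_local_bound hψ h2 h1 rfl (h z hz).2

variable {U₁ : Opens (EuclideanSpace ℝ (Fin n))} {U₂ : Opens (EuclideanSpace ℝ (Fin d))}

lemma stdBounded_box (hU : ScaleStable (box U₁ U₂)) (h0 : 0 ∈ U₂) {s : ℝ}
    {t : 𝓓'(box U₁ U₂, ℂ)} (ht : t ∈ weaklyHomogeneous s (box U₁ U₂)) :
    StdBounded s (t : 𝓓(box U₁ U₂, ℝ) →ₗ[ℝ] ℂ) := by
  refine stdBounded_of_weaklyHomogeneous hU ht (A := True) fun z hz => ?_
  have hz' : ((z.1, 0) : Space n d) ∈ box U₁ U₂ := ⟨hz.1, h0⟩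
  refine ⟨(box U₁ U₂).isOpen.subset_interior_closure hz', ?_⟩
  filter_upwards [(box U₁ U₂).isOpen.mem_nhds hz'] with w hw
  exact iff_of_true hw (Or.inl trivial)

lemma dense_compl_planeI (hd : d ≠ 0) : Dense {z : Space n d | z.2 ≠ 0} := by
  have : Nonempty (Fin d) := ⟨⟨0, Nat.pos_of_ne_zero hd⟩⟩
  have h : Dense {h : EuclideanSpace ℝ (Fin d) | h ≠ 0} := dense_compl_singleton _
  exact h.preimage isOpenMap_snd

/-- If `U ∖ I` has a point then `d ≠ 0`, so `I` has dense complement and its points in `U` lie in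
the interior of the closure of `U ∖ I`. Weak homogeneity therefore does provide charts there. -/
lemma stdBounded_offI (hU : ScaleStable (box U₁ U₂)) (h0 : 0 ∈ U₂) {s : ℝ}
    {t : 𝓓'(offI (box U₁ U₂), ℂ)} (ht : t ∈ weaklyHomogeneous s (offI (box U₁ U₂))) :
    StdBounded s (t : 𝓓(offI (box U₁ U₂), ℝ) →ₗ[ℝ] ℂ) := by
  refine stdBounded_of_weaklyHomogeneous (scaleStable_offI hU) ht (A := False) fun z hz => ?_
  have hz' : ((z.1, 0) : Space n d) ∈ box U₁ U₂ := ⟨hz.1.1, h0⟩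
  have hd : d ≠ 0 := by
    rintro rfl
    exact hz.2 (Subsingleton.elim _ _)
  refine ⟨?_, ?_⟩
  · refine interior_maximal ?_ (box U₁ U₂).isOpen hz'
    exact (dense_compl_planeI hd).open_subset_closure_inter (box U₁ U₂).isOpen
  · filter_upwards [(box U₁ U₂).isOpen.mem_nhds hz'] with w hw
    rw [false_or]
    exact ⟨fun h => h.2, fun h => ⟨hw, h⟩⟩

end

/-! ### Taylor's formula in the transverse variables. -/

section

section LineDerivatives

variable {E : Type*} [NormedAddCommGroup E] [NormedSpace ℝ E] {U : Opens E}

lemma lineDeriv_test_apply (v : E) (φ : 𝓓(U, ℝ)) (z : E) :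
    (∂_{v} φ : 𝓓(U, ℝ)) z = fderiv ℝ φ z v := by
  change (TestFunction.lineDerivCLM ℝ v φ : 𝓓(U, ℝ)) z = _
  rw [TestFunction.lineDerivCLM_apply_of_le (by simp),
    (φ.contDiff.differentiable (by simp) z).lineDeriv_eq_fderiv]

lemma lineDeriv_test_comm (v w : E) (φ : 𝓓(U, ℝ)) :
    (∂_{v} (∂_{w} φ : 𝓓(U, ℝ)) : 𝓓(U, ℝ)) = ∂_{w} (∂_{v} φ : 𝓓(U, ℝ)) := by
  have key : ∀ (v w : E) (z : E), (∂_{v} (∂_{w} φ : 𝓓(U, ℝ)) : 𝓓(U, ℝ)) z =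
      fderiv ℝ (fderiv ℝ φ) z v w := by
    intro v w z
    rw [lineDeriv_test_apply]
    have h1 : ((∂_{w} φ : 𝓓(U, ℝ)) : E → ℝ) = fun z => fderiv ℝ φ z w :=
      funext fun z => lineDeriv_test_apply w φ z
    have h2 : DifferentiableAt ℝ (fderiv ℝ φ) z :=
      (φ.contDiff.fderiv_right (m := ∞) (by simp)).differentiable (by simp) z
    rw [h1, fderiv_clm_apply h2 (differentiableAt_const w)]
    simp
  ext z
  rw [key, key]
  exact (φ.contDiff.contDiffAt.isSymmSndFDerivAt (by
    rw [minSmoothness_of_isRCLikeNormedField]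
    exact WithTop.coe_le_coe.2 (le_top : (2 : ℕ∞) ≤ ⊤))) v w

end LineDerivatives

variable {n d : ℕ} {U : Opens (Space n d)}

/-- The partial derivative in the `j`-th transverse coordinate. -/
def dh (j : Fin d) (φ : 𝓓(U, ℝ)) : 𝓓(U, ℝ) := ∂_{((0, EuclideanSpace.single j 1) : Space n d)} φ

lemma dh_comm (i j : Fin d) : Function.Commute (dh i : 𝓓(U, ℝ) → 𝓓(U, ℝ)) (dh j) :=
  fun φ => lineDeriv_test_comm _ _ φ

lemma transverseDeriv_eq_foldr (α : Fin d → ℕ) (φ : 𝓓(U, ℝ)) :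
    transverseDeriv α φ = (List.finRange d).foldr (fun j g => (dh j)^[α j] g) φ := rfl

lemma foldr_dh_comm (l : List (Fin d)) (α : Fin d → ℕ) (j : Fin d) (φ : 𝓓(U, ℝ)) :
    l.foldr (fun i g => (dh i)^[α i] g) (dh j φ) =
      dh j (l.foldr (fun i g => (dh i)^[α i] g) φ) := by
  induction l with
  | nil => rfl
  | cons a l ih =>
    simp only [List.foldr_cons, ih]
    exact ((dh_comm a j).iterate_left (α a)).eq _

/-- The list has no repetition, so the extra derivative occurs once, and it moves to the innermost
position because the `dh i` commute. -/
lemma foldr_dh_add_single (l : List (Fin d)) (hl : l.Nodup) (α : Fin d → ℕ) (j : Fin d)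
    (φ : 𝓓(U, ℝ)) : l.foldr (fun i g => (dh i)^[(α + Pi.single j 1 : Fin d → ℕ) i] g) φ =
      if j ∈ l then l.foldr (fun i g => (dh i)^[α i] g) (dh j φ)
      else l.foldr (fun i g => (dh i)^[α i] g) φ := by
  induction l with
  | nil => simp
  | cons a l ih =>
    rw [List.nodup_cons] at hl
    simp only [List.foldr_cons, ih hl.2]
    by_cases ha : a = j
    · subst ha
      simp only [hl.1, if_false, List.mem_cons, true_or, if_true, foldr_dh_comm]
      simp [Function.iterate_succ_apply]
    · simp only [List.mem_cons, Ne.symm ha, false_or]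
      have : (α + Pi.single j 1 : Fin d → ℕ) a = α a := by simp [ha]
      rw [this]
      split_ifs <;> rfl

lemma transverseDeriv_add_single (α : Fin d → ℕ) (j : Fin d) (φ : 𝓓(U, ℝ)) :
    transverseDeriv (α + Pi.single j 1) φ = transverseDeriv α (dh j φ) := by
  rw [transverseDeriv_eq_foldr, foldr_dh_add_single _ (List.nodup_finRange d),
    if_pos (List.mem_finRange j)]
  rfl

lemma transverseDeriv_zero (φ : 𝓓(U, ℝ)) : transverseDeriv 0 φ = φ := by
  rw [transverseDeriv_eq_foldr]
  induction List.finRange d with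
  | nil => rfl
  | cons a l ih => simp

/-- The monomial `h^α / α!`. -/
def mon (α : Fin d → ℕ) (z : Space n d) : ℝ := ∏ j, z.2 j ^ α j / (α j).factorial

lemma contDiff_mon (α : Fin d → ℕ) : ContDiff ℝ ∞ (mon α : Space n d → ℝ) := by
  refine contDiff_prod fun j _ => ContDiff.div_const (ContDiff.pow ?_ _) _
  fun_prop

lemma mon_scal (α : Fin d → ℕ) (r : ℝ) (z : Space n d) :
    mon α (scal r z) = r ^ (∑ j, α j) * mon α z := by
  simp only [mon, scal, PiLp.smul_apply, smul_eq_mul, mul_pow, mul_div_assoc,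
    Finset.prod_mul_distrib, Finset.prod_pow_eq_pow_sum]

lemma mon_add_single (α : Fin d → ℕ) (j : Fin d) (z : Space n d) :
    (α j + 1 : ℝ) * mon (α + Pi.single j 1) z = z.2 j * mon α z := by
  unfold mon
  rw [← Finset.mul_prod_erase _ _ (Finset.mem_univ j), ← Finset.mul_prod_erase _ _ (Finset.mem_univ j)]
  have h1 : ∀ i ∈ Finset.univ.erase j,
      z.2 i ^ (α + Pi.single j 1 : Fin d → ℕ) i / ((α + Pi.single j 1 : Fin d → ℕ) i).factorial =
        z.2 i ^ α i / (α i).factorial := by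
    intro i hi
    have : (α + Pi.single j 1 : Fin d → ℕ) i = α i := by simp [Finset.ne_of_mem_erase hi]
    rw [this]
  rw [Finset.prod_congr rfl h1]
  have h2 : (α + Pi.single j 1 : Fin d → ℕ) j = α j + 1 := by simp
  rw [h2, Nat.factorial_succ, pow_succ]
  have h3 : ((α j).factorial : ℝ) ≠ 0 := by exact_mod_cast (α j).factorial_ne_zero
  have h4 : (α j + 1 : ℝ) ≠ 0 := by positivity
  push_cast
  field_simp

lemma taylorRemainder_eq (m : ℤ) (φ : 𝓓(U, ℝ)) (z : Space n d) : taylorRemainder m φ z =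
    φ z - ∑ α ∈ multiIndices d m, mon α z * transverseDeriv α φ (z.1, 0) := rfl

lemma multiIndices_eq_empty {m : ℤ} (hm : m < 0) : multiIndices d m = ∅ := by
  ext α
  rw [mem_multiIndices]
  simp only [Finset.notMem_empty, iff_false, not_le]
  exact hm.trans_le (Int.natCast_nonneg _)

lemma sum_add_single (α : Fin d → ℕ) (j : Fin d) :
    ∑ i, (α + Pi.single j 1 : Fin d → ℕ) i = ∑ i, α i + 1 := by
  simp [Finset.sum_add_distrib]

/-- The derivative in `r` of the Taylor polynomial of `r ↦ φ (x, r h)`. -/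
lemma sum_deriv_taylor (k : ℕ) (φ : 𝓓(U, ℝ)) (r : ℝ) (z : Space n d) :
    ∑ α ∈ multiIndices d k, ((∑ j, α j : ℕ) : ℝ) * r ^ (∑ j, α j - 1) *
      (mon α z * transverseDeriv α φ (z.1, 0)) =
    ∑ j, z.2 j * ∑ α ∈ multiIndices d ((k : ℤ) - 1),
      mon α (scal r z) * transverseDeriv α (dh j φ) (z.1, 0) := by
  have h1 : ∀ α ∈ multiIndices d k, ((∑ j, α j : ℕ) : ℝ) * r ^ (∑ j, α j - 1) *
      (mon α z * transverseDeriv α φ (z.1, 0)) = ∑ j, (α j : ℝ) * r ^ (∑ j, α j - 1) *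
      (mon α z * transverseDeriv α φ (z.1, 0)) := by
    intro α _
    push_cast
    rw [Finset.sum_mul, Finset.sum_mul]
  rw [Finset.sum_congr rfl h1, Finset.sum_comm]
  refine Finset.sum_congr rfl fun j _ => ?_
  rw [Finset.mul_sum]
  symm
  -- Reindexing by `α ↦ α + e_j`: the multi-indices that are missed have `α j = 0`, and their terms
  -- carry the factor `α j`.
  refine Finset.sum_of_injOn (fun α => α + Pi.single j 1) (fun α _ β _ h => add_right_cancel h)
    (fun α hα => ?_) (fun α hα hα' => ?_) fun α _ => ?_
  · rw [Finset.mem_coe, mem_multiIndices] at hα ⊢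
    rw [sum_add_single]
    push_cast at hα ⊢
    linarith
  · have : α j = 0 := by
      by_contra h0
      refine hα' ⟨α - Pi.single j 1, ?_, ?_⟩
      · have h2 : α = (α - Pi.single j 1) + Pi.single j 1 := by
          refine (tsub_add_cancel_of_le ?_).symm
          intro i
          by_cases hi : i = j
          · subst hi; simpa using Nat.one_le_iff_ne_zero.2 h0
          · simp [hi]
        rw [mem_multiIndices, h2, sum_add_single] at hα
        rw [Finset.mem_coe, mem_multiIndices]
        push_cast at hα ⊢
        linarith
      · refine tsub_add_cancel_of_le ?_
        intro i
        by_cases hi : i = j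
        · subst hi; simpa using Nat.one_le_iff_ne_zero.2 h0
        · simp [hi]
    simp [this]
  · have h2 : ((α + Pi.single j 1 : Fin d → ℕ) j : ℕ) = α j + 1 := by simp
    rw [h2, sum_add_single, transverseDeriv_add_single, mon_scal, Nat.add_sub_cancel]
    push_cast
    linear_combination (-(r ^ (∑ i, α i)) * transverseDeriv α (dh j φ) (z.1, 0)) *
      mon_add_single α j z

lemma fderiv_transverse (φ : 𝓓(U, ℝ)) (w : Space n d) (h : EuclideanSpace ℝ (Fin d)) :
    fderiv ℝ φ w (0, h) = ∑ j, h j * dh j φ w := by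
  have h1 : ((0, h) : Space n d) =
      ∑ j, h j • ((0, EuclideanSpace.single j 1) : Space n d) := by
    have h2 := (EuclideanSpace.basisFun (Fin d) ℝ).sum_repr h
    simp only [EuclideanSpace.basisFun_repr, EuclideanSpace.basisFun_apply] at h2
    refine Prod.ext ?_ ?_
    · simp [Prod.fst_sum]
    · simp only [Prod.snd_sum, Prod.smul_snd]
      exact h2.symm
  rw [h1, map_sum]
  refine Finset.sum_congr rfl fun j _ => ?_
  rw [map_smul, smul_eq_mul, dh, lineDeriv_test_apply]

lemma taylorRemainder_of_snd_eq_zero (k : ℕ) (φ : 𝓓(U, ℝ)) {z : Space n d} (hz : z.2 = 0) :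
    taylorRemainder (k : ℤ) φ z = 0 := by
  rw [taylorRemainder_eq, Finset.sum_eq_single 0]
  · rw [transverseDeriv_zero]
    have : ((z.1, 0) : Space n d) = z := Prod.ext rfl hz.symm
    simp [mon, this]
  · intro α _ hα
    obtain ⟨j, hj⟩ := Function.ne_iff.1 hα
    have : mon α z = 0 := Finset.prod_eq_zero (Finset.mem_univ j) (by
      rw [hz]
      have : α j ≠ 0 := hj
      simp [this])
    rw [this, zero_mul]
  · intro h
    refine (h ?_).elim
    rw [mem_multiIndices]
    simp

/-- Taylor's formula in the transverse variables. -/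
lemma exists_taylorRemainder_nat (k : ℕ) : ∀ φ : 𝓓(U, ℝ), ∃ R : ℝ × Space n d → ℝ,
    ContDiff ℝ ∞ R ∧ ∀ r z, taylorRemainder ((k : ℤ) - 1) φ (scal r z) = r ^ k * R (r, z) := by
  induction k with
  | zero =>
    intro φ
    refine ⟨fun q => φ (scal q.1 q.2), φ.contDiff.comp (by unfold scal; fun_prop), fun r z => ?_⟩
    rw [taylorRemainder_eq, multiIndices_eq_empty (by simp)]
    simp
  | succ k ih =>
    intro φ
    -- The derivative in `r` of the remainder of order `k` of `φ` is the sum over `j` of `h_j` times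
    -- the remainder of order `k - 1` of `∂_{h_j} φ`, hence `r ^ k` times a smooth function.
    -- Integration gains one more power of `r`.
    choose R hR h using fun j : Fin d => ih (dh j φ)
    obtain ⟨Q, hQ, hQ'⟩ := exists_smooth_factor
      (r := fun q : ℝ × Space n d => taylorRemainder (k : ℤ) φ (scal q.1 q.2)) k
      (S := fun q => ∑ j, q.2.2 j * R j q)
      (ContDiff.sum fun j _ => ContDiff.mul (by fun_prop) (hR j))
      (fun z => taylorRemainder_of_snd_eq_zero k φ (by simp [scal])) (by
        intro z r
        have h1 : HasDerivAt (fun r : ℝ => φ (scal r z)) (fderiv ℝ φ (scal r z) (0, z.2)) r := by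
          have h2 : HasDerivAt (fun r : ℝ => scal r z) ((0 : EuclideanSpace ℝ (Fin n)), z.2) r := by
            have := (hasDerivAt_const r z.1).prodMk ((hasDerivAt_id r).smul_const z.2)
            rw [one_smul] at this
            exact this
          exact (φ.contDiff.differentiable (by simp) (scal r z)).hasFDerivAt.comp_hasDerivAt r h2
        have h3 : ∀ α ∈ multiIndices d (k : ℤ), HasDerivAt
            (fun r : ℝ => mon α (scal r z) * transverseDeriv α φ (z.1, 0))
            (((∑ j, α j : ℕ) : ℝ) * r ^ (∑ j, α j - 1) *
              (mon α z * transverseDeriv α φ (z.1, 0))) r := by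
          intro α _
          simp only [mon_scal, mul_assoc]
          have := (hasDerivAt_pow (∑ j, α j) r).mul_const (mon α z * transverseDeriv α φ (z.1, 0))
          simpa only [mul_assoc] using this
        have h4 := h1.sub (HasDerivAt.fun_sum h3)
        rw [sum_deriv_taylor, fderiv_transverse, ← Finset.sum_sub_distrib] at h4
        have h5 : r ^ k • ∑ j, z.2 j * R j (r, z) = ∑ j, (z.2 j * dh j φ (scal r z) -
            z.2 j * ∑ α ∈ multiIndices d ((k : ℤ) - 1),
              mon α (scal r z) * transverseDeriv α (dh j φ) (z.1, 0)) := by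
          rw [smul_eq_mul, Finset.mul_sum]
          refine Finset.sum_congr rfl fun j _ => ?_
          rw [← mul_sub]
          have h6 := h j r z
          rw [taylorRemainder_eq] at h6
          change _ = z.2 j * (_ - ∑ α ∈ multiIndices d ((k : ℤ) - 1),
            mon α (scal r z) * transverseDeriv α (dh j φ) ((scal r z).1, 0))
          rw [h6]
          ring
        rw [h5]
        exact h4)
    refine ⟨Q, hQ, fun r z => ?_⟩
    have := hQ' r z
    push_cast
    rw [add_sub_cancel_right]
    exact this

/-- Taylor's formula in the transverse variables. -/
lemma exists_taylorRemainder (m : ℤ) (φ : 𝓓(U, ℝ)) : ∃ R : ℝ × Space n d → ℝ,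
    ContDiff ℝ ∞ R ∧ ∀ r z, taylorRemainder m φ (scal r z) = r ^ (m + 1).toNat * R (r, z) := by
  rcases lt_or_ge m 0 with hm | hm
  · obtain ⟨R, hR, h⟩ := exists_taylorRemainder_nat 0 φ
    refine ⟨R, hR, fun r z => ?_⟩
    have h1 : (m + 1).toNat = 0 := by omega
    rw [h1, ← h r z, taylorRemainder_eq, taylorRemainder_eq, multiIndices_eq_empty hm,
      multiIndices_eq_empty (by simp)]
  · obtain ⟨R, hR, h⟩ := exists_taylorRemainder_nat (m + 1).toNat φ
    refine ⟨R, hR, fun r z => ?_⟩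
    rw [← h r z]
    congr 2
    omega

end

section

/-! ### Operators given by pull-back and multiplication. -/

section PullMul

variable {E : Type*} [NormedAddCommGroup E] [NormedSpace ℝ E] {W : Opens E}
  {E' : Type*} [NormedAddCommGroup E'] [NormedSpace ℝ E'] {W' : Opens E'}
  {F : Type*} [NormedAddCommGroup F] [NormedSpace ℝ F]

/-- `κ · (f ∘ π)` is a test function on `W` for each test function `f` on `W'`. -/
structure PullMul (W : Opens E) (W' : Opens E') (κ : E → ℝ) (π : E → E') : Prop where
  smooth : ContDiff ℝ ∞ κ
  smooth' : ContDiff ℝ ∞ π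
  proper : ∀ K, IsCompact K → K ⊆ W' → ∃ K', IsCompact K' ∧ K' ⊆ W ∧
    ∀ z, κ z ≠ 0 → π z ∈ K → z ∈ K'

lemma PullMul.isTest {κ : E → ℝ} {π : E → E'} (h : PullMul W W' κ π) {f : E' → ℝ}
    (hf : IsTest W' f) : IsTest W (fun z => κ z * f (π z)) := by
  obtain ⟨K', hK', hK'W, H⟩ := h.proper _ hf.hasCompactSupport hf.tsupport_subset
  exact .of_support (h.smooth.mul (hf.contDiff.comp h.smooth')) hK' hK'W fun z hz =>
    H z (left_ne_zero_of_mul hz) (subset_tsupport _ (right_ne_zero_of_mul hz))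

/-- The operator `φ ↦ κ · (φ ∘ π)`. -/
def PullMul.lin {κ : E → ℝ} {π : E → E'} (h : PullMul W W' κ π) : 𝓓(W', ℝ) →ₗ[ℝ] 𝓓(W, ℝ) where
  toFun φ := (h.isTest (isTest_coe φ)).toTest
  map_add' φ φ' := by
    ext z
    exact mul_add _ _ _
  map_smul' c φ := by
    ext z
    exact mul_left_comm _ _ _

lemma PullMul.bounded {κ : E → ℝ} {π : E → E'} (h : PullMul W W' κ π) {T : 𝓓(W, ℝ) →ₗ[ℝ] F}
    (hT : BoundedOnTestSets T) : BoundedOnTestSets (T ∘ₗ h.lin) := by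
  refine hT.comp isOpen_univ h.smooth'.contDiffOn h.smooth.contDiffOn (fun φ z _ => rfl)
    fun K hK hKW => ?_
  obtain ⟨K', hK', hK'W, H⟩ := h.proper K hK hKW
  exact ⟨K', hK', subset_univ _, hK'W, fun φ hφ z hz =>
    H z (left_ne_zero_of_mul hz) (hφ _ (right_ne_zero_of_mul hz))⟩

end PullMul

/-! ### Summation of dyadic increments. -/

section Dyadic

variable {G : ℝ → ℂ} {C a : ℝ}

/-- Halve the scale repeatedly and sum a geometric series of ratio `2⁻¹ ^ a < 1`. The final step, by
a factor between `1` and `2`, is why the hypothesis covers all `ν ∈ [1, 2]`. -/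
lemma norm_sub_le_of_pos (ha : 0 < a)
    (hG : ∀ r ∈ Ioc (0 : ℝ) 1, ∀ ν ∈ Icc (1 : ℝ) 2, ‖G r - G (r / ν)‖ ≤ C * r ^ a) :
    ∀ r ∈ Ioc (0 : ℝ) 1, ∀ q ∈ Ioc (0 : ℝ) 1,
      ‖G r - G (r * q)‖ ≤ C / (1 - 2⁻¹ ^ a) * r ^ a := by
  have hC : 0 ≤ C := by simpa using (norm_nonneg _).trans (hG 1 (by simp) 1 (by simp))
  have h2 : (2⁻¹ : ℝ) ^ a < 1 := Real.rpow_lt_one (by norm_num) (by norm_num) ha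
  have h2' : (0 : ℝ) < 2⁻¹ ^ a := Real.rpow_pos_of_pos (by norm_num) _
  set C' := C / (1 - 2⁻¹ ^ a) with hC'
  -- `C'` is the fixed point of the recursion for the constant under one halving, which closes the
  -- induction.
  have hCC : C + C' * 2⁻¹ ^ a = C' := by
    rw [hC']; field_simp [(sub_pos.2 h2).ne']; ring
  have hC'0 : 0 ≤ C' := div_nonneg hC (sub_pos.2 h2).le
  have key : ∀ k : ℕ, ∀ r ∈ Ioc (0 : ℝ) 1, ∀ q ∈ Ioc (0 : ℝ) 1, 2⁻¹ ^ k ≤ q →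
      ‖G r - G (r * q)‖ ≤ C' * r ^ a := by
    intro k
    induction k with
    | zero =>
      intro r hr q hq hk
      have : q = 1 := le_antisymm hq.2 (by simpa using hk)
      rw [this, mul_one, sub_self, norm_zero]
      exact mul_nonneg hC'0 (Real.rpow_nonneg hr.1.le _)
    | succ k ih =>
      intro r hr q hq hk
      have hra : 0 ≤ r ^ a := Real.rpow_nonneg hr.1.le _
      rcases le_total 2⁻¹ q with h | h
      · have h3 := hG r hr q⁻¹ ⟨(one_le_inv₀ hq.1).2 hq.2, inv_le_of_inv_le₀ (by norm_num) h⟩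
        rw [div_inv_eq_mul] at h3
        refine h3.trans (mul_le_mul_of_nonneg_right ?_ hra)
        nlinarith
      · have h3 := hG r hr 2 (by norm_num)
        have h4 := ih (r / 2) ⟨by linarith [hr.1], by linarith [hr.2]⟩ (2 * q)
          ⟨by linarith [hq.1], by linarith⟩ (by rw [pow_succ] at hk; linarith)
        have h5 : r / 2 * (2 * q) = r * q := by ring
        rw [h5, div_eq_mul_inv, Real.mul_rpow hr.1.le (by norm_num)] at h4
        calc ‖G r - G (r * q)‖ ≤ ‖G r - G (r / 2)‖ + ‖G (r / 2) - G (r * q)‖ :=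
              norm_sub_le_norm_sub_add_norm_sub _ _ _
          _ ≤ C * r ^ a + C' * (r ^ a * 2⁻¹ ^ a) := add_le_add h3 h4
          _ = C' * r ^ a := by linear_combination r ^ a * hCC
  intro r hr q hq
  obtain ⟨k, hk⟩ := exists_pow_lt_of_lt_one hq.1 (show (2⁻¹ : ℝ) < 1 by norm_num)
  exact key k r hr q hq hk.le

/-- The values at the scales `2⁻¹ ^ k` form a Cauchy sequence, and `norm_sub_le_of_pos` compares
every other scale with them. -/
lemma exists_limit_of_pos (ha : 0 < a)
    (hG : ∀ r ∈ Ioc (0 : ℝ) 1, ∀ ν ∈ Icc (1 : ℝ) 2, ‖G r - G (r / ν)‖ ≤ C * r ^ a) :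
    ∃ L, ∀ r ∈ Ioc (0 : ℝ) 1, ‖G r - L‖ ≤ C / (1 - 2⁻¹ ^ a) * r ^ a := by
  have h := norm_sub_le_of_pos ha hG
  have hk : ∀ k : ℕ, (2⁻¹ : ℝ) ^ k ∈ Ioc (0 : ℝ) 1 := fun k =>
    ⟨by positivity, pow_le_one₀ (by norm_num) (by norm_num)⟩
  have hcs : CauchySeq fun k : ℕ => G (2⁻¹ ^ k) := by
    refine cauchySeq_of_le_geometric ((2⁻¹ : ℝ) ^ a) C
      (Real.rpow_lt_one (by norm_num) (by norm_num) ha) fun k => ?_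
    have := hG _ (hk k) 2 (by norm_num)
    rw [dist_eq_norm, pow_succ, ← div_eq_mul_inv]
    refine this.trans_eq ?_
    rw [← Real.rpow_natCast, ← Real.rpow_natCast, ← Real.rpow_mul (by norm_num),
      ← Real.rpow_mul (by norm_num), mul_comm a]
  obtain ⟨L, hL⟩ := cauchySeq_tendsto_of_complete hcs
  refine ⟨L, fun r hr => ?_⟩
  refine le_of_tendsto (tendsto_const_nhds.sub hL).norm ?_
  have h0 : Tendsto (fun k : ℕ => (2⁻¹ : ℝ) ^ k) atTop (𝓝 0) :=
    tendsto_pow_atTop_nhds_zero_of_lt_one (by norm_num) (by norm_num)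
  filter_upwards [h0.eventually (gt_mem_nhds hr.1)] with k hkr
  have := h r hr (2⁻¹ ^ k / r) ⟨div_pos (hk k).1 hr.1, (div_le_one hr.1).2 hkr.le⟩
  rwa [mul_div_cancel₀ _ hr.1.ne'] at this

/-- For `a < 0` the increments grow geometrically as the scale decreases, so the sum from scale `1`
down to `r` is controlled by the last one. -/
lemma norm_sub_le_of_neg (ha : a < 0)
    (hG : ∀ r ∈ Ioc (0 : ℝ) 1, ∀ ν ∈ Icc (1 : ℝ) 2, ‖G r - G (r / ν)‖ ≤ C * r ^ a) :
    ∀ r ∈ Ioc (0 : ℝ) 1, ‖G 1 - G r‖ ≤ C / (1 - 2 ^ a) * r ^ a := by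
  have hC : 0 ≤ C := by simpa using (norm_nonneg _).trans (hG 1 (by simp) 1 (by simp))
  have h2 : (2 : ℝ) ^ a < 1 := Real.rpow_lt_one_of_one_lt_of_neg (by norm_num) ha
  have h2' : (0 : ℝ) < 2 ^ a := Real.rpow_pos_of_pos (by norm_num) _
  set C' := C / (1 - 2 ^ a) with hC'
  have hCC : (C' + C) * 2 ^ a ≤ C' := by
    have h3 : C' * (1 - 2 ^ a) = C := div_mul_cancel₀ _ (sub_pos.2 h2).ne'
    nlinarith
  have hC'C : C ≤ C' := by
    rw [hC', le_div_iff₀ (sub_pos.2 h2)]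
    nlinarith
  have key : ∀ k : ℕ, ∀ r ∈ Ioc (0 : ℝ) 1, 2⁻¹ ^ k ≤ r → ‖G 1 - G r‖ ≤ C' * r ^ a := by
    intro k
    induction k with
    | zero =>
      intro r hr hk
      have : r = 1 := le_antisymm hr.2 (by simpa using hk)
      rw [this, sub_self, norm_zero]
      exact mul_nonneg (hC.trans hC'C) (Real.rpow_nonneg zero_le_one _)
    | succ k ih =>
      intro r hr hk
      have hra : 0 ≤ r ^ a := Real.rpow_nonneg hr.1.le _
      rcases le_total 2⁻¹ r with h | h
      · have h3 := hG 1 (by simp) r⁻¹ ⟨(one_le_inv₀ hr.1).2 hr.2,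
          inv_le_of_inv_le₀ (by norm_num) h⟩
        rw [div_inv_eq_mul, one_mul, Real.one_rpow] at h3
        refine h3.trans (mul_le_mul hC'C ?_ zero_le_one (hC.trans hC'C))
        exact Real.one_le_rpow_of_pos_of_le_one_of_nonpos hr.1 hr.2 ha.le
      · have hr2 : 2 * r ∈ Ioc (0 : ℝ) 1 := ⟨by linarith [hr.1], by linarith⟩
        have h3 := hG (2 * r) hr2 2 (by norm_num)
        have h4 := ih (2 * r) hr2 (by rw [pow_succ] at hk; linarith)
        rw [mul_div_cancel_left₀ r two_ne_zero] at h3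
        rw [Real.mul_rpow (by norm_num) hr.1.le] at h3 h4
        calc ‖G 1 - G r‖ ≤ ‖G 1 - G (2 * r)‖ + ‖G (2 * r) - G r‖ :=
              norm_sub_le_norm_sub_add_norm_sub _ _ _
          _ ≤ C' * (2 ^ a * r ^ a) + C * (2 ^ a * r ^ a) := add_le_add h4 h3
          _ = (C' + C) * 2 ^ a * r ^ a := by ring
          _ ≤ C' * r ^ a := mul_le_mul_of_nonneg_right hCC hra
  intro r hr
  obtain ⟨k, hk⟩ := exists_pow_lt_of_lt_one hr.1 (show (2⁻¹ : ℝ) < 1 by norm_num)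
  exact key k r hr hk.le

end Dyadic

/-! ### Cut-off functions and their scaled differences. -/

section Cutoff

variable {n d : ℕ} {U₁ : Opens (EuclideanSpace ℝ (Fin n))} {U₂ : Opens (EuclideanSpace ℝ (Fin d))}
  {χ : Space n d → ℝ}

lemma continuous_scal_prod : Continuous fun x : ℝ × Space n d => scal x.1 x.2 := by
  unfold scal; fun_prop

lemma scal_scal (r r' : ℝ) (z : Space n d) : scal r (scal r' z) = scal (r * r') z := by
  simp [scal, smul_smul]

lemma scal_one (z : Space n d) : scal 1 z = z := by simp [scal]

/-- Supports of cut-off functions over compact subsets of `U₁`. -/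
lemma IsCutoff.isCompact_support (hχ : IsCutoff U₁ U₂ χ) (h0 : 0 ∈ U₂)
    {K : Set (EuclideanSpace ℝ (Fin n))} (hK : IsCompact K) (hKU : K ⊆ U₁) :
    ∃ K', IsCompact K' ∧ K' ⊆ box U₁ U₂ ∧ ∀ z, χ z ≠ 0 → z.1 ∈ K → z ∈ K' :=
  ⟨_, hχ.proper K hK, fun z hz => ⟨hKU hz.2, hχ.support_subset h0 z hz.1 (hKU hz.2)⟩,
    fun _ hz hzK => ⟨subset_tsupport _ hz, hzK⟩⟩

/-- Supports of differences of scaled cut-off functions over compact subsets of `U₁`. -/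
lemma IsCutoff.isCompact_support_sub (hU : ScaleStable (box U₁ U₂)) (hχ : IsCutoff U₁ U₂ χ)
    (h0 : 0 ∈ U₂) {K : Set (EuclideanSpace ℝ (Fin n))} (hK : IsCompact K) (hKU : K ⊆ U₁)
    {N : ℝ} (hN : 1 ≤ N) : ∃ K', IsCompact K' ∧ K' ⊆ offI (box U₁ U₂) ∧
      ∀ ν ∈ Icc (1 : ℝ) N, ∀ z, χ z - χ (scal ν z) ≠ 0 → z.1 ∈ K → z ∈ K' := by
  obtain ⟨K₁, hK₁, hK₁U, H⟩ := hχ.isCompact_support h0 hK hKU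
  have hN0 : 0 < N := one_pos.trans_le hN
  let S : Set ℝ → Set (Space n d) → Set (Space n d) := fun I A =>
    (fun x : ℝ × Space n d => scal x.1 x.2) '' (I ×ˢ A)
  have hS : ∀ {I A}, IsCompact I → IsCompact A → IsCompact (S I A) := fun hI hA =>
    (hI.prod hA).image continuous_scal_prod
  -- If `χ z ≠ χ (scal ν z)`, one of the two values is nonzero, which confines `z` to a compact set,
  -- and one of them differs from `1`, which puts `z` or `scal ν z` in the closed set `Z` away from
  -- `I`.
  let Z : Set (Space n d) := tsupport fun z => 1 - χ z
  have hZc : IsClosed Z := isClosed_tsupport _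
  have hZ : ∀ z ∈ Z, z.2 ≠ 0 := by
    intro z hz hz0
    refine notMem_tsupport_iff_eventuallyEq.2 ?_ hz
    filter_upwards [hχ.eq_one z hz0] with w hw
    simp [hw]
  let K₂ := S (Icc N⁻¹ 1) K₁
  have hK₂ : IsCompact K₂ := hS isCompact_Icc hK₁
  have hK₂U : K₂ ⊆ box U₁ U₂ := by
    rintro _ ⟨⟨r, z⟩, ⟨hr, hz⟩, rfl⟩
    exact hU z (hK₁U hz) r ⟨(inv_pos.2 hN0).trans_le hr.1, hr.2⟩
  let K₃ := S (Icc N⁻¹ 1) (S (Icc 1 N) K₂ ∩ Z)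
  have hK₃ : IsCompact K₃ := hS isCompact_Icc ((hS isCompact_Icc hK₂).inter_right hZc)
  refine ⟨K₂ ∩ (Z ∪ K₃), hK₂.inter_right (hZc.union hK₃.isClosed), ?_, ?_⟩
  · rintro z ⟨hz, hz' | ⟨⟨r, w⟩, ⟨hr, hw⟩, rfl⟩⟩
    · exact ⟨hK₂U hz, hZ z hz'⟩
    · refine ⟨hK₂U hz, fun h => hZ w hw.2 ?_⟩
      exact (smul_eq_zero.1 h).resolve_left ((inv_pos.2 hN0).trans_le hr.1).ne'
  · intro ν hν z hz hzK
    have hν0 : 0 < ν := one_pos.trans_le hν.1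
    have hνm : ν⁻¹ ∈ Icc N⁻¹ 1 := ⟨inv_anti₀ hν0 hν.2, inv_le_one_of_one_le₀ hν.1⟩
    have hzν : scal ν⁻¹ (scal ν z) = z := by
      rw [scal_scal, inv_mul_cancel₀ hν0.ne', scal_one]
    have hz2 : z ∈ K₂ := by
      by_cases h1 : χ z = 0
      · have h2 : χ (scal ν z) ≠ 0 := fun h2 => hz (by rw [h1, h2, sub_zero])
        exact ⟨(ν⁻¹, scal ν z), ⟨hνm, H _ h2 hzK⟩, hzν⟩
      · exact ⟨(1, z), ⟨⟨inv_le_one_of_one_le₀ hN, le_rfl⟩, H _ h1 hzK⟩, scal_one z⟩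
    refine ⟨hz2, ?_⟩
    by_cases h1 : χ z = 1
    · right
      have h2 : 1 - χ (scal ν z) ≠ 0 := by rwa [h1] at hz
      exact ⟨(ν⁻¹, scal ν z), ⟨hνm, ⟨(ν, z), ⟨hν, hz2⟩, rfl⟩, subset_tsupport _ h2⟩, hzν⟩
    · left
      exact subset_tsupport (fun z => 1 - χ z) (fun h => h1 (by linarith : χ z = 1))

/-- Uniform bounds for the pairings with scaled differences of cut-off functions. -/
lemma StdBounded.exists_bound_cutoff (hU : ScaleStable (box U₁ U₂)) (hχ : IsCutoff U₁ U₂ χ)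
    (h0 : 0 ∈ U₂) {s : ℝ} {T : 𝓓(offI (box U₁ U₂), ℝ) →ₗ[ℝ] ℂ} (hT : BoundedOnTestSets T)
    (h : StdBounded s T) {K : Set (EuclideanSpace ℝ (Fin n))} (hK : IsCompact K) (hKU : K ⊆ U₁)
    {M : ℝ × Space n d → ℝ} (hM : ContDiff ℝ ∞ M)
    (hMK : ∀ q ∈ Ioc (0 : ℝ) 1, ∀ z, M (q, z) ≠ 0 → z.1 ∈ K) :
    ∃ C, 0 ≤ C ∧ ∀ r ∈ Ioc (0 : ℝ) 1, ∀ q ∈ Ioc (0 : ℝ) 1, ∀ ν ∈ Icc (1 : ℝ) 2,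
      IsTest (offI (box U₁ U₂)) (fun z => (χ z - χ (scal ν z)) * M (q, z)) ∧
      ‖pair T (dil r fun z => (χ z - χ (scal ν z)) * M (q, z))‖ ≤ C * r ^ (s + d) := by
  obtain ⟨K', hK', hK'U, H⟩ := hχ.isCompact_support_sub hU h0 hK hKU one_le_two
  let Q : (ℝ × ℝ) × Space n d → ℝ := fun x => (χ x.2 - χ (scal x.1.2 x.2)) * M (x.1.1, x.2)
  have hQ : ContDiff ℝ ∞ Q := by
    have hs : ContDiff ℝ ∞ fun x : (ℝ × ℝ) × Space n d => scal x.1.2 x.2 := by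
      unfold scal; fun_prop
    refine ContDiff.mul ((hχ.smooth.comp contDiff_snd).sub (hχ.smooth.comp hs)) (hM.comp ?_)
    fun_prop
  -- The parameters `(q, ν)` range over `[0, 1] × [1, 2]`. Compactness at `q = 0` gives bounds that
  -- do not degenerate as `q → 0`.
  obtain ⟨B, hB⟩ := exists_testSet_family hQ
    ((isCompact_Icc (a := (0 : ℝ)) (b := 1)).prod (isCompact_Icc (a := (1 : ℝ)) (b := 2))) hK'
  obtain ⟨C, hC0, hC⟩ := h.uniform hT (scaleStable_offI hU) hK' hK'U B
  refine ⟨C, hC0, fun r hr q hq ν hν => ?_⟩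
  have hmem := hB (q, ν) ⟨⟨hq.1.le, hq.2⟩, hν⟩ fun z hz =>
    H ν hν z (left_ne_zero_of_mul hz) (hMK q hq z (right_ne_zero_of_mul hz))
  exact ⟨isTest_of_mem_testSet hK' hK'U hmem, hC _ hmem r hr⟩

end Cutoff

end

section

variable {n d : ℕ} {U₁ : Opens (EuclideanSpace ℝ (Fin n))} {U₂ : Opens (EuclideanSpace ℝ (Fin d))}
  {χ : Space n d → ℝ}

/-- The difference `χ(x, h) - χ(x, h / r)`. -/
def cutDiff (χ : Space n d → ℝ) (r : ℝ) (z : Space n d) : ℝ := χ z - χ (scal r⁻¹ z)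

lemma contDiff_cutDiff (hχ : ContDiff ℝ ∞ χ) (r : ℝ) : ContDiff ℝ ∞ (cutDiff χ r) :=
  hχ.sub (hχ.comp (contDiff_scal _))

lemma cutDiff_one (z : Space n d) : cutDiff χ 1 z = 0 := by simp [cutDiff, scal_one]

lemma dil_one (f : Space n d → ℝ) : dil 1 f = f := by
  funext z; simp [dil]

lemma dil_apply (r : ℝ) (f : Space n d → ℝ) (z : Space n d) : dil r f z = f (scal r⁻¹ z) := rfl

lemma isTest_cutDiff_mul (hU : ScaleStable (box U₁ U₂)) (hχ : IsCutoff U₁ U₂ χ) (h0 : 0 ∈ U₂)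
    {K : Set (EuclideanSpace ℝ (Fin n))} (hK : IsCompact K) (hKU : K ⊆ U₁) {Φ : Space n d → ℝ}
    (hΦ : ContDiff ℝ ∞ Φ) (hΦK : ∀ z, Φ z ≠ 0 → z.1 ∈ K) {q : ℝ} (hq : q ∈ Ioc (0 : ℝ) 1) :
    IsTest (offI (box U₁ U₂)) (fun z => cutDiff χ q z * Φ z) := by
  have hq1 : 1 ≤ q⁻¹ := (one_le_inv₀ hq.1).2 hq.2
  obtain ⟨K', hK', hK'U, H⟩ := hχ.isCompact_support_sub hU h0 hK hKU hq1
  exact .of_support ((contDiff_cutDiff hχ.smooth q).mul hΦ) hK' hK'U fun z hz =>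
    H q⁻¹ ⟨hq1, le_rfl⟩ z (left_ne_zero_of_mul hz) (hΦK z (right_ne_zero_of_mul hz))

/-! ### Shell estimates for functions vanishing to a given order. -/

section Estimates

variable {s : ℝ} {T : 𝓓(offI (box U₁ U₂), ℝ) →ₗ[ℝ] ℂ} {K : Set (EuclideanSpace ℝ (Fin n))}
  {Φ : Space n d → ℝ} {M : ℝ × Space n d → ℝ} {k : ℕ}

/-- With `z = scal (r q) w`, the shell becomes one of unit scale and `Φ (scal q w) = q ^ k * M (q,
w)`, so the uniform bound at scale `r q` applies. The factor `r` is kept for the degree of the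
extension; `r = 1` suffices for convergence. -/
lemma exists_dyadic_bound (hU : ScaleStable (box U₁ U₂)) (hχ : IsCutoff U₁ U₂ χ) (h0 : 0 ∈ U₂)
    (hT : BoundedOnTestSets T) (h : StdBounded s T) (hK : IsCompact K) (hKU : K ⊆ U₁)
    (hΦ : ContDiff ℝ ∞ Φ) (hM : ContDiff ℝ ∞ M) (hΦM : ∀ r z, Φ (scal r z) = r ^ k * M (r, z))
    (hΦK : ∀ z, Φ z ≠ 0 → z.1 ∈ K) :
    ∃ C, 0 ≤ C ∧ ∀ r ∈ Ioc (0 : ℝ) 1, ∀ q ∈ Ioc (0 : ℝ) 1, ∀ ν ∈ Icc (1 : ℝ) 2,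
      ‖pair T (dil r fun z => cutDiff χ q z * Φ z) -
        pair T (dil r fun z => cutDiff χ (q / ν) z * Φ z)‖ ≤
      C * r ^ (s + d) * q ^ (k + s + d) := by
  obtain ⟨C, hC0, hC⟩ := h.exists_bound_cutoff hU hχ h0 hT hK hKU hM (by
    intro q hq z hz
    exact hΦK (scal q z) (by rw [hΦM]; exact mul_ne_zero (pow_ne_zero _ hq.1.ne') hz))
  refine ⟨C, hC0, fun r hr q hq ν hν => ?_⟩
  have hν0 : 0 < ν := one_pos.trans_le hν.1
  have hqν : q / ν ∈ Ioc (0 : ℝ) 1 :=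
    ⟨div_pos hq.1 hν0, (div_le_self hq.1.le hν.1).trans hq.2⟩
  have hrq : r * q ∈ Ioc (0 : ℝ) 1 :=
    ⟨mul_pos hr.1 hq.1, mul_le_one₀ hr.2 hq.1.le hq.2⟩
  have hS := scaleStable_offI hU
  have ht1 := (isTest_cutDiff_mul hU hχ h0 hK hKU hΦ hΦK hq).dil hS hr
  have ht2 := (isTest_cutDiff_mul hU hχ h0 hK hKU hΦ hΦK hqν).dil hS hr
  obtain ⟨htest, hbound⟩ := hC (r * q) hrq q hq ν hν
  have hid : (fun z => dil r (fun z => cutDiff χ q z * Φ z) z -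
      dil r (fun z => cutDiff χ (q / ν) z * Φ z) z) =
      fun z => (-q ^ k) * dil (r * q) (fun z => (χ z - χ (scal ν z)) * M (q, z)) z := by
    funext z
    set w := scal (r * q)⁻¹ z with hw
    have h1 : scal r⁻¹ z = scal q w := by
      rw [hw, scal_scal, mul_inv, mul_left_comm, mul_inv_cancel₀ hq.1.ne', mul_one]
    have h2 : scal q⁻¹ (scal q w) = w := by
      rw [scal_scal, inv_mul_cancel₀ hq.1.ne', scal_one]
    have h3 : scal (q / ν)⁻¹ (scal q w) = scal ν w := by
      rw [scal_scal, inv_div, div_mul_cancel₀ _ hq.1.ne']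
    simp only [dil_apply, h1, ← hw, cutDiff, h2, h3, hΦM]
    ring
  rw [← pair_sub T ht1 ht2, hid, pair_smul T (htest.dil hS hrq), norm_smul, norm_neg, norm_pow,
    Real.norm_of_nonneg hq.1.le]
  calc q ^ k * ‖pair T (dil (r * q) fun z => (χ z - χ (scal ν z)) * M (q, z))‖
      ≤ q ^ k * (C * (r * q) ^ (s + d)) := by gcongr; exact pow_nonneg hq.1.le _
    _ = C * r ^ (s + d) * q ^ (k + s + d) := by
      have h4 : q ^ ((k : ℝ) + s + d) = q ^ k * q ^ (s + d) := by
        rw [add_assoc, Real.rpow_add hq.1, Real.rpow_natCast]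
      rw [Real.mul_rpow hr.1.le hq.1.le, h4]
      ring

lemma exists_uniform_bound (hU : ScaleStable (box U₁ U₂)) (hχ : IsCutoff U₁ U₂ χ) (h0 : 0 ∈ U₂)
    (hT : BoundedOnTestSets T) (h : StdBounded s T) (hK : IsCompact K) (hKU : K ⊆ U₁)
    (hΦ : ContDiff ℝ ∞ Φ) (hM : ContDiff ℝ ∞ M) (hΦM : ∀ r z, Φ (scal r z) = r ^ k * M (r, z))
    (hΦK : ∀ z, Φ z ≠ 0 → z.1 ∈ K) (hk : 0 < k + s + d) :
    ∃ C, ∀ r ∈ Ioc (0 : ℝ) 1, ∀ q ∈ Ioc (0 : ℝ) 1,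
      ‖pair T (dil r fun z => cutDiff χ q z * Φ z)‖ ≤ C * r ^ (s + d) := by
  obtain ⟨C, hC0, hC⟩ := exists_dyadic_bound hU hχ h0 hT h hK hKU hΦ hM hΦM hΦK
  refine ⟨C / (1 - 2⁻¹ ^ ((k : ℝ) + s + d)), fun r hr q hq => ?_⟩
  have h1 := norm_sub_le_of_pos (G := fun q => pair T (dil r fun z => cutDiff χ q z * Φ z)) hk
    (hC r hr) 1 (by simp) q hq
  simp only [cutDiff_one, zero_mul, one_mul, Real.one_rpow, mul_one] at h1
  have h2 : pair T (dil r fun _ : Space n d => (0 : ℝ)) = 0 := pair_zero T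
  rw [h2, zero_sub, norm_neg] at h1
  exact h1.trans_eq (by ring)

lemma exists_limit (hU : ScaleStable (box U₁ U₂)) (hχ : IsCutoff U₁ U₂ χ) (h0 : 0 ∈ U₂)
    (hT : BoundedOnTestSets T) (h : StdBounded s T) (hK : IsCompact K) (hKU : K ⊆ U₁)
    (hΦ : ContDiff ℝ ∞ Φ) (hM : ContDiff ℝ ∞ M) (hΦM : ∀ r z, Φ (scal r z) = r ^ k * M (r, z))
    (hΦK : ∀ z, Φ z ≠ 0 → z.1 ∈ K) (hk : 0 < k + s + d) :
    ∃ L C, ∀ q ∈ Ioc (0 : ℝ) 1,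
      ‖pair T (fun z => cutDiff χ q z * Φ z) - L‖ ≤ C * q ^ (k + s + d) := by
  obtain ⟨C, -, hC⟩ := exists_dyadic_bound hU hχ h0 hT h hK hKU hΦ hM hΦM hΦK
  have h1 := hC 1 (by simp)
  simp only [dil_one, Real.one_rpow, mul_one] at h1
  obtain ⟨L, hL⟩ := exists_limit_of_pos
    (G := fun q => pair T fun z => cutDiff χ q z * Φ z) hk h1
  exact ⟨L, _, hL⟩

/-- The exponent `b` may be smaller than `k + s + d`, so the borderline case `k + s + d = 0` is
covered at the price of a power instead of a logarithm. -/
lemma exists_bound_of_neg (hU : ScaleStable (box U₁ U₂)) (hχ : IsCutoff U₁ U₂ χ) (h0 : 0 ∈ U₂)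
    (hT : BoundedOnTestSets T) (h : StdBounded s T) (hK : IsCompact K) (hKU : K ⊆ U₁)
    (hΦ : ContDiff ℝ ∞ Φ) (hM : ContDiff ℝ ∞ M) (hΦM : ∀ r z, Φ (scal r z) = r ^ k * M (r, z))
    (hΦK : ∀ z, Φ z ≠ 0 → z.1 ∈ K) {b : ℝ} (hb : b < 0) (hbk : b ≤ k + s + d) :
    ∃ C, ∀ q ∈ Ioc (0 : ℝ) 1, ‖pair T (fun z => cutDiff χ q z * Φ z)‖ ≤ C * q ^ b := by
  obtain ⟨C, hC0, hC⟩ := exists_dyadic_bound hU hχ h0 hT h hK hKU hΦ hM hΦM hΦK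
  have h1 := hC 1 (by simp)
  simp only [dil_one, Real.one_rpow, mul_one] at h1
  refine ⟨C / (1 - 2 ^ b), fun q hq => ?_⟩
  have h2 := norm_sub_le_of_neg (G := fun q => pair T fun z => cutDiff χ q z * Φ z) hb
    (fun r hr ν hν => (h1 r hr ν hν).trans (mul_le_mul_of_nonneg_left
      (Real.rpow_le_rpow_of_exponent_ge hr.1 hr.2 hbk) hC0)) q hq
  simp only [cutDiff_one, zero_mul] at h2
  rwa [pair_zero, zero_sub, norm_neg] at h2

end Estimates

/-! ### Taylor terms and transverse derivatives under scaling. -/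

section Traces

variable {U : Opens (Space n d)}

lemma fst_mem_of_transverseDeriv_ne_zero {α : Fin d → ℕ} {φ : 𝓓(U, ℝ)} {z : Space n d}
    (h : transverseDeriv α φ (z.1, 0) ≠ 0) : z.1 ∈ Prod.fst '' tsupport φ :=
  ⟨(z.1, 0), tsupport_transverseDeriv α φ (subset_tsupport _ h), rfl⟩

lemma fst_mem_of_taylorRemainder_ne_zero {m : ℤ} {φ : 𝓓(U, ℝ)} {z : Space n d}
    (h : taylorRemainder m φ z ≠ 0) : z.1 ∈ Prod.fst '' tsupport φ := by
  by_contra hz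
  apply h
  have h1 : ∀ α : Fin d → ℕ, transverseDeriv α φ (z.1, 0) = 0 := fun α => by
    by_contra h'
    exact hz (fst_mem_of_transverseDeriv_ne_zero h')
  have h2 : φ z = 0 := by
    by_contra h'
    exact hz ⟨z, subset_tsupport _ h', rfl⟩
  simp [taylorRemainder, h1, h2]

lemma isCompact_fst_tsupport (φ : 𝓓(U, ℝ)) : IsCompact (Prod.fst '' tsupport φ) :=
  φ.hasCompactSupport.isCompact.image continuous_fst

lemma fst_tsupport_subset (φ : 𝓓(box U₁ U₂, ℝ)) : Prod.fst '' tsupport φ ⊆ U₁ := by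
  rintro _ ⟨z, hz, rfl⟩
  exact (φ.tsupport_subset hz).1

/-- The functions `h^α / α! ∂_h^α φ(x, 0)`. -/
def taylorTerm (α : Fin d → ℕ) (φ : 𝓓(U, ℝ)) (z : Space n d) : ℝ :=
  mon α z * transverseDeriv α φ (z.1, 0)

lemma contDiff_taylorTerm (α : Fin d → ℕ) (φ : 𝓓(U, ℝ)) : ContDiff ℝ ∞ (taylorTerm α φ) :=
  (contDiff_mon α).mul
    ((transverseDeriv α φ).contDiff.comp (contDiff_fst.prodMk contDiff_const))

lemma taylorTerm_scal (α : Fin d → ℕ) (φ : 𝓓(U, ℝ)) (r : ℝ) (z : Space n d) :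
    taylorTerm α φ (scal r z) = r ^ (∑ j, α j) * taylorTerm α φ z := by
  rw [taylorTerm, mon_scal, mul_assoc]
  rfl

/-- Transverse derivatives as continuous linear maps. -/
def transverseCLM (α : Fin d → ℕ) : 𝓓(U, ℝ) →L[ℝ] 𝓓(U, ℝ) :=
  (List.finRange d).foldr (fun j L =>
    ((TestFunction.lineDerivCLM ℝ ((0, EuclideanSpace.single j 1) : Space n d) :
      𝓓(U, ℝ) →L[ℝ] 𝓓(U, ℝ)) ^ α j) ∘L L) (ContinuousLinearMap.id ℝ _)

lemma transverseCLM_apply (α : Fin d → ℕ) (φ : 𝓓(U, ℝ)) :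
    transverseCLM α φ = transverseDeriv α φ := by
  rw [transverseDeriv_eq_foldr, transverseCLM]
  induction List.finRange d with
  | nil => rfl
  | cons a l ih =>
    simp only [List.foldr_cons, ContinuousLinearMap.comp_apply, ih]
    generalize l.foldr (fun j g => (dh j)^[α j] g) φ = g
    induction α a generalizing g with
    | zero => rfl
    | succ k ihk =>
      rw [pow_succ, Function.iterate_succ_apply, ← ihk]
      rfl

lemma dh_scaleTest (hU : ScaleStable U) {r : ℝ} (hr : r ∈ Ioc (0 : ℝ) 1) (j : Fin d)
    (φ : 𝓓(U, ℝ)) : dh j (scaleTest hU r hr φ) = r⁻¹ • scaleTest hU r hr (dh j φ) := by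
  ext z
  change dh j (scaleTest hU r hr φ) z = r⁻¹ * dh j φ (scal r⁻¹ z)
  rw [dh, dh, lineDeriv_test_apply, lineDeriv_test_apply]
  let L : Space n d →L[ℝ] Space n d :=
    (ContinuousLinearMap.fst ℝ _ _).prod (r⁻¹ • ContinuousLinearMap.snd ℝ _ _)
  have h1 : HasFDerivAt (scaleTest hU r hr φ) ((fderiv ℝ φ (scal r⁻¹ z)).comp L) z :=
    ((φ.contDiff.differentiable (by simp) (scal r⁻¹ z)).hasFDerivAt).comp z L.hasFDerivAt
  rw [h1.fderiv, ContinuousLinearMap.comp_apply]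
  have h2 : L (0, EuclideanSpace.single j 1) =
      r⁻¹ • ((0, EuclideanSpace.single j 1) : Space n d) := by
    simp [L]
  rw [h2, map_smul, smul_eq_mul]

lemma transverseDeriv_scaleTest (hU : ScaleStable U) {r : ℝ} (hr : r ∈ Ioc (0 : ℝ) 1)
    (α : Fin d → ℕ) (φ : 𝓓(U, ℝ)) : transverseDeriv α (scaleTest hU r hr φ) =
      (r⁻¹ ^ (∑ j, α j)) • scaleTest hU r hr (transverseDeriv α φ) := by
  have key : ∀ (j : Fin d) (c : ℝ) (g : 𝓓(U, ℝ)) (k : ℕ),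
      (dh j)^[k] (c • scaleTest hU r hr g) =
        (c * r⁻¹ ^ k) • scaleTest hU r hr ((dh j)^[k] g) := by
    intro j c g k
    induction k generalizing c g with
    | zero => simp
    | succ k ih =>
      have h1 : dh j (c • scaleTest hU r hr g) = (c * r⁻¹) • scaleTest hU r hr (dh j g) := by
        have : dh j (c • scaleTest hU r hr g) = c • dh j (scaleTest hU r hr g) :=
          map_smul (TestFunction.lineDerivCLM ℝ
            ((0, EuclideanSpace.single j 1) : Space n d) : 𝓓(U, ℝ) →L[ℝ] 𝓓(U, ℝ)) c _
        rw [this, dh_scaleTest, smul_smul]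
      rw [Function.iterate_succ_apply, Function.iterate_succ_apply, h1, ih, mul_assoc, ← pow_succ']
  have h2 : ∑ j, α j = ((List.finRange d).map α).sum := by
    rw [← List.sum_ofFn, List.ofFn_eq_map]
  rw [transverseDeriv_eq_foldr, transverseDeriv_eq_foldr, h2]
  induction List.finRange d with
  | nil => simp
  | cons a l ih =>
    simp only [List.foldr_cons, ih, key, List.map_cons, List.sum_cons]
    rw [← pow_add, add_comm]

end Traces

end

/-! ### Existence of the canonical extension. -/

section

section Bundling

variable {E : Type*} [NormedAddCommGroup E] [NormedSpace ℝ E] {W : Opens E}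

/-- A continuous linear form on test functions, as a distribution. -/
def toDistribution (T : 𝓓(W, ℝ) →ₗ[ℝ] ℂ) (hT : Continuous T) : 𝓓'(W, ℂ) where
  toFun := T
  map_add' := T.map_add
  map_smul' := T.map_smul
  cont := hT

@[simp] lemma toDistribution_apply (T : 𝓓(W, ℝ) →ₗ[ℝ] ℂ) (hT : Continuous T) (φ : 𝓓(W, ℝ)) :
    toDistribution T hT φ = T φ := rfl

lemma PullMul.continuous {E' : Type*} [NormedAddCommGroup E'] [NormedSpace ℝ E'] {W' : Opens E'}
    {κ : E → ℝ} {π : E → E'} (h : PullMul W W' κ π) (t : 𝓓'(W, ℂ)) :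
    Continuous fun φ => t (h.lin φ) :=
  (h.bounded (boundedOnTestSets_distribution t)).continuous

end Bundling

variable {n d : ℕ} {U₁ : Opens (EuclideanSpace ℝ (Fin n))} {U₂ : Opens (EuclideanSpace ℝ (Fin d))}
  {χ : Space n d → ℝ}

lemma taylorRemainder_eq_sub {U : Opens (Space n d)} (m : ℤ) (φ : 𝓓(U, ℝ)) (z : Space n d) :
    taylorRemainder m φ z = φ z - ∑ α ∈ multiIndices d m, taylorTerm α φ z := rfl

lemma innerTest_apply (hU : ScaleStable (box U₁ U₂)) (hχ : IsCutoff U₁ U₂ χ) (m : ℤ) {ε : ℝ}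
    (hε : ε ∈ Ioc (0 : ℝ) 1) (φ : 𝓓(box U₁ U₂, ℝ)) (z : Space n d) :
    innerTest hU hχ m ε hε φ z = cutDiff χ ε z * taylorRemainder m φ z := rfl

lemma outerTest_apply (hχ : IsCutoff U₁ U₂ χ) (φ : 𝓓(box U₁ U₂, ℝ)) (z : Space n d) :
    outerTest hχ φ z = (1 - χ z) * φ z := rfl

lemma notMem_tsupport_one_sub (hχ : IsCutoff U₁ U₂ χ) {z : Space n d} (hz : z.2 = 0) :
    z ∉ tsupport fun z => 1 - χ z := by
  refine notMem_tsupport_iff_eventuallyEq.2 ?_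
  filter_upwards [hχ.eq_one z hz] with w hw
  simp [hw]

lemma pullMul_one_sub (hχ : IsCutoff U₁ U₂ χ) :
    PullMul (offI (box U₁ U₂)) (box U₁ U₂) (fun z => 1 - χ z) id where
  smooth := contDiff_const.sub hχ.smooth
  smooth' := contDiff_id
  proper K hK hKU := ⟨K ∩ tsupport fun z => 1 - χ z, hK.inter_right (isClosed_tsupport _),
    fun _ hz => ⟨hKU hz.1, fun h => notMem_tsupport_one_sub hχ h hz.2⟩,
    fun _ hz hzK => ⟨hzK, subset_tsupport _ hz⟩⟩

lemma pullMul_cutDiff (hU : ScaleStable (box U₁ U₂)) (hχ : IsCutoff U₁ U₂ χ) (h0 : 0 ∈ U₂)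
    {g : Space n d → ℝ} (hg : ContDiff ℝ ∞ g) {π : Space n d → Space n d} (hπ : ContDiff ℝ ∞ π)
    (hπ1 : ∀ z, (π z).1 = z.1) {q : ℝ} (hq : q ∈ Ioc (0 : ℝ) 1) :
    PullMul (offI (box U₁ U₂)) (box U₁ U₂) (fun z => cutDiff χ q z * g z) π where
  smooth := (contDiff_cutDiff hχ.smooth q).mul hg
  smooth' := hπ
  proper K hK hKU := by
    have hq1 : 1 ≤ q⁻¹ := (one_le_inv₀ hq.1).2 hq.2
    obtain ⟨K', hK', hK'U, H⟩ := hχ.isCompact_support_sub hU h0 (hK.image continuous_fst)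
      (by rintro _ ⟨z, hz, rfl⟩; exact (hKU hz).1) hq1
    exact ⟨K', hK', hK'U, fun z hz hzK =>
      H _ ⟨hq1, le_rfl⟩ z (left_ne_zero_of_mul hz) ⟨π z, hzK, hπ1 z⟩⟩

lemma pullMul_cutoff (hχ : IsCutoff U₁ U₂ χ) (h0 : 0 ∈ U₂) {g : Space n d → ℝ}
    (hg : ContDiff ℝ ∞ g) : PullMul (box U₁ U₂) U₁ (fun z => χ z * g z) Prod.fst where
  smooth := hχ.smooth.mul hg
  smooth' := contDiff_fst
  proper K hK hKU := by
    obtain ⟨K', hK', hK'U, H⟩ := hχ.isCompact_support h0 hK hKU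
    exact ⟨K', hK', hK'U, fun z hz hzK => H z (left_ne_zero_of_mul hz) hzK⟩

/-- The approximations of the canonical extension are distributions. -/
lemma exists_approximation (hU : ScaleStable (box U₁ U₂)) (hχ : IsCutoff U₁ U₂ χ) (h0 : 0 ∈ U₂)
    (t : 𝓓'(offI (box U₁ U₂), ℂ)) (m : ℤ) {ε : ℝ} (hε : ε ∈ Ioc (0 : ℝ) 1) :
    ∃ F : 𝓓(box U₁ U₂, ℝ) →ₗ[ℝ] ℂ, BoundedOnTestSets F ∧
      ∀ φ, F φ = t (innerTest hU hχ m ε hε φ) + t (outerTest hχ φ) := by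
  -- The approximation is assembled from the `φ` part of `I_m φ` (`A`), its Taylor terms (`B`, where
  -- `π` projects onto `I` after a transverse derivative) and the part `(1 - χ) φ` (`C`).
  let A := pullMul_cutDiff hU hχ h0 (contDiff_const (c := (1 : ℝ))) contDiff_id (fun _ => rfl) hε
  let π : Space n d → Space n d := fun z => (z.1, 0)
  have hπ : ContDiff ℝ ∞ π := contDiff_fst.prodMk contDiff_const
  let B := fun α : Fin d → ℕ => pullMul_cutDiff hU hχ h0 (contDiff_mon α) hπ (fun _ => rfl) hε
  let C := pullMul_one_sub hχ
  let t' : 𝓓(offI (box U₁ U₂), ℝ) →ₗ[ℝ] ℂ := t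
  let F : 𝓓(box U₁ U₂, ℝ) →ₗ[ℝ] ℂ := t' ∘ₗ (A.lin -
    ∑ α ∈ multiIndices d m, (B α).lin ∘ₗ (transverseCLM (U := box U₁ U₂) α).toLinearMap + C.lin)
  have hF : ∀ φ, F φ = t (A.lin φ) -
      ∑ α ∈ multiIndices d m, t ((B α).lin (transverseCLM α φ)) + t (C.lin φ) := fun φ => by
    change t' _ = t' _ - ∑ α ∈ multiIndices d m, t' _ + t' _
    simp [map_add, map_sub, map_sum]
  refine ⟨F, boundedOnTestSets_of_continuous ?_, fun φ => ?_⟩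
  · change Continuous fun φ => F φ
    simp only [hF]
    exact ((A.continuous t).sub (continuous_finsetSum _ fun α _ =>
      ((B α).continuous t).comp (transverseCLM α).continuous)).add (C.continuous t)
  · change t' _ = t' _ + t' _
    rw [← map_add]
    congr 1
    ext z
    have h1 : ((A.lin - ∑ α ∈ multiIndices d m,
        (B α).lin ∘ₗ (transverseCLM (U := box U₁ U₂) α).toLinearMap + C.lin) φ) z =
        cutDiff χ ε z * 1 * φ z - ∑ α ∈ multiIndices d m,
          cutDiff χ ε z * mon α z * transverseDeriv α φ (z.1, 0) + (1 - χ z) * φ z := by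
      simp only [LinearMap.add_apply, LinearMap.sub_apply, LinearMap.sum_apply,
        add_apply, sub_apply, sum_apply]
      simp only [LinearMap.comp_apply, ContinuousLinearMap.coe_coe, transverseCLM_apply]
      rfl
    rw [h1, add_apply, innerTest_apply, outerTest_apply, taylorRemainder_eq_sub,
      mul_sub, Finset.mul_sum, mul_one]
    simp only [taylorTerm, mul_assoc]

/-- Zero is a limit point of `(0, 1]`, so limits as `ε → 0` along this filter are unique. -/
instance comap_val_neBot : (comap (Subtype.val : Ioc (0 : ℝ) 1 → ℝ) (𝓝 0)).NeBot := by
  refine comap_neBot_iff.2 fun s hs => ?_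
  obtain ⟨δ, hδ, h⟩ := Metric.mem_nhds_iff.1 hs
  refine ⟨⟨min (δ / 2) 1, lt_min (half_pos hδ) one_pos, min_le_right _ _⟩, h ?_⟩
  have : 0 < min (δ / 2) 1 := lt_min (half_pos hδ) one_pos
  rw [Metric.mem_ball, Real.dist_0_eq_abs, abs_of_pos this]
  exact (min_le_left _ _).trans_lt (half_lt_self hδ)

/-- The exponent of `h` which can be factored out of the Taylor remainder. -/
lemma toNat_add_pos (s : ℝ) (d : ℕ) : 0 < ((⌊-s - d⌋ + 1).toNat : ℝ) + s + d := by
  have h1 : ((⌊-s - d⌋ + 1 : ℤ) : ℝ) ≤ ((⌊-s - d⌋ + 1).toNat : ℝ) := by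
    exact_mod_cast Int.self_le_toNat _
  have h2 := Int.lt_floor_add_one (-s - d)
  push_cast at h1
  linarith

/-- The canonical extension of a weakly homogeneous distribution. -/
theorem exists_canonicalExtension (hU : ScaleStable (box U₁ U₂)) (hχ : IsCutoff U₁ U₂ χ)
    (h0 : 0 ∈ U₂) {s : ℝ} {t : 𝓓'(offI (box U₁ U₂), ℂ)}
    (ht : StdBounded s (t : 𝓓(offI (box U₁ U₂), ℝ) →ₗ[ℝ] ℂ)) :
    ∃ T : 𝓓'(box U₁ U₂, ℂ), IsCanonicalExtension hU hχ s t T := by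
  choose F hF hFt using fun ε : Ioc (0 : ℝ) 1 =>
    exists_approximation hU hχ h0 t ⌊-s - d⌋ ε.2
  have hlim : ∀ φ, ∃ L, Tendsto (fun ε => F ε φ) (comap Subtype.val (𝓝 0)) (𝓝 L) := by
    intro φ
    obtain ⟨R, hR, hRr⟩ := exists_taylorRemainder ⌊-s - d⌋ φ
    obtain ⟨L, C, h⟩ := exists_limit hU hχ h0 (boundedOnTestSets_distribution t) ht
      (isCompact_fst_tsupport φ) (fst_tsupport_subset φ) (contDiff_taylorRemainder _ φ) hR hRr
      (fun z => fst_mem_of_taylorRemainder_ne_zero) (toNat_add_pos s d)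
    refine ⟨L + t (outerTest hχ φ), ?_⟩
    simp only [hFt]
    refine Tendsto.add_const _ (tendsto_iff_norm_sub_tendsto_zero.2 ?_)
    have h1 : Tendsto (fun q : ℝ => C * q ^ (((⌊-s - d⌋ + 1).toNat : ℝ) + s + d)) (𝓝 0) (𝓝 0) := by
      have := (Real.continuousAt_rpow_const 0 (((⌊-s - d⌋ + 1).toNat : ℝ) + s + d)
        (Or.inr (toNat_add_pos s d).le)).tendsto.const_mul C
      rwa [Real.zero_rpow (toNat_add_pos s d).ne', mul_zero] at this
    refine squeeze_zero (fun _ => norm_nonneg _) (fun ε => ?_) (h1.comp tendsto_comap)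
    exact (congrArg (‖· - L‖) (pair_coe (t : 𝓓(offI (box U₁ U₂), ℝ) →ₗ[ℝ] ℂ)
      (innerTest hU hχ ⌊-s - d⌋ ε ε.2 φ))).symm.trans_le (h ε ε.2)
  choose L hL using hlim
  let T : 𝓓(box U₁ U₂, ℝ) →ₗ[ℝ] ℂ :=
    { toFun := L
      map_add' := fun φ φ' => tendsto_nhds_unique (hL _) (by
        simpa only [map_add] using (hL φ).add (hL φ'))
      map_smul' := fun c φ => tendsto_nhds_unique (hL _) (by
        simpa only [map_smul, RingHom.id_apply] using (hL φ).const_smul c) }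
  have hT : Continuous T := by
    -- Passing to the sequence `ε = 2⁻¹ ^ k` makes the approximations bounded at each test function,
    -- as Banach–Steinhaus requires.
    let e : ℕ → Ioc (0 : ℝ) 1 := fun k =>
      ⟨2⁻¹ ^ k, by positivity, pow_le_one₀ (by norm_num) (by norm_num)⟩
    refine continuous_of_tendsto (S := fun k => F (e k)) (fun k => hF _) fun φ =>
      (hL φ).comp (tendsto_comap_iff.2 ?_)
    exact tendsto_pow_atTop_nhds_zero_of_lt_one (by norm_num) (by norm_num)
  refine ⟨toDistribution T hT, fun φ => ?_⟩
  have h := hL φ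
  simp only [hFt] at h
  exact h

lemma transverseDeriv_monoCLM_apply {U : Opens (Space n d)} (α : Fin d → ℕ) (φ : 𝓓(offI U, ℝ))
    (x : EuclideanSpace ℝ (Fin n)) :
    transverseDeriv α (TestFunction.monoCLM ℝ φ : 𝓓(U, ℝ)) (x, 0) = 0 := by
  have hle : offI U ≤ U := fun _ hz => hz.1
  have h1 : ((TestFunction.monoCLM ℝ φ : 𝓓(U, ℝ)) : Space n d → ℝ) = φ := by
    ext z; simp [TestFunction.monoCLM_apply, hle]
  refine image_eq_zero_of_notMem_tsupport fun h => ?_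
  have h2 := tsupport_transverseDeriv α _ h
  rw [h1] at h2
  exact (φ.tsupport_subset h2).2 rfl

lemma coe_monoCLM_offI {U : Opens (Space n d)} (φ : 𝓓(offI U, ℝ)) :
    ((TestFunction.monoCLM ℝ φ : 𝓓(U, ℝ)) : Space n d → ℝ) = φ := by
  have hle : offI U ≤ U := fun _ hz => hz.1
  ext z; simp [TestFunction.monoCLM_apply, hle]

/-- On a compact set disjoint from `I`, the scaled cut-off functions vanish eventually. -/
lemma IsCutoff.exists_scal_eq_zero (hχ : IsCutoff U₁ U₂ χ) {K : Set (Space n d)}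
    (hK : IsCompact K) (hKI : ∀ z ∈ K, z.2 ≠ 0) :
    ∃ δ > 0, ∀ ε ∈ Ioo (0 : ℝ) δ, ∀ z ∈ K, χ (scal ε⁻¹ z) = 0 := by
  obtain ⟨B, hB⟩ := isBounded_iff_forall_norm_le.1
    (hχ.proper _ (hK.image continuous_fst)).isBounded
  obtain ⟨c, hc, hcK⟩ : ∃ c > 0, ∀ z ∈ K, c ≤ ‖z.2‖ := by
    rcases K.eq_empty_or_nonempty with rfl | hne
    · exact ⟨1, one_pos, fun _ h => h.elim⟩
    · obtain ⟨z, hz, h⟩ := hK.exists_isMinOn hne (f := fun z => ‖z.2‖) (by fun_prop)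
      exact ⟨_, norm_pos_iff.2 (hKI z hz), fun w hw => h hw⟩
  have hB1 : 0 < |B| + 1 := by positivity
  -- Over the projection of `K` the support of `χ` has norm at most `B`, while `‖h‖ ≥ c` on `K`; so
  -- `h / ε` leaves that support once `ε < c / (|B| + 1)`.
  refine ⟨c / (|B| + 1), div_pos hc hB1, fun ε hε z hz => ?_⟩
  by_contra h
  have h1 : ‖scal ε⁻¹ z‖ ≤ B := hB _ ⟨subset_tsupport _ h, ⟨z, hz, rfl⟩⟩
  have h2 : ‖ε⁻¹ • z.2‖ ≤ B := (norm_snd_le (scal ε⁻¹ z)).trans h1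
  rw [norm_smul, norm_inv, Real.norm_of_nonneg hε.1.le, inv_mul_le_iff₀ hε.1] at h2
  have h3 := (lt_div_iff₀ hB1).1 hε.2
  nlinarith [hcK z hz, le_abs_self B, hε.1]

/-- The approximations of the canonical extension are eventually equal to `t` on test functions
which are supported away from `I`. -/
lemma tendsto_approximation_monoCLM (hU : ScaleStable (box U₁ U₂)) (hχ : IsCutoff U₁ U₂ χ) (m : ℤ)
    (t : 𝓓'(offI (box U₁ U₂), ℂ)) (φ : 𝓓(offI (box U₁ U₂), ℝ)) :
    Tendsto (fun ε : Ioc (0 : ℝ) 1 => t (innerTest hU hχ m ε ε.2 (TestFunction.monoCLM ℝ φ)) +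
      t (outerTest hχ (TestFunction.monoCLM ℝ φ))) (comap Subtype.val (𝓝 0)) (𝓝 (t φ)) := by
  obtain ⟨δ, hδ, H⟩ := hχ.exists_scal_eq_zero φ.hasCompactSupport
    fun z hz => (φ.tsupport_subset hz).2
  refine tendsto_nhds_of_eventually_eq ?_
  have h1 : ∀ᶠ ε : Ioc (0 : ℝ) 1 in comap Subtype.val (𝓝 0), (ε : ℝ) < δ :=
    tendsto_comap.eventually (gt_mem_nhds hδ)
  filter_upwards [h1] with ε hε
  have h2 := map_add (t : 𝓓(offI (box U₁ U₂), ℝ) →ₗ[ℝ] ℂ)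
    (innerTest hU hχ m ε ε.2 (TestFunction.monoCLM ℝ φ))
    (outerTest hχ (TestFunction.monoCLM ℝ φ))
  refine h2.symm.trans (congrArg t ?_)
  ext z
  rw [add_apply, innerTest_apply, outerTest_apply, taylorRemainder_eq_sub,
    coe_monoCLM_offI]
  simp only [taylorTerm, transverseDeriv_monoCLM_apply, mul_zero, Finset.sum_const_zero, sub_zero,
    cutDiff]
  by_cases hz : z ∈ tsupport φ
  · rw [H ε ⟨ε.2.1, hε⟩ z hz]
    ring
  · rw [image_eq_zero_of_notMem_tsupport hz]
    ring

lemma IsCanonicalExtension.isExtension {hU : ScaleStable (box U₁ U₂)} {hχ : IsCutoff U₁ U₂ χ}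
    {s : ℝ} {t : 𝓓'(offI (box U₁ U₂), ℂ)} {T : 𝓓'(box U₁ U₂, ℂ)}
    (h : IsCanonicalExtension hU hχ s t T) : IsExtension t T := fun φ =>
  tendsto_nhds_unique (h _) (tendsto_approximation_monoCLM hU hχ _ t φ)

end

section

variable {n d : ℕ} {U₁ : Opens (EuclideanSpace ℝ (Fin n))} {U₂ : Opens (EuclideanSpace ℝ (Fin d))}
  {χ : Space n d → ℝ}

/-! ### The degree of the canonical extension. -/

section Scaling

lemma taylorTerm_scaleTest {U : Opens (Space n d)} (hU : ScaleStable U) {r : ℝ}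
    (hr : r ∈ Ioc (0 : ℝ) 1) (α : Fin d → ℕ) (φ : 𝓓(U, ℝ)) (z : Space n d) :
    taylorTerm α (scaleTest hU r hr φ) z = r⁻¹ ^ (∑ j, α j) * taylorTerm α φ z := by
  rw [taylorTerm, transverseDeriv_scaleTest, smul_apply, smul_eq_mul, coe_scaleTest]
  simp only [dil, smul_zero, taylorTerm]
  ring

lemma isTest_cutDiff_taylorTerm (hU : ScaleStable (box U₁ U₂)) (hχ : IsCutoff U₁ U₂ χ)
    (h0 : 0 ∈ U₂) (α : Fin d → ℕ) (φ : 𝓓(box U₁ U₂, ℝ)) {q : ℝ} (hq : q ∈ Ioc (0 : ℝ) 1) :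
    IsTest (offI (box U₁ U₂)) fun z => cutDiff χ q z * taylorTerm α φ z :=
  isTest_cutDiff_mul hU hχ h0 (isCompact_fst_tsupport φ) (fst_tsupport_subset φ)
    (contDiff_taylorTerm α φ)
    (fun _ hz => fst_mem_of_transverseDeriv_ne_zero (right_ne_zero_of_mul hz)) hq

/-- The approximations of the canonical extension, on scaled test functions. -/
lemma approximation_scaleTest (hU : ScaleStable (box U₁ U₂)) (hχ : IsCutoff U₁ U₂ χ) (h0 : 0 ∈ U₂)
    (t : 𝓓'(offI (box U₁ U₂), ℂ)) (m : ℤ) (φ : 𝓓(box U₁ U₂, ℝ)) {r q : ℝ}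
    (hr : r ∈ Ioc (0 : ℝ) 1) (hq : q ∈ Ioc (0 : ℝ) 1) (hrq : r * q ∈ Ioc (0 : ℝ) 1) :
    t (innerTest hU hχ m (r * q) hrq (scaleTest hU r hr φ)) +
        t (outerTest hχ (scaleTest hU r hr φ)) =
      pair (t : 𝓓(offI (box U₁ U₂), ℝ) →ₗ[ℝ] ℂ) (dil r (outerTest hχ φ)) +
      pair (t : 𝓓(offI (box U₁ U₂), ℝ) →ₗ[ℝ] ℂ)
        (dil r fun z => cutDiff χ q z * taylorRemainder m φ z) -
      ∑ α ∈ multiIndices d m, r⁻¹ ^ (∑ j, α j) •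
        pair (t : 𝓓(offI (box U₁ U₂), ℝ) →ₗ[ℝ] ℂ) fun z => cutDiff χ r z * taylorTerm α φ z := by
  set t' := (t : 𝓓(offI (box U₁ U₂), ℝ) →ₗ[ℝ] ℂ)
  have hS := scaleStable_offI hU
  have h1 : IsTest (offI (box U₁ U₂)) (dil r (outerTest hχ φ)) := (isTest_coe _).dil hS hr
  have h2 : IsTest (offI (box U₁ U₂)) (dil r fun z => cutDiff χ q z * taylorRemainder m φ z) :=
    (isTest_coe (innerTest hU hχ m q hq φ)).dil hS hr
  have h3 : ∀ α ∈ multiIndices d m, IsTest (offI (box U₁ U₂))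
      (fun z => r⁻¹ ^ (∑ j, α j) * (cutDiff χ r z * taylorTerm α φ z)) := fun α _ =>
    (isTest_cutDiff_taylorTerm hU hχ h0 α φ hr).smul _
  have h4 : ∀ α, r⁻¹ ^ (∑ j, α j) • pair t' (fun z => cutDiff χ r z * taylorTerm α φ z) =
      pair t' fun z => r⁻¹ ^ (∑ j, α j) * (cutDiff χ r z * taylorTerm α φ z) := fun α =>
    (pair_smul t' (isTest_cutDiff_taylorTerm hU hχ h0 α φ hr) _).symm
  simp only [h4]
  rw [← pair_sum t' h3, ← pair_add t' h1 h2, ← pair_sub t' (h1.add h2) (.sum h3)]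
  change t' _ + t' _ = _
  rw [← pair_coe t', ← pair_coe t', ← pair_add t' (isTest_coe _) (isTest_coe _)]
  congr 1
  funext z
  rw [innerTest_apply, outerTest_apply, dil_apply, dil_apply, outerTest_apply,
    taylorRemainder_eq_sub, taylorRemainder_eq_sub]
  have h5 : scal (r * q)⁻¹ z = scal q⁻¹ (scal r⁻¹ z) := by rw [scal_scal, mul_inv, mul_comm]
  have h6 : scaleTest hU r hr φ z = φ (scal r⁻¹ z) := rfl
  simp only [taylorTerm_scaleTest, taylorTerm_scal, cutDiff, h5, h6, mul_left_comm _ (χ z - _),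
    ← Finset.mul_sum]
  ring

/-- The canonical extension has bounded scaled families. -/
theorem IsCanonicalExtension.stdBounded {hU : ScaleStable (box U₁ U₂)} {hχ : IsCutoff U₁ U₂ χ}
    (h0 : 0 ∈ U₂) {s s' : ℝ} {t : 𝓓'(offI (box U₁ U₂), ℂ)} {T : 𝓓'(box U₁ U₂, ℂ)}
    (hT : IsCanonicalExtension hU hχ s t T)
    (ht : StdBounded s (t : 𝓓(offI (box U₁ U₂), ℝ) →ₗ[ℝ] ℂ)) (hs : s' ≤ s)
    (hα : ∀ α ∈ multiIndices d ⌊-s - d⌋, ((∑ j, α j : ℕ) : ℝ) + s' + d < 0) :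
    StdBounded s' (T : 𝓓(box U₁ U₂, ℝ) →ₗ[ℝ] ℂ) := by
  intro f hf
  set t' := (t : 𝓓(offI (box U₁ U₂), ℝ) →ₗ[ℝ] ℂ)
  have hb : BoundedOnTestSets t' := boundedOnTestSets_distribution t
  let φ : 𝓓(box U₁ U₂, ℝ) := hf.toTest
  have hK := isCompact_fst_tsupport φ
  have hKU := fst_tsupport_subset φ
  obtain ⟨R, hR, hRr⟩ := exists_taylorRemainder ⌊-s - d⌋ φ
  obtain ⟨C₁, hC₁⟩ := ht.mono hs _ (isTest_coe (outerTest hχ φ))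
  obtain ⟨C₂, hC₂⟩ := exists_uniform_bound hU hχ h0 hb ht hK hKU (contDiff_taylorRemainder _ φ)
    hR hRr (fun z => fst_mem_of_taylorRemainder_ne_zero) (toNat_add_pos s d)
  -- Here `taylorTerm α φ` is exactly homogeneous of degree `|α|` in `h`, so its `M` is independent
  -- of the scale. The prefactor `r ^ (-|α|)` later turns the bound into `r ^ (s' + d)`.
  have h3 : ∀ α ∈ multiIndices d ⌊-s - d⌋, ∃ C, ∀ q ∈ Ioc (0 : ℝ) 1,
      ‖pair t' fun z => cutDiff χ q z * taylorTerm α φ z‖ ≤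
        C * q ^ (((∑ j, α j : ℕ) : ℝ) + s' + d) := fun α hαm =>
    exists_bound_of_neg hU hχ h0 hb ht hK hKU (contDiff_taylorTerm α φ)
      (M := fun x => taylorTerm α φ x.2) ((contDiff_taylorTerm α φ).comp contDiff_snd)
      (taylorTerm_scal α φ) (fun _ hz => fst_mem_of_transverseDeriv_ne_zero
        (right_ne_zero_of_mul hz)) (hα α hαm) (by linarith)
  choose! C₃ hC₃ using h3
  refine ⟨C₁ + |C₂| + ∑ α ∈ multiIndices d ⌊-s - d⌋, C₃ α, fun r hr => ?_⟩
  rw [pair_of_isTest _ (hf.dil hU hr)]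
  change ‖T (scaleTest hU r hr φ)‖ ≤ _
  refine le_of_tendsto (hT (scaleTest hU r hr φ)).norm ?_
  have h4 : ∀ᶠ ε : Ioc (0 : ℝ) 1 in comap Subtype.val (𝓝 0), (ε : ℝ) < r :=
    tendsto_comap.eventually (gt_mem_nhds hr.1)
  filter_upwards [h4] with ε hε
  obtain ⟨ε, hε1⟩ := ε
  have hq : ε / r ∈ Ioc (0 : ℝ) 1 := ⟨div_pos hε1.1 hr.1, (div_le_one hr.1).2 hε.le⟩
  -- The cut-off parameter is measured relative to `r`; the bounds are uniform in `q`, so they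
  -- survive the limit.
  obtain ⟨q, rfl⟩ : ∃ q, ε = r * q := ⟨ε / r, (mul_div_cancel₀ ε hr.1.ne').symm⟩
  rw [mul_div_cancel_left₀ q hr.1.ne'] at hq
  rw [approximation_scaleTest hU hχ h0 t _ φ hr hq hε1]
  refine (norm_sub_le _ _).trans ?_
  rw [add_mul, add_mul]
  refine add_le_add ((norm_add_le _ _).trans (add_le_add (hC₁ r hr) ?_)) ?_
  · refine (hC₂ r hr q hq).trans ?_
    refine (mul_le_mul_of_nonneg_right (le_abs_self C₂) (Real.rpow_nonneg hr.1.le _)).trans ?_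
    exact mul_le_mul_of_nonneg_left
      (Real.rpow_le_rpow_of_exponent_ge hr.1 hr.2 (by linarith)) (abs_nonneg _)
  · rw [Finset.sum_mul]
    refine (norm_sum_le _ _).trans (Finset.sum_le_sum fun α hαm => ?_)
    have hr' : (0 : ℝ) ≤ r⁻¹ ^ (∑ j, α j) := pow_nonneg (inv_nonneg.2 hr.1.le) _
    rw [norm_smul, Real.norm_of_nonneg hr']
    refine (mul_le_mul_of_nonneg_left (hC₃ α hαm r hr) hr').trans_eq ?_
    rw [add_assoc, Real.rpow_add hr.1, Real.rpow_natCast, inv_pow]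
    field_simp [(pow_pos hr.1 (∑ j, α j)).ne']

end Scaling

/-! ### Layers on the submanifold and uniqueness. -/

section Layers

lemma layerPairing_monoCLM (c : 𝓓'(U₁, ℂ)) (α : Fin d → ℕ) (φ : 𝓓(offI (box U₁ U₂), ℝ)) :
    layerPairing c α (TestFunction.monoCLM ℝ φ : 𝓓(box U₁ U₂, ℝ)) = 0 := by
  have h : traceTest (transverseDeriv α (TestFunction.monoCLM ℝ φ : 𝓓(box U₁ U₂, ℝ))) = 0 := by
    ext x
    exact transverseDeriv_monoCLM_apply α φ x
  rw [layerPairing, h]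
  exact mul_eq_zero_of_right _ (map_zero (c : 𝓓(U₁, ℝ) →ₗ[ℝ] ℂ))

lemma layerPairing_scaleTest (hU : ScaleStable (box U₁ U₂)) (c : 𝓓'(U₁, ℂ)) (α : Fin d → ℕ)
    {r : ℝ} (hr : r ∈ Ioc (0 : ℝ) 1) (φ : 𝓓(box U₁ U₂, ℝ)) :
    layerPairing c α (scaleTest hU r hr φ) = r⁻¹ ^ (∑ j, α j) • layerPairing c α φ := by
  have h : traceTest (transverseDeriv α (scaleTest hU r hr φ)) =
      r⁻¹ ^ (∑ j, α j) • traceTest (transverseDeriv α φ) := by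
    ext x
    rw [transverseDeriv_scaleTest]
    change r⁻¹ ^ (∑ j, α j) * transverseDeriv α φ (x, r⁻¹ • 0) = _
    rw [smul_zero]
    rfl
  rw [layerPairing, h, layerPairing, ← mul_smul_comm]
  congr 1
  exact map_smul (c : 𝓓(U₁, ℝ) →ₗ[ℝ] ℂ) _ _

/-- Scaling multiplies a layer of order `α` by `r ^ (-|α|)`, which is at most `r ^ (s + d)` on `(0,
1]` precisely because `|α| + s + d ≤ 0`. -/
lemma StdBounded.add_layers (hU : ScaleStable (box U₁ U₂)) {s : ℝ} {T T' : 𝓓'(box U₁ U₂, ℂ)}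
    (hT : StdBounded s (T : 𝓓(box U₁ U₂, ℝ) →ₗ[ℝ] ℂ)) {A : Finset (Fin d → ℕ)}
    (hA : ∀ α ∈ A, ((∑ j, α j : ℕ) : ℝ) + s + d ≤ 0) {c : (Fin d → ℕ) → 𝓓'(U₁, ℂ)}
    (h : ∀ φ, T' φ = T φ + ∑ α ∈ A, layerPairing (c α) α φ) :
    StdBounded s (T' : 𝓓(box U₁ U₂, ℝ) →ₗ[ℝ] ℂ) := by
  intro f hf
  obtain ⟨C, hC⟩ := hT f hf
  refine ⟨C + ∑ α ∈ A, ‖layerPairing (c α) α hf.toTest‖, fun r hr => ?_⟩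
  have h1 := hC r hr
  rw [pair_of_isTest _ (hf.dil hU hr)] at h1 ⊢
  change ‖T (scaleTest hU r hr hf.toTest)‖ ≤ _ at h1
  change ‖T' (scaleTest hU r hr hf.toTest)‖ ≤ _
  rw [h, add_mul, Finset.sum_mul]
  refine (norm_add_le _ _).trans (add_le_add h1 ((norm_sum_le _ _).trans
    (Finset.sum_le_sum fun α hα => ?_)))
  rw [layerPairing_scaleTest, norm_smul, mul_comm,
    Real.norm_of_nonneg (pow_nonneg (inv_nonneg.2 hr.1.le) _)]
  refine mul_le_mul_of_nonneg_left ?_ (norm_nonneg _)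
  rw [inv_pow, ← Real.rpow_natCast, ← Real.rpow_neg hr.1.le]
  exact Real.rpow_le_rpow_of_exponent_ge hr.1 hr.2 (by linarith [hA α hα])

/-- A distribution with bounded scaled families which vanishes off `I` annihilates functions
vanishing on `I` to a sufficiently high order. -/
lemma StdBounded.pair_cutoff_mul_eq_zero (hU : ScaleStable (box U₁ U₂)) (hχ : IsCutoff U₁ U₂ χ)
    (h0 : 0 ∈ U₂) {s : ℝ} {S : 𝓓(box U₁ U₂, ℝ) →ₗ[ℝ] ℂ} (hb : BoundedOnTestSets S)
    (hS : StdBounded s S) (hS0 : ∀ f, IsTest (offI (box U₁ U₂)) f → pair S f = 0)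
    {K : Set (EuclideanSpace ℝ (Fin n))} (hK : IsCompact K) (hKU : K ⊆ U₁) {Φ : Space n d → ℝ}
    {M : ℝ × Space n d → ℝ} {k : ℕ} (hΦ : ContDiff ℝ ∞ Φ) (hM : ContDiff ℝ ∞ M)
    (hΦM : ∀ r z, Φ (scal r z) = r ^ k * M (r, z)) (hΦK : ∀ z, Φ z ≠ 0 → z.1 ∈ K)
    (hk : 0 < k + s + d) : pair S (fun z => χ z * Φ z) = 0 := by
  obtain ⟨K', hK', hK'U, H⟩ := hχ.isCompact_support h0 hK hKU
  obtain ⟨B, hB⟩ := exists_testSet_family (M := fun x : ℝ × Space n d => χ x.2 * M x)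
    ((hχ.smooth.comp contDiff_snd).mul hM) (isCompact_Icc (a := (0 : ℝ)) (b := 1)) hK'
  obtain ⟨C, -, hC⟩ := hS.uniform hb hU hK' hK'U B
  have hbound : ∀ q ∈ Ioc (0 : ℝ) 1, ‖pair S fun z => χ z * Φ z‖ ≤ C * q ^ (k + s + d) := by
    intro q hq
    have hmem : (fun z => χ z * M (q, z)) ∈ testSet K' B := hB q ⟨hq.1.le, hq.2⟩ fun z hz => by
      refine H z (left_ne_zero_of_mul hz) (hΦK (scal q z) ?_)
      rw [hΦM]
      exact mul_ne_zero (pow_ne_zero _ hq.1.ne') (right_ne_zero_of_mul hz)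
    have ht := isTest_of_mem_testSet hK' hK'U hmem
    have h1 := isTest_cutDiff_mul hU hχ h0 hK hKU hΦ hΦK hq
    -- The first summand is supported off `I`, so `S` kills it; the second is `q ^ k` times a
    -- dilation of a function from a bounded set. As `q` is arbitrary, the pairing is zero.
    have h2 : (fun z => χ z * Φ z) = fun z => cutDiff χ q z * Φ z +
        q ^ k * dil q (fun z => χ z * M (q, z)) z := by
      funext z
      have h3 : Φ z = q ^ k * M (q, scal q⁻¹ z) := by
        rw [← hΦM, scal_scal, mul_inv_cancel₀ hq.1.ne', scal_one]
      rw [dil_apply, cutDiff, h3]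
      ring
    have h4 := hC _ hmem q hq
    rw [h2, pair_add S (h1.mono (W' := box U₁ U₂) fun _ hz => And.left hz) ((ht.dil hU hq).smul _), hS0 _ h1, zero_add,
      pair_smul S (ht.dil hU hq), norm_smul, norm_pow, Real.norm_of_nonneg hq.1.le,
      add_assoc, Real.rpow_add hq.1, Real.rpow_natCast, mul_left_comm]
    exact mul_le_mul_of_nonneg_left h4 (pow_nonneg hq.1.le _)
  have hlim : Tendsto (fun q : ℝ => C * q ^ ((k : ℝ) + s + d)) (𝓝[>] 0) (𝓝 0) := by
    have := (Real.continuousAt_rpow_const 0 ((k : ℝ) + s + d) (Or.inr hk.le)).tendsto.const_mul C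
    rw [Real.zero_rpow hk.ne', mul_zero] at this
    exact this.mono_left nhdsWithin_le_nhds
  refine norm_le_zero_iff.1 (ge_of_tendsto hlim ?_)
  filter_upwards [Ioc_mem_nhdsGT one_pos] with q hq
  exact hbound q hq

/-- Two extensions with bounded scaled families differ by layers on `I`. -/
theorem exists_layers (hU : ScaleStable (box U₁ U₂)) (hχ : IsCutoff U₁ U₂ χ) (h0 : 0 ∈ U₂)
    {s : ℝ} {m : ℤ} {t : 𝓓'(offI (box U₁ U₂), ℂ)} {T T' : 𝓓'(box U₁ U₂, ℂ)}
    (hT : StdBounded s (T : 𝓓(box U₁ U₂, ℝ) →ₗ[ℝ] ℂ)) (hTt : IsExtension t T)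
    (hT' : StdBounded s (T' : 𝓓(box U₁ U₂, ℝ) →ₗ[ℝ] ℂ)) (hTt' : IsExtension t T')
    (hm : 0 < ((m + 1).toNat : ℝ) + s + d) :
    ∃ c : (Fin d → ℕ) → 𝓓'(U₁, ℂ), ∀ φ : 𝓓(box U₁ U₂, ℝ),
      T φ = T' φ + ∑ α ∈ multiIndices d m, layerPairing (c α) α φ := by
  let S : 𝓓(box U₁ U₂, ℝ) →ₗ[ℝ] ℂ :=
    (T : 𝓓(box U₁ U₂, ℝ) →ₗ[ℝ] ℂ) + (-1 : ℝ) • (T' : 𝓓(box U₁ U₂, ℝ) →ₗ[ℝ] ℂ)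
  have hSapply : ∀ φ, S φ = T φ - T' φ := fun φ => by
    change T φ + (-1 : ℝ) • T' φ = _
    rw [neg_one_smul, sub_eq_add_neg]
  have hSb : BoundedOnTestSets S :=
    (boundedOnTestSets_distribution T).add ((boundedOnTestSets_distribution T').smul _)
  have hS : StdBounded s S := hT.add hU (hT'.smul hU _)
  have hS0 : ∀ f, IsTest (offI (box U₁ U₂)) f → pair S f = 0 := by
    intro f hf
    have h1 := hTt hf.toTest
    have h2 := hTt' hf.toTest
    rw [← hf.coe_toTest, ← coe_monoCLM_offI, pair_coe, hSapply, h1, h2, sub_self]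
  let A := fun α : Fin d → ℕ => pullMul_cutoff hχ h0 (contDiff_mon α)
  have hA : ∀ α, Continuous (S ∘ₗ (A α).lin) := fun α => ((A α).bounded hSb).continuous
  -- The coefficient is `g ↦ (-1)^|α| S (χ h^α / α! g(x))`; the sign cancels the one in
  -- `layerPairing`.
  refine ⟨fun α => toDistribution ((-1 : ℝ) ^ (∑ j, α j) • (S ∘ₗ (A α).lin))
    ((hA α).const_smul _), fun φ => ?_⟩
  have hK := isCompact_fst_tsupport φ
  have hKU := fst_tsupport_subset φ
  have hlayer : ∀ α, layerPairing (toDistribution ((-1 : ℝ) ^ (∑ j, α j) • (S ∘ₗ (A α).lin))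
      ((hA α).const_smul _)) α φ = S ((A α).lin (traceTest (transverseDeriv α φ))) := by
    intro α
    rw [layerPairing, toDistribution_apply, LinearMap.smul_apply, LinearMap.comp_apply,
      Complex.real_smul, ← mul_assoc]
    push_cast
    rw [← mul_pow]
    simp
  have hterm : ∀ α, ((A α).lin (traceTest (transverseDeriv α φ)) : Space n d → ℝ) =
      fun z => χ z * taylorTerm α φ z := fun α => by
    funext z
    exact mul_assoc _ _ _
  have ht1 : IsTest (offI (box U₁ U₂)) (fun z => (1 - χ z) * φ z) := isTest_coe (outerTest hχ φ)
  have ht2 : IsTest (box U₁ U₂) (fun z => χ z * taylorRemainder m φ z) := by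
    obtain ⟨K', hK', hK'U, H⟩ := hχ.isCompact_support h0 hK hKU
    exact .of_support (hχ.smooth.mul (contDiff_taylorRemainder m φ)) hK' hK'U fun z hz =>
      H z (left_ne_zero_of_mul hz) (fst_mem_of_taylorRemainder_ne_zero (right_ne_zero_of_mul hz))
  have ht3 : ∀ α ∈ multiIndices d m, IsTest (box U₁ U₂) (fun z => χ z * taylorTerm α φ z) :=
    fun α _ => hterm α ▸ isTest_coe _
  obtain ⟨R, hR, hRr⟩ := exists_taylorRemainder m φ
  have hzero := hS.pair_cutoff_mul_eq_zero hU hχ h0 hSb hS0 hK hKU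
    (contDiff_taylorRemainder m φ) hR hRr (fun z => fst_mem_of_taylorRemainder_ne_zero) hm
  -- `S` kills the first summand by its support and the second by its order of vanishing on `I`.
  have hsplit : (φ : Space n d → ℝ) = fun z => (1 - χ z) * φ z + χ z * taylorRemainder m φ z +
      ∑ α ∈ multiIndices d m, χ z * taylorTerm α φ z := by
    funext z
    rw [taylorRemainder_eq_sub, ← Finset.mul_sum]
    ring
  have ht1' : IsTest (box U₁ U₂) (fun z => (1 - χ z) * φ z) := ht1.mono fun _ hz => And.left hz
  have hmain : S φ = ∑ α ∈ multiIndices d m, S ((A α).lin (traceTest (transverseDeriv α φ))) := by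
    rw [← pair_coe S φ, hsplit, pair_add S (ht1'.add ht2) (.sum ht3), pair_add S ht1' ht2,
      hS0 _ ht1, hzero, pair_sum S ht3, zero_add, zero_add]
    refine Finset.sum_congr rfl fun α _ => ?_
    rw [← hterm, pair_coe]
  rw [Finset.sum_congr rfl fun α _ => hlayer α, ← hmain, hSapply, add_sub_cancel]

end Layers

/-! ### The case without points of the submanifold, and the conclusion. -/

section Disjoint

/-- Transport of a distribution along an equality of open sets. -/
lemma exists_transport {W W' : Opens (Space n d)} (h : W = W') (t : 𝓓'(W, ℂ)) :
    ∃ T : 𝓓'(W', ℂ), (∀ (φ : 𝓓(W, ℝ)) (φ' : 𝓓(W', ℝ)), (φ : Space n d → ℝ) = φ' → T φ' = t φ) ∧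
      ∀ s, t ∈ weaklyHomogeneous s W → T ∈ weaklyHomogeneous s W' := by
  subst h
  exact ⟨t, fun φ φ' h => congrArg t (DFunLike.coe_injective h).symm, fun _ => id⟩

lemma offI_box_of_notMem (h0 : 0 ∉ U₂) : offI (box U₁ U₂) = box U₁ U₂ := by
  ext z
  refine ⟨fun h => h.1, fun h => ⟨h, fun hz => h0 ?_⟩⟩
  have hz' : z.2 = 0 := hz
  exact hz' ▸ h.2

lemma exists_eq_monoCLM (h0 : 0 ∉ U₂) (φ : 𝓓(box U₁ U₂, ℝ)) :
    ∃ φ₀ : 𝓓(offI (box U₁ U₂), ℝ), φ = TestFunction.monoCLM ℝ φ₀ := by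
  have h : IsTest (offI (box U₁ U₂)) φ :=
    ⟨φ.contDiff, φ.hasCompactSupport, φ.tsupport_subset.trans (by rw [offI_box_of_notMem h0])⟩
  exact ⟨h.toTest, DFunLike.coe_injective (coe_monoCLM_offI h.toTest).symm⟩

end Disjoint

/-- Both cases of the definition are treated at once: all `s' ≤ s` are allowed, with strict
inequality only when `-s-d` is a natural number. -/
lemma mem_extensionSpace_of {s : ℝ} {U : Opens (Space n d)} {T : 𝓓'(U, ℂ)}
    (h : ∀ s' ≤ s, ((∃ k : ℕ, -s - d = k) → s' < s) → T ∈ weaklyHomogeneous s' U) :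
    T ∈ extensionSpace s U :=
  ⟨fun hk => h s le_rfl fun hk' => (hk hk').elim, fun _ s' hs' => h s' hs'.le fun _ => hs'⟩

/-- `|α| ≤ -s-d`, and equality makes `-s-d` a natural number, in which case `s' < s` restores
strictness. -/
lemma add_neg_of_mem_multiIndices {s s' : ℝ} (hs : s' ≤ s)
    (hs' : (∃ k : ℕ, -s - d = k) → s' < s) {α : Fin d → ℕ} (hα : α ∈ multiIndices d ⌊-s - d⌋) :
    ((∑ j, α j : ℕ) : ℝ) + s' + d < 0 := by
  have h1 : ((∑ j, α j : ℕ) : ℝ) ≤ -s - d := by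
    have := Int.le_floor.1 (mem_multiIndices.1 hα)
    exact_mod_cast this
  rcases h1.lt_or_eq with h | h
  · linarith
  · linarith [hs' ⟨_, h.symm⟩]

/-- Extensions and the canonical extension when `I` meets `U₁ × U₂`. -/
lemma exists_extension_of_mem (hU : ScaleStable (box U₁ U₂)) (hχ : IsCutoff U₁ U₂ χ)
    (h0 : 0 ∈ U₂) {s : ℝ} {t : 𝓓'(offI (box U₁ U₂), ℂ)}
    (ht : t ∈ weaklyHomogeneous s (offI (box U₁ U₂))) :
    ∃ tbar : 𝓓'(box U₁ U₂, ℂ), IsCanonicalExtension hU hχ s t tbar ∧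
      tbar ∈ extensionSpace s (box U₁ U₂) ∧
      ∀ T : 𝓓'(box U₁ U₂, ℂ), (IsExtension t T ∧ T ∈ extensionSpace s (box U₁ U₂)) ↔
        ∃ c : (Fin d → ℕ) → 𝓓'(U₁, ℂ), ∀ φ : 𝓓(box U₁ U₂, ℝ),
          T φ = tbar φ + ∑ α ∈ multiIndices d ⌊-s - d⌋, layerPairing (c α) α φ := by
  have ht' := stdBounded_offI hU h0 ht
  obtain ⟨tbar, hc⟩ := exists_canonicalExtension hU hχ h0 ht'
  have hstd : ∀ s' ≤ s, ((∃ k : ℕ, -s - d = k) → s' < s) →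
      StdBounded s' (tbar : 𝓓(box U₁ U₂, ℝ) →ₗ[ℝ] ℂ) := fun s' hs hs' =>
    hc.stdBounded h0 ht' hs fun α hα => add_neg_of_mem_multiIndices hs hs' hα
  refine ⟨tbar, hc, mem_extensionSpace_of fun s' hs hs' =>
    (hstd s' hs hs').weaklyHomogeneous hU, fun T => ⟨fun ⟨hTt, hT⟩ => ?_, fun ⟨c, h⟩ => ⟨?_, ?_⟩⟩⟩
  · have hpos := toNat_add_pos s d
    -- When `-s-d` is a natural number, `s` is lowered by half of the positive margin `k + s + d`,
    -- so that both extensions scale with degree `s'` and `k + s' + d` is still positive.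
    obtain ⟨s', hs, hs', hTs, hs'pos⟩ : ∃ s' ≤ s, ((∃ k : ℕ, -s - d = k) → s' < s) ∧
        T ∈ weaklyHomogeneous s' (box U₁ U₂) ∧
        0 < ((⌊-s - d⌋ + 1).toNat : ℝ) + s' + d := by
      by_cases hk : ∃ k : ℕ, -s - d = k
      · refine ⟨s - (((⌊-s - d⌋ + 1).toNat : ℝ) + s + d) / 2, by linarith, fun _ => by linarith,
          hT.2 hk _ (by linarith), by linarith⟩
      · exact ⟨s, le_rfl, fun h => (hk h).elim, hT.1 hk, hpos⟩
    exact exists_layers hU hχ h0 (stdBounded_box hU h0 hTs) hTt (hstd s' hs hs')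
      hc.isExtension hs'pos
  · intro φ
    rw [h]
    simp only [layerPairing_monoCLM, Finset.sum_const_zero, add_zero]
    exact hc.isExtension φ
  · exact mem_extensionSpace_of fun s' hs hs' =>
      ((hstd s' hs hs').add_layers hU
        (fun α hα => (add_neg_of_mem_multiIndices hs hs' hα).le) h).weaklyHomogeneous hU

/-- Extensions and the canonical extension when `I` does not meet `U₁ × U₂`. -/
lemma exists_extension_of_notMem (hU : ScaleStable (box U₁ U₂)) (hχ : IsCutoff U₁ U₂ χ)
    (h0 : 0 ∉ U₂) {s : ℝ} {t : 𝓓'(offI (box U₁ U₂), ℂ)}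
    (ht : t ∈ weaklyHomogeneous s (offI (box U₁ U₂))) :
    ∃ tbar : 𝓓'(box U₁ U₂, ℂ), IsCanonicalExtension hU hχ s t tbar ∧
      tbar ∈ extensionSpace s (box U₁ U₂) ∧
      ∀ T : 𝓓'(box U₁ U₂, ℂ), (IsExtension t T ∧ T ∈ extensionSpace s (box U₁ U₂)) ↔
        ∃ c : (Fin d → ℕ) → 𝓓'(U₁, ℂ), ∀ φ : 𝓓(box U₁ U₂, ℝ),
          T φ = tbar φ + ∑ α ∈ multiIndices d ⌊-s - d⌋, layerPairing (c α) α φ := by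
  obtain ⟨tbar, h1, h2⟩ := exists_transport (offI_box_of_notMem (U₁ := U₁) h0) t
  have hext : IsExtension t tbar := fun φ => h1 φ _ (coe_monoCLM_offI φ).symm
  have hmem : tbar ∈ extensionSpace s (box U₁ U₂) :=
    mem_extensionSpace_of fun s' hs _ => weaklyHomogeneous_mono hs (h2 s ht)
  refine ⟨tbar, fun φ => ?_, hmem, fun T => ⟨fun ⟨hT, _⟩ => ⟨0, fun φ => ?_⟩, fun ⟨c, h⟩ => ?_⟩⟩
  · obtain ⟨φ₀, rfl⟩ := exists_eq_monoCLM h0 φ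
    rw [hext]
    exact tendsto_approximation_monoCLM hU hχ _ t φ₀
  · obtain ⟨φ₀, rfl⟩ := exists_eq_monoCLM h0 φ
    simp only [layerPairing_monoCLM, Finset.sum_const_zero, add_zero]
    rw [hT, hext]
  · have : T = tbar := by
      refine DFunLike.ext _ _ fun φ => ?_
      obtain ⟨φ₀, rfl⟩ := exists_eq_monoCLM h0 φ
      simp only [h, layerPairing_monoCLM, Finset.sum_const_zero, add_zero]
    exact this ▸ ⟨hext, hmem⟩

end

end TransverseScaling

end

theorem mainTheorem10 (n d : ℕ)
    (U₁ : Opens (EuclideanSpace ℝ (Fin n))) (U₂ : Opens (EuclideanSpace ℝ (Fin d)))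
    (hU : ScaleStable (box U₁ U₂))
    (χ : Space n d → ℝ) (hχ : IsCutoff U₁ U₂ χ)
    (s : ℝ) (t : 𝓓'(offI (box U₁ U₂), ℂ)) (ht : t ∈ weaklyHomogeneous s (offI (box U₁ U₂))) :
    ∃ tbar : 𝓓'(box U₁ U₂, ℂ),
      IsCanonicalExtension hU hχ s t tbar ∧
      (IsExtension t tbar ∧ tbar ∈ extensionSpace s (box U₁ U₂)) ∧
      (∀ T : 𝓓'(box U₁ U₂, ℂ),
        (IsExtension t T ∧ T ∈ extensionSpace s (box U₁ U₂)) ↔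
          ∃ c : (Fin d → ℕ) → 𝓓'(U₁, ℂ), ∀ φ : 𝓓(box U₁ U₂, ℝ),
            T φ = tbar φ + ∑ α ∈ multiIndices d ⌊-s - d⌋, layerPairing (c α) α φ) ∧
      (0 < s + d →
        ∀ T : 𝓓'(box U₁ U₂, ℂ),
          IsExtension t T → T ∈ weaklyHomogeneous s (box U₁ U₂) → T = tbar) := by
  obtain ⟨tbar, h1, h2, h3⟩ : ∃ tbar : 𝓓'(box U₁ U₂, ℂ), IsCanonicalExtension hU hχ s t tbar ∧
      tbar ∈ extensionSpace s (box U₁ U₂) ∧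
      ∀ T : 𝓓'(box U₁ U₂, ℂ), (IsExtension t T ∧ T ∈ extensionSpace s (box U₁ U₂)) ↔
        ∃ c : (Fin d → ℕ) → 𝓓'(U₁, ℂ), ∀ φ : 𝓓(box U₁ U₂, ℝ),
          T φ = tbar φ + ∑ α ∈ multiIndices d ⌊-s - d⌋, layerPairing (c α) α φ := by
    by_cases h0 : 0 ∈ U₂
    · exact exists_extension_of_mem hU hχ h0 ht
    · exact exists_extension_of_notMem hU hχ h0 ht
  refine ⟨tbar, h1, ⟨h1.isExtension, h2⟩, h3, fun hs T hT hTs => ?_⟩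
  -- For `s + d > 0` the extension space is `E_{s,I}(U)` itself, and `m < 0` leaves no layers.
  have hk : ¬ ∃ k : ℕ, -s - d = k := by
    rintro ⟨k, hk⟩
    linarith [k.cast_nonneg (α := ℝ)]
  obtain ⟨c, hc⟩ := (h3 T).1 ⟨hT, fun _ => hTs, fun h => (hk h).elim⟩
  have hm : ⌊-s - d⌋ < 0 := Int.floor_lt.2 (by push_cast; linarith)
  refine DFunLike.ext _ _ fun φ => ?_
  rw [hc, multiIndices_eq_empty hm, Finset.sum_empty, add_zero]
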